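/- **Setting.** Let $k,n\ge 0$ be integers and $\kappa\in\mathbb C$, $\kappa\ne0$. For $r\ge0$ let $\mathfrak X_r$ be the algebra of polynomials in anticommuting variables $x_1,\dots,x_r$ over $\mathbb C$, with left derivations $\partial_a$, and let $e_{ab}\in\mathfrak{gl}_r$ act on it by $x_a\partial_b$. Then $\mathfrak X_r=V_\bullet=\bigoplus_{l=0}^rV_l$, where $V_l$ is the (irreducible) space of homogeneous polynomials of degree $l$, with highest weight vector $x_1\cdots x_l$. On $(\mathfrak X_r)^{\otimes s}$ write $g_{(i)}$ for $g$ acting in the $i$-th factor, $(g\otimes h)_{(ij)}=g_{(i)}h_{(j)}$ for $i\neq j$, and $e_{ab}=\sum_i(e_{ab})_{(i)}$. Put $\Omega=\sum_{a,b}e_{ab}\otimes e_{ba}$, $\Omega^{+}=\frac12\sum_ae_{aa}\otimes e_{aa}+\sum_{a<b}e_{ab}\otimes e_{ba}$, $\Omega^-=\Omega-\Omega^+$, $z_{ij}=z_i-z_j$, $\lambda_{ab}=\lambda_a-\lambda_b$. For functions of $(z,\lambda)\in\mathbb C^s\times\mathbb C^r$ with values in $(\mathfrak X_r)^{\otimes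 s}$ define, for $1\le i\le s$, $1\le a\le r$, $$\nabla_{z_i}(z,\lambda,\kappa)=\kappa\partial_{z_i}-\sum_{a}\lambda_a(e_{aa})_{(i)}-\sum_{j\ne i}\frac{\Omega_{(ij)}}{z_i-z_j},$$ $$\widehat\nabla_{z_i}(z,\lambda,\kappa)=\kappa z_i\partial_{z_i}-\sum_a\Big(\lambda_a-\frac{e_{aa}}2\Big)(e_{aa})_{(i)}-\sum_{j\ne i}\frac{z_i\Omega^+_{(ij)}+z_j\Omega^-_{(ij)}}{z_i-z_j},$$ $$D_{\lambda_a}(z,\lambda,\kappa)=\kappa\partial_{\lambda_a}-\sum_iz_i(e_{aa})_{(i)}-\sum_{b\ne a}\frac{e_{ab}e_{ba}-e_{aa}}{\lambda_a-\lambda_b},$$ $$\widehat D_{\lambda_a}(z,\lambda,\kappa)=\kappa\lambda_a\partial_{\lambda_a}+\frac{e_{aa}^2}2-\sum_iz_i(e_{aa})_{(i)}-\sum_b\sum_{i<j}(e_{ab})_{(i)}(e_{ba})_{(j)}-\sum_{b\ne a}\frac{\lambda_b}{\lambda_a-\lambda_b}(e_{ab}e_{ba}-e_{aa}),$$ $$B_{ab}(t)=1+\sum_{q\ge1}\frac{e_{ba}^qe_{ab}^q}{q!}\prod_{j=1}^q(t-e_{aa}+e_{bb}-j)^{-1}\qquad(a\ne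 b),$$ $$Q_{\lambda_a}(z,\lambda,\kappa)=\big(B_{ar}(\lambda_{ar})\cdots B_{a,a+1}(\lambda_{a,a+1})\big)^{-1}\prod_{i}\big(z_i^{-e_{aa}}\big)_{(i)}\,B_{1a}(\lambda_{1a}-\kappa)\cdots B_{a-1,a}(\lambda_{a-1,a}-\kappa)\,T_{\lambda_a},$$ $$Z_{z_i}(z,\lambda,\kappa)=\big(R_{is}(z_{is})\cdots R_{i,i+1}(z_{i,i+1})\big)^{-1}\prod_a\big(\lambda_a^{-e_{aa}}\big)_{(i)}\,R_{1i}(z_{1i}-\kappa)\cdots R_{i-1,i}(z_{i-1,i}-\kappa)\,T_{z_i},$$ where $T_uf(u)=f(u+\kappa)$ and $R_{ij}(t)=R(t)_{(ij)}$. Here, for $t\notin\mathbb Z$, $R(t)\in\operatorname{End}(V_\bullet\otimes V_\bullet)$ is the operator which preserves every $V_l\otimes V_m$, commutes with $g\otimes1+1\otimes g$ for all $g\in\mathfrak{gl}_r$, satisfies $$R(t)\Big(te_{ab}\otimes1+\sum_ce_{ac}\otimes e_{cb}\Big)=\Big(te_{ab}\otimes1+\sum_ce_{cb}\otimes e_{ac}\Big)R(t),$$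 and is normalized by $R(t)\,v\otimes w=\nu_{l,m}(t)\,v\otimes w$ for the highest weight vectors $v\in V_l$, $w\in V_m$. Two choices of the normalization, together with operators $C_{ab}(t)$ ($a\ne b$), are considered: * (A) $\displaystyle\nu_{l,m}(t)=\prod_{q=0}^{\min(l,m)-1}\frac{t+l-q}{t-m+q}$ and $\displaystyle C_{ab}(t)=\frac{\Gamma(t+e_{aa}+1)\,\Gamma(t-e_{bb})}{\Gamma(t+e_{aa}-e_{bb}+1)\,\Gamma(t)}$; * (B) $\nu_{l,m}(t)=1$ and $\displaystyle C_{ab}(t)=\frac{t}{t+\min(0,e_{aa}-e_{bb})}$. Finally let $\displaystyle N_a(\lambda)=\prod_{b<a}C_{ba}(\lambda_{ba}-\kappa)\Big/\prod_{b>a}C_{ab}(\lambda_{ab})$. Let $\mathfrak P_{kn}$ be the space of polynomials in $kn$ anticommuting variables $x_{ai}$, $1\le a\le k$, $1\le i\le n$. It is identified with $(\mathfrak X_k)^{\otimes n}$ by $p_1\otimes\dots\otimes p_n\mapsto p_1(x_{11},\dots,x_{k1})\cdots p_n(x_{1n},\dots,x_{kn})$, and with $(\mathfrak X_n)^{\otimes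 k}$ by $p_1\otimes\dots\otimes p_k\mapsto p_1(x_{11},\dots,x_{1n})\cdots p_k(x_{k1},\dots,x_{kn})$. Superscripts $\langle k\rangle$ and $\langle n\rangle$ mark the objects for $\mathfrak{gl}_k$ ($r=k$, $s=n$) and for $\mathfrak{gl}_n$ ($r=n$, $s=k$). Write $F\backsimeq G$ if $F$ and $G$ act in the same way on the $\mathfrak P_{kn}$-valued functions of $z\in\mathbb C^n$, $\lambda\in\mathbb C^k$; an operator with changed arguments, such as $D_{z_i}^{\langle n\rangle}(\lambda,-z,-\kappa)$, is the operator obtained by the change of variables, the derivatives and shifts included. Let $\mathbf 1=(1,\dots,1)$. **Theorem.** For $t\notin\mathbb Z$ the operators $R^{\langle k\rangle}(t)$ and $R^{\langle n\rangle}(t)$ exist and are unique, in each of the normalizations (A), (B). For all $i=1,\dots,n$ and $a=1,\dots,k$: $$\nabla^{\langle k\rangle}_{z_i}(z,\lambda,\kappa)\backsimeq D^{\langle n\rangle}_{z_i}(\lambda,-z,-\kappa),\tag{1}$$ $$\nabla^{\langle n\rangle}_{\lambda_a}(\lambda,z,\kappa)\backsimeq D^{\langle k\rangle}_{\lambda_a}(z,-\lambda,-\kappa),\tag{2}$$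 $$\widehat\nabla^{\langle k\rangle}_{z_i}(z,\lambda,\kappa)\backsimeq-\widehat D^{\langle n\rangle}_{z_i}(-\lambda+\mathbf 1,z,-\kappa),\tag{3}$$ $$\widehat\nabla^{\langle n\rangle}_{\lambda_a}(\lambda,z,\kappa)\backsimeq-\widehat D^{\langle k\rangle}_{\lambda_a}(-z+\mathbf 1,\lambda,-\kappa),\tag{4}$$ and, both in the case (A) and in the case (B), $$Z^{\langle k\rangle}_{z_i}(z,\lambda,\kappa)\backsimeq N_i^{\langle n\rangle}(z)\,Q^{\langle n\rangle}_{z_i}(\lambda,-z,-\kappa),\tag{5}$$ $$Z^{\langle n\rangle}_{\lambda_a}(\lambda,z,\kappa)\backsimeq N_a^{\langle k\rangle}(\lambda)\,Q^{\langle k\rangle}_{\lambda_a}(z,-\lambda,-\kappa).\tag{6}$$ Moreover, in both cases, $R^{\langle k\rangle}_{ij}(t)\backsimeq C^{\langle n\rangle}_{ij}(t)B^{\langle n\rangle}_{ij}(-t)$ for $i\ne j$ and $R^{\langle n\rangle}_{ab}(t)\backsimeq C^{\langle k\rangle}_{ab}(t)B^{\langle k\rangle}_{ab}(-t)$ for $a\neq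 b$, when $t\notin\mathbb Z$. The relations hold where the coefficients are defined: (1), (3) for functions differentiable in $z_i$ at the point considered and $z_j\ne z_i$ for $j\neq i$, and likewise (2), (4) with $\lambda$ in place of $z$; (5) for all functions if $z_{ij}\notin\mathbb Z$ for $j>i$, $z_{ji}-\kappa\notin\mathbb Z$ for $j<i$, and all $\lambda_b\ne0$; (6) for all functions if $\lambda_{ab}\notin\mathbb Z$ for $b>a$, $\lambda_{ba}-\kappa\notin\mathbb Z$ for $b<a$, and all $z_j\ne0$. -/

import Mathlib

noncomputable section

namespace GLDuality

open scoped TensorProduct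

/-! ### Anticommuting polynomials -/

/-- Polynomials over `ℂ` in anticommuting variables `x_j`, `j ∈ J`. -/
abbrev Grass (J : Type) : Type := ExteriorAlgebra ℂ (J → ℂ)

/-- The variable `x_j`. -/
def xvar {J : Type} [DecidableEq J] (j : J) : Grass J := ExteriorAlgebra.ι ℂ (Pi.single j (1 : ℂ))

/-- The left derivation `∂_j`: it kills the monomials without `x_j`, and `∂_j (x_j g) = g` for
such monomials `g`. -/
def pdx {J : Type} (j : J) : Module.End ℂ (Grass J) :=
  CliffordAlgebra.contractLeft (LinearMap.proj j : Module.Dual ℂ (J → ℂ))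

/-- The substitution of variables `p(x_1, …, x_r) ↦ p(x_{f 1}, …, x_{f r})`. -/
def substVar {r : ℕ} {J : Type} [DecidableEq J] (f : Fin r → J) : Grass (Fin r) →ₐ[ℂ] Grass J :=
  ExteriorAlgebra.map (Fintype.linearCombination ℂ (fun a => (Pi.single (f a) (1 : ℂ) : J → ℂ)))

/-- The `s`-fold tensor power of the space `𝔛_r` of polynomials in `x_1, …, x_r`. -/
abbrev TP (r s : ℕ) : Type := ⨂[ℂ] _ : Fin s, Grass (Fin r)

/-- `p_1 ⊗ ⋯ ⊗ p_s ↦ p_1(x_{f 1 1}, …, x_{f 1 r}) ⋯ p_s(x_{f s 1}, …, x_{f s r})`. -/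
def prodMap {r s : ℕ} {J : Type} [DecidableEq J] (f : Fin s → Fin r → J) : TP r s →ₗ[ℂ] Grass J :=
  PiTensorProduct.lift ((MultilinearMap.mkPiAlgebraFin ℂ s (Grass J)).compLinearMap
    (fun i => (substVar (f i)).toLinearMap))

theorem prodMap_tprod {r s : ℕ} {J : Type} [DecidableEq J] (f : Fin s → Fin r → J)
    (p : Fin s → Grass (Fin r)) :
    prodMap f (PiTensorProduct.tprod ℂ p) = (List.ofFn (fun i => substVar (f i) (p i))).prod := by
  simp [prodMap]

theorem iota_mul_comm {M : Type} [AddCommGroup M] [Module ℂ M] (m : M) (y : ExteriorAlgebra ℂ M) :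
    ExteriorAlgebra.ι ℂ m * y = CliffordAlgebra.involute y * ExteriorAlgebra.ι ℂ m := by
  induction y using CliffordAlgebra.left_induction with
  | algebraMap c => simp [Algebra.commutes]
  | add x y hx hy => rw [mul_add, hx, hy, map_add, add_mul]
  | ι_mul x v hx =>
    have h : ExteriorAlgebra.ι ℂ m * ExteriorAlgebra.ι ℂ v
        = - (ExteriorAlgebra.ι ℂ v * ExteriorAlgebra.ι ℂ m) :=
      eq_neg_of_add_eq_zero_left (ExteriorAlgebra.ι_add_mul_swap m v)
    change ExteriorAlgebra.ι ℂ m * (ExteriorAlgebra.ι ℂ v * x) =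
      CliffordAlgebra.involute (ExteriorAlgebra.ι ℂ v * x) * ExteriorAlgebra.ι ℂ m
    rw [← mul_assoc, h, neg_mul, mul_assoc, hx, map_mul]
    erw [CliffordAlgebra.involute_ι]
    rw [← mul_assoc, neg_mul, neg_mul]

theorem involute_substVar {r : ℕ} {J : Type} [DecidableEq J] (f : Fin r → J) (p : Grass (Fin r)) :
    CliffordAlgebra.involute (substVar f p) = substVar f (CliffordAlgebra.involute p) := by
  have h : (CliffordAlgebra.involute).comp (substVar f)
      = (substVar f).comp (CliffordAlgebra.involute) := by
    apply ExteriorAlgebra.hom_ext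
    ext v
    simp [substVar]
  exact DFunLike.congr_fun h p

theorem mul_ofFn_prod {A : Type} [Monoid A] (c : A) : ∀ {s : ℕ} (q q' : Fin s → A) (i : Fin s),
    (∀ j, c * q j = q' j * c) →
    c * (List.ofFn q).prod =
      (List.ofFn (fun j => if j < i then q' j else if j = i then c * q j else q j)).prod := by
  intro s
  induction s with
  | zero => intro q q' i; exact i.elim0
  | succ s ih =>
    intro q q' i h
    rw [List.ofFn_succ, List.ofFn_succ, List.prod_cons, List.prod_cons]
    induction i using Fin.cases with
    | zero => simp [mul_assoc, Fin.succ_ne_zero]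
    | succ i =>
      rw [← mul_assoc, h 0, mul_assoc, ih (fun j => q j.succ) (fun j => q' j.succ) i
        (fun j => h j.succ)]
      simp

theorem prodMap_surjective {r s : ℕ} {J : Type} [DecidableEq J] [Fintype J]
    (f : Fin s → Fin r → J) (hf : ∀ j, ∃ i a, f i a = j) : Function.Surjective (prodMap f) := by
  have hx : ∀ (j : J) (t : TP r s), ∃ t', prodMap f t' = xvar j * prodMap f t := by
    intro j t
    obtain ⟨i, a, rfl⟩ := hf j
    induction t using PiTensorProduct.induction_on with
    | smul_tprod c p =>
      refine ⟨c • PiTensorProduct.tprod ℂ (fun j => if j < i then CliffordAlgebra.involute (p j)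
        else if j = i then xvar a * p j else p j), ?_⟩
      rw [map_smul, map_smul, prodMap_tprod, prodMap_tprod, mul_smul_comm,
        mul_ofFn_prod (xvar (f i a)) _ (fun j => CliffordAlgebra.involute (substVar (f j) (p j))) i
          (fun j => iota_mul_comm _ _)]
      congr 4
      funext j
      split_ifs with h1 h2
      · rw [involute_substVar]
      · subst h2
        rw [map_mul]
        congr 1
        simp [substVar, xvar, Fintype.linearCombination_apply, Pi.single_apply]
      · rfl
    | add x y hx hy =>
      obtain ⟨x', hx'⟩ := hx
      obtain ⟨y', hy'⟩ := hy
      exact ⟨x' + y', by rw [map_add, map_add, mul_add, hx', hy']⟩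
  intro y
  induction y using CliffordAlgebra.left_induction with
  | algebraMap c =>
    refine ⟨c • PiTensorProduct.tprod ℂ (fun _ => 1), ?_⟩
    rw [map_smul, prodMap_tprod]
    simp [Algebra.algebraMap_eq_smul_one]
  | add x y hx hy =>
    obtain ⟨x', hx'⟩ := hx
    obtain ⟨y', hy'⟩ := hy
    exact ⟨x' + y', by rw [map_add, hx', hy']⟩
  | ι_mul x v h =>
    obtain ⟨x', rfl⟩ := h
    choose g hg using fun j => hx j x'
    refine ⟨∑ j, v j • g j, ?_⟩
    have hv : v = ∑ j, v j • (Pi.single j (1 : ℂ) : J → ℂ) := by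
      funext l
      simp [Finset.sum_apply, Pi.single_apply]
    rw [map_sum]
    conv_rhs => rw [hv, map_sum, Finset.sum_mul]
    refine Finset.sum_congr rfl (fun j _ => ?_)
    rw [map_smul, map_smul, hg, smul_mul_assoc]
    rfl

theorem grass_basis (J : Type) [Fintype J] :
    Nonempty (Module.Basis (Finset (Fin (Fintype.card J))) ℂ (Grass J)) :=
  ⟨((Pi.basisFun ℂ J).reindex (Fintype.equivFin J)).ExteriorAlgebra⟩

theorem prodMap_bijective {r s : ℕ} {J : Type} [DecidableEq J] [Fintype J]
    (f : Fin s → Fin r → J) (hf : ∀ j, ∃ i a, f i a = j) (hc : Fintype.card J = r * s) :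
    Function.Bijective (prodMap f) := by
  obtain ⟨b⟩ := grass_basis J
  obtain ⟨b'⟩ := grass_basis (Fin r)
  let B := Basis.piTensorProduct (fun _ : Fin s => b')
  have : Module.Finite ℂ (Grass J) := Module.Finite.of_basis b
  have : Module.Finite ℂ (TP r s) := Module.Finite.of_basis B
  have hd : Module.finrank ℂ (TP r s) = Module.finrank ℂ (Grass J) := by
    rw [Module.finrank_eq_card_basis b, Module.finrank_eq_card_basis B]
    simp [hc, pow_mul]
  have hs := prodMap_surjective f hf
  exact ⟨(LinearMap.injective_iff_surjective_of_finrank_eq_finrank hd).2 hs, hs⟩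

/-- The space `𝔓_{kn}` of polynomials in the anticommuting variables `x_{ai}`. -/
abbrev PP (k n : ℕ) : Type := Grass (Fin k × Fin n)

/-- `φ₁ : (𝔛_k)^{⊗n} → 𝔓_{kn}`,
`p_1 ⊗ ⋯ ⊗ p_n ↦ p_1(x_{11}, …, x_{k1}) ⋯ p_n(x_{1n}, …, x_{kn})`. -/
def phi1 (k n : ℕ) : TP k n ≃ₗ[ℂ] PP k n :=
  LinearEquiv.ofBijective (prodMap (fun (i : Fin n) (a : Fin k) => (a, i)))
    (prodMap_bijective _ (fun j => ⟨j.2, j.1, rfl⟩) (by simp))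

/-- `φ₂ : (𝔛_n)^{⊗k} → 𝔓_{kn}`,
`p_1 ⊗ ⋯ ⊗ p_k ↦ p_1(x_{11}, …, x_{1n}) ⋯ p_k(x_{k1}, …, x_{kn})`. -/
def phi2 (k n : ℕ) : TP n k ≃ₗ[ℂ] PP k n :=
  LinearEquiv.ofBijective (prodMap (fun (a : Fin k) (i : Fin n) => (a, i)))
    (prodMap_bijective _ (fun j => ⟨j.1, j.2, rfl⟩) (by simp [mul_comm]))

/-! ### The action of `gl_r` on tensor powers -/

/-- The action `x_a ∂_b` of the basis element `e_{ab}` of `gl_r` on `𝔛_r = V_•`. -/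
def gl {r : ℕ} (a b : Fin r) : Module.End ℂ (Grass (Fin r)) :=
  LinearMap.mulLeft ℂ (xvar a) ∘ₗ pdx b

/-- `g ↦ g_{(i)} = 1 ⊗ ⋯ ⊗ g ⊗ ⋯ ⊗ 1`, with `g` in the `i`-th place. -/
def leg {r s : ℕ} (i : Fin s) : Module.End ℂ (Grass (Fin r)) →ₗ[ℂ] Module.End ℂ (TP r s) :=
  (PiTensorProduct.mapMultilinear ℂ (fun _ : Fin s => Grass (Fin r))
    (fun _ : Fin s => Grass (Fin r))).toLinearMap (fun _ => LinearMap.id) i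

/-- The algebra `End(𝔛_r) ⊗ End(𝔛_r)`, that is, `End(𝔛_r ⊗ 𝔛_r)`. -/
abbrev End2 (r : ℕ) : Type := Module.End ℂ (Grass (Fin r)) ⊗[ℂ] Module.End ℂ (Grass (Fin r))

/-- `g ⊗ h ↦ (g ⊗ h)_{(ij)} = g_{(i)} h_{(j)}`, for `i ≠ j`. -/
def leg2 {r s : ℕ} (i j : Fin s) : End2 r →ₗ[ℂ] Module.End ℂ (TP r s) :=
  TensorProduct.lift ((LinearMap.mul ℂ (Module.End ℂ (TP r s))).compl₁₂ (leg i) (leg j))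

/-- The action `∑_i (e_{ab})_{(i)}` of `e_{ab}` on the tensor power. -/
def tot {r s : ℕ} (a b : Fin r) : Module.End ℂ (TP r s) := ∑ i : Fin s, leg i (gl a b)

/-- The Casimir tensor `Ω`. -/
def Om (r : ℕ) : End2 r := ∑ a : Fin r, ∑ b : Fin r, gl a b ⊗ₜ[ℂ] gl b a

/-- The half Casimir tensor `Ω⁺`. -/
def OmPlus (r : ℕ) : End2 r :=
  (1 / 2 : ℂ) • ∑ a : Fin r, gl a a ⊗ₜ[ℂ] gl a a
    + ∑ a : Fin r, ∑ b ∈ Finset.univ.filter (fun b => a < b), gl a b ⊗ₜ[ℂ] gl b a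

/-- The half Casimir tensor `Ω⁻`. -/
def OmMinus (r : ℕ) : End2 r :=
  (1 / 2 : ℂ) • ∑ a : Fin r, gl a a ⊗ₜ[ℂ] gl a a
    + ∑ a : Fin r, ∑ b ∈ Finset.univ.filter (fun b => a < b), gl b a ⊗ₜ[ℂ] gl a b

/-! ### Functions of complex variables with values in a (finite-dimensional) space -/

section Calculus

variable {V : Type} [AddCommGroup V] [Module ℂ V]

/-- `v` is the derivative at `t` of the vector-valued function `g`. For finite-dimensional `V`
this is the usual derivative: all the coordinates of `g` are differentiated. -/
def HasVecDeriv (g : ℂ → V) (v : V) (t : ℂ) : Prop :=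
  ∀ ξ : Module.Dual ℂ V, HasDerivAt (fun u => ξ (g u)) (ξ v) t

theorem HasVecDeriv.unique {g : ℂ → V} {v w : V} {t : ℂ} (hv : HasVecDeriv g v t)
    (hw : HasVecDeriv g w t) : v = w := by
  rw [← sub_eq_zero, ← Module.forall_dual_apply_eq_zero_iff ℂ]
  intro ξ
  rw [map_sub, (hv ξ).unique (hw ξ), sub_self]

open Classical in
/-- The derivative at `t` of a vector-valued function (zero if there is none). -/
def vecDeriv (g : ℂ → V) (t : ℂ) : V := if h : ∃ v, HasVecDeriv g v t then h.choose else 0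

variable {s r : ℕ}

/-- Pairs of vectors of variables. -/
abbrev Pt (s r : ℕ) : Type := (Fin s → ℂ) × (Fin r → ℂ)

/-- Partial derivative in the `i`-th variable of the first group. -/
def pdFst (i : Fin s) (f : Pt s r → V) (p : Pt s r) : V :=
  vecDeriv (fun u => f (Function.update p.1 i u, p.2)) (p.1 i)

/-- Partial derivative in the `a`-th variable of the second group. -/
def pdSnd (a : Fin r) (f : Pt s r → V) (p : Pt s r) : V :=
  vecDeriv (fun u => f (p.1, Function.update p.2 a u)) (p.2 a)

/-- `f` has at `p` a partial derivative in the `i`-th variable of the first group. -/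
def DiffFst (i : Fin s) (f : Pt s r → V) (p : Pt s r) : Prop :=
  ∃ v, HasVecDeriv (fun u => f (Function.update p.1 i u, p.2)) v (p.1 i)

/-- `f` has at `p` a partial derivative in the `a`-th variable of the second group. -/
def DiffSnd (a : Fin r) (f : Pt s r → V) (p : Pt s r) : Prop :=
  ∃ v, HasVecDeriv (fun u => f (p.1, Function.update p.2 a u)) v (p.2 a)

end Calculus

/-! ### KZ and dynamical differential operators

The operators act on functions of `(z, λ) ∈ ℂ^s × ℂ^r` with values in `(𝔛_r)^{⊗s}`. -/

variable {r s : ℕ}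

/-- The rational KZ operator `∇_{z_i}(z, λ, κ)`. -/
def ratKZ (κ : ℂ) (i : Fin s) (f : Pt s r → TP r s) (p : Pt s r) : TP r s :=
  κ • pdFst i f p - ∑ a : Fin r, p.2 a • leg i (gl a a) (f p)
    - ∑ j ∈ Finset.univ.erase i, (p.1 i - p.1 j)⁻¹ • leg2 i j (Om r) (f p)

/-- The trigonometric KZ operator. -/
def trigKZ (κ : ℂ) (i : Fin s) (f : Pt s r → TP r s) (p : Pt s r) : TP r s :=
  (κ * p.1 i) • pdFst i f p
    - ∑ a : Fin r,
        ((algebraMap ℂ _ (p.2 a) - (1 / 2 : ℂ) • tot a a) * leg i (gl a a) :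
          Module.End ℂ (TP r s)) (f p)
    - ∑ j ∈ Finset.univ.erase i,
        (p.1 i - p.1 j)⁻¹ • (p.1 i • leg2 i j (OmPlus r) + p.1 j • leg2 i j (OmMinus r)) (f p)

/-- The rational dynamical differential operator `D_{λ_a}(z, λ, κ)`. -/
def ratDD (κ : ℂ) (a : Fin r) (f : Pt s r → TP r s) (p : Pt s r) : TP r s :=
  κ • pdSnd a f p - ∑ i : Fin s, p.1 i • leg i (gl a a) (f p)
    - ∑ b ∈ Finset.univ.erase a, (p.2 a - p.2 b)⁻¹ • (tot a b * tot b a - tot a a : Module.End ℂ (TP r s)) (f p)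

/-- The trigonometric dynamical differential operator. -/
def trigDD (κ : ℂ) (a : Fin r) (f : Pt s r → TP r s) (p : Pt s r) : TP r s :=
  (κ * p.2 a) • pdSnd a f p + (1 / 2 : ℂ) • (tot a a ^ 2) (f p)
    - ∑ i : Fin s, p.1 i • leg i (gl a a) (f p)
    - ∑ b : Fin r, ∑ i : Fin s, ∑ j ∈ Finset.univ.filter (fun j => i < j),
        (leg i (gl a b) * leg j (gl b a)) (f p)
    - ∑ b ∈ Finset.univ.erase a,
        (p.2 b / (p.2 a - p.2 b)) • (tot a b * tot b a - tot a a : Module.End ℂ (TP r s)) (f p)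

/-! ### The difference dynamical operators -/

/-- The function `F(A)` of a diagonalizable operator `A` on a finite-dimensional space: it acts
as `F μ` on the eigenspace of `A` with the eigenvalue `μ`. -/
def opFun {V : Type} [AddCommGroup V] [Module ℂ V] (F : ℂ → ℂ) (A : Module.End ℂ V) :
    Module.End ℂ V :=
  Polynomial.aeval A (Lagrange.interpolate (minpoly ℂ A).roots.toFinset id F)

theorem opFun_apply {V : Type} [AddCommGroup V] [Module ℂ V] [Module.Finite ℂ V]
    (F : ℂ → ℂ) (A : Module.End ℂ V) {μ : ℂ} {v : V} (hv : A v = μ • v) :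
    opFun F A v = F μ • v := by
  by_cases h0 : v = 0
  · simp [h0]
  have he : Module.End.HasEigenvector A μ v := ⟨Module.End.mem_eigenspace_iff.2 hv, h0⟩
  rw [opFun, Module.End.aeval_apply_of_hasEigenvector he]
  congr 1
  have hr : μ ∈ (minpoly ℂ A).roots.toFinset := by
    rw [Multiset.mem_toFinset,
      Polynomial.mem_roots (minpoly.ne_zero (Algebra.IsIntegral.isIntegral A))]
    exact Module.End.isRoot_of_hasEigenvalue (Module.End.hasEigenvalue_of_hasEigenvector he)
  exact Lagrange.eval_interpolate_at_node F (Set.injOn_id _) hr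

/-- The series `B_{ab}(t) = 1 + ∑_{q ≥ 1} (e_{ba}^q e_{ab}^q / q!) ∏_{j=1}^q
(t - e_{aa} + e_{bb} - j)⁻¹`, of which only finitely many terms are nonzero here. -/
def Bop (a b : Fin r) (t : ℂ) : Module.End ℂ (TP r s) :=
  ∑ᶠ q : ℕ, ((q.factorial : ℂ)⁻¹) • (tot b a ^ q * tot a b ^ q *
    ((List.range q).map (fun j => Ring.inverse
      (algebraMap ℂ (Module.End ℂ (TP r s)) (t - ((j : ℂ) + 1)) - tot a a + tot b b))).prod)

/-- The indices `a + 1, …, r` in decreasing order. -/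
def above (a : Fin r) : List (Fin r) := ((List.finRange r).filter (fun b => a < b)).reverse

/-- The indices `1, …, a - 1` in increasing order. -/
def below (a : Fin r) : List (Fin r) := (List.finRange r).filter (fun b => b < a)

/-- The product `X_a(z, λ, κ)`. -/
def Xop (κ : ℂ) (a : Fin r) (p : Pt s r) : Module.End ℂ (TP r s) :=
  Ring.inverse ((above a).map (fun b => Bop a b (p.2 a - p.2 b))).prod
    * ((List.finRange s).map (fun i => leg i (opFun (fun μ => p.1 i ^ (-μ)) (gl a a)))).prod
    * ((below a).map (fun b => Bop b a (p.2 b - p.2 a - κ))).prod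

/-- The difference dynamical operator `Q_{λ_a}(z, λ, κ) = X_a(z, λ, κ) T_{λ_a}`. -/
def qDD (κ : ℂ) (a : Fin r) (f : Pt s r → TP r s) (p : Pt s r) : TP r s :=
  Xop κ a p (f (p.1, Function.update p.2 a (p.2 a + κ)))

/-! ### The rational `R`-matrix and the qKZ operators -/

/-- `t` is not an integer. -/
def NonInt (t : ℂ) : Prop := ∀ m : ℤ, t ≠ m

/-- The highest weight vector `x_1 ⋯ x_l` of the submodule `V_l` of `V_•`. -/
def hw (r l : ℕ) : Grass (Fin r) := (((List.finRange r).take l).map xvar).prod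

/-- `S` is the value at `t` of the rational `R`-matrix on `V_• ⊗ V_• = ⨁ V_l ⊗ V_m`, multiplied
by the scalar `ν l m` on the summand `V_l ⊗ V_m`. The summand `V_l` of `V_•` is the eigenspace
of `∑_c e_{cc}` with the eigenvalue `l`, so the first two conditions say that `S` preserves all
the summands `V_l ⊗ V_m`. -/
structure IsRMatrix (r : ℕ) (t : ℂ) (ν : ℕ → ℕ → ℂ) (S : End2 r) : Prop where
  block_left : S * ((∑ c : Fin r, gl c c) ⊗ₜ[ℂ] 1) = ((∑ c : Fin r, gl c c) ⊗ₜ[ℂ] 1) * S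
  block_right : S * (1 ⊗ₜ[ℂ] (∑ c : Fin r, gl c c)) = (1 ⊗ₜ[ℂ] (∑ c : Fin r, gl c c)) * S
  invariance : ∀ a b : Fin r,
    S * (gl a b ⊗ₜ[ℂ] 1 + 1 ⊗ₜ[ℂ] gl a b) = (gl a b ⊗ₜ[ℂ] 1 + 1 ⊗ₜ[ℂ] gl a b) * S
  comm_rel : ∀ a b : Fin r,
    S * (t • (gl a b ⊗ₜ[ℂ] 1) + ∑ c : Fin r, gl a c ⊗ₜ[ℂ] gl c b)
      = (t • (gl a b ⊗ₜ[ℂ] 1) + ∑ c : Fin r, gl c b ⊗ₜ[ℂ] gl a c) * S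
  normalization : ∀ l m : ℕ, l ≤ r → m ≤ r →
    TensorProduct.homTensorHomMap (RingHom.id ℂ) _ _ _ _ S (hw r l ⊗ₜ[ℂ] hw r m)
      = ν l m • (hw r l ⊗ₜ[ℂ] hw r m)

open Classical in
/-- The rational `R`-matrix `R(t)` on `V_• ⊗ V_•`, for a noninteger `t`, with the normalization
`R(t) v ⊗ w = ν t l m · v ⊗ w` for the highest weight vectors `v` of `V_l` and `w` of `V_m`. -/
def rMatrix (r : ℕ) (ν : ℂ → ℕ → ℕ → ℂ) (t : ℂ) : End2 r :=
  if h : ∃ S, IsRMatrix r t (ν t) S then h.choose else 0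

/-- The normalization `R(t) v ⊗ w = v ⊗ w`. -/
def unitNorm (_ : ℂ) (_ _ : ℕ) : ℂ := 1

/-- The normalization `R(t) v ⊗ w = ∏_{q=0}^{min(l,m)-1} (t + l - q)/(t - m + q) · v ⊗ w`. -/
def shiftedNorm (t : ℂ) (l m : ℕ) : ℂ :=
  ∏ q ∈ Finset.range (min l m), (t + l - q) / (t - m + q)

/-- The product `K_i(z, λ, κ)`. -/
def Kop (ν : ℂ → ℕ → ℕ → ℂ) (κ : ℂ) (i : Fin s) (p : Pt s r) : Module.End ℂ (TP r s) :=
  Ring.inverse ((above i).map (fun j => leg2 i j (rMatrix r ν (p.1 i - p.1 j)))).prod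
    * ((List.finRange r).map (fun a => leg i (opFun (fun μ => p.2 a ^ (-μ)) (gl a a)))).prod
    * ((below i).map (fun j => leg2 j i (rMatrix r ν (p.1 j - p.1 i - κ)))).prod

/-- The rational qKZ operator `Z_{z_i}(z, λ, κ) = K_i(z, λ, κ) T_{z_i}`. -/
def qKZ (ν : ℂ → ℕ → ℕ → ℂ) (κ : ℂ) (i : Fin s) (f : Pt s r → TP r s) (p : Pt s r) : TP r s :=
  Kop ν κ i p (f (Function.update p.1 i (p.1 i + κ), p.2))

/-! ### The normalizing factors -/

/-- `C_{ab}(t) = Γ(t + e_{aa} + 1) Γ(t - e_{bb}) / (Γ(t + e_{aa} - e_{bb} + 1) Γ(t))`. -/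
def gammaC (r s : ℕ) (a b : Fin r) (t : ℂ) : Module.End ℂ (TP r s) :=
  opFun (fun μ => Complex.Gamma (t + μ + 1)) (tot a a)
    * opFun (fun μ => Complex.Gamma (t - μ)) (tot b b)
    * opFun (fun μ => (Complex.Gamma (t + μ + 1) * Complex.Gamma t)⁻¹) (tot a a - tot b b)

/-- `t / (t + min(0, e_{aa} - e_{bb}))`; the eigenvalues of `e_{aa} - e_{bb}` are integers. -/
def simpleC (r s : ℕ) (a b : Fin r) (t : ℂ) : Module.End ℂ (TP r s) :=
  opFun (fun μ => t / (t + (min 0 μ.re : ℝ))) (tot a a - tot b b)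

/-- `N_a(λ) = ∏_{b < a} C_{ba}(λ_b - λ_a - κ) / ∏_{b > a} C_{ab}(λ_a - λ_b)`. -/
def normFactor (C : (r s : ℕ) → Fin r → Fin r → ℂ → Module.End ℂ (TP r s))
    (κ : ℂ) (a : Fin r) (l : Fin r → ℂ) : Module.End ℂ (TP r s) :=
  ((below a).map (fun b => C r s b a (l b - l a - κ))).prod
    * Ring.inverse ((above a).map (fun b => C r s a b (l a - l b))).prod

/-! ### Comparison of operators -/

/-- The operator `D` on functions on `Q`, written in the variables `p ∈ P` with `σ p ∈ Q`. -/
def changeVar {P Q V : Type} (σ : P ≃ Q) (D : (Q → V) → Q → V) : (P → V) → P → V :=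
  fun f p => D (f ∘ σ.symm) (σ p)

/-- The operator `D` on `V`-valued functions as an operator on `W`-valued functions, under an
isomorphism `V ≃ W`. -/
def transfer {P V W : Type} [AddCommGroup V] [Module ℂ V] [AddCommGroup W] [Module ℂ W]
    (φ : V ≃ₗ[ℂ] W) (D : (P → V) → P → V) : (P → W) → P → W :=
  fun f p => φ (D (φ.symm ∘ f) p)

variable (k n : ℕ)

/-- The change of variables `(z, λ) ↦ (λ, z)`. -/
def toLZ : Pt n k ≃ Pt k n := Equiv.prodComm _ _

/-- The change of variables `(z, λ) ↦ (λ, -z)`. -/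
def toLNegZ : Pt n k ≃ Pt k n :=
  (Equiv.prodComm _ _).trans (Equiv.prodCongr (Equiv.refl _) (Equiv.neg _))

/-- The change of variables `(z, λ) ↦ (z, -λ)`. -/
def toZNegL : Pt n k ≃ Pt n k := Equiv.prodCongr (Equiv.refl _) (Equiv.neg _)

/-- The change of variables `(z, λ) ↦ (-λ + 1, z)`, where `1 = (1, …, 1)`. -/
def toOneSubLZ : Pt n k ≃ Pt k n :=
  (Equiv.prodComm _ _).trans (Equiv.prodCongr (Equiv.subLeft 1) (Equiv.refl _))

/-- The change of variables `(z, λ) ↦ (-z + 1, λ)`, where `1 = (1, …, 1)`. -/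
def toOneSubZL : Pt n k ≃ Pt n k := Equiv.prodCongr (Equiv.subLeft 1) (Equiv.refl _)

end GLDuality

end

namespace GLDuality

open scoped TensorProduct

noncomputable section

/-! ### Canonical anticommutation relations and the two commuting general linear algebras -/

/-! The whole theorem is skew Howe duality on a fermionic Fock space. Under both identifications the
Lie algebra generators become bilinears in the creation operators `x_{ai}` and annihilation
operators `∂_{ai}`: `(e_{ab})_{(i)}` for `gl_k` is `x_{ai} ∂_{bi}`, and `(e_{ij})_{(a)}` for `gl_n`
is `x_{ai} ∂_{aj}`. The reordering signs of the anticommuting variables cancel because these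
operators are even. Each relation then becomes an identity in the algebra of the canonical
anticommutation relations, and the structure `IsDuality` records exactly what is used. It is
symmetric in the two algebras, so only half of the relations need an argument.

The bridge between the two sides is `e_{ij} e_{ji} = e_{ii} - Ω_{(ij)}` for `i ≠ j`
(`IsCAR.colE_mul_colE`), with the `e`'s acting for `gl_n` and `Ω` for `gl_k`. It yields the rational
differential relations at once. The trigonometric ones need in addition a normal-ordering identity
for `Ω⁺` (`IsCAR.half_sum_rowE_sub`).

For the difference operators, put `e = e_{ij}`, `f = e_{ji}`, `L = e_{ii}`, `M = e_{jj}`, all for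
`gl_n`. Since `f e = M - Ω`, every `f^q e^q` is a polynomial in `L`, `M`, `Ω`, and so is the
operator `C_{ij}(t) B_{ij}(-t)`; this polynomial is `rPoly`. The same polynomial, evaluated in
`End(𝔛_r) ⊗ End(𝔛_r)`, is the `R`-matrix. Indeed `𝔛_r ⊗ 𝔛_r`, with a parity twist, is again a Fock
space, where invariance is the commutation of the two Lie algebras, the quadratic relation follows
from a telescoping of the series (`series_intertwine`, `IsCAR.rPoly_exchange`), and the
normalization is a terminating hypergeometric sum (`sum_serCoeff_lowest`, `rElem_hw`).

Uniqueness: if `D` is the difference of two solutions, then `ker D` contains the products of highest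
weight vectors, and it is stable under both copies of `gl_r` (`IsCAR.exchange_kernel`). For if `D v
= 0`, the vector `y = D (e_{ab} ⊗ 1) v` satisfies `f e y = (t - 1)(L - M + t) y`; this makes `f^q
e^q` act on `y` by a product of invertible operators for noninteger `t`, although `f^q e^q = 0` for
large `q`. Hence `y = 0`. -/

/-- The canonical anticommutation relations for creation operators `X` and annihilation
operators `P`. -/
structure IsCAR {α β A : Type} [DecidableEq α] [DecidableEq β] [Ring A] (X P : α → β → A) :
    Prop where
  xx : ∀ a i b j, X a i * X b j = -(X b j * X a i)
  pp : ∀ a i b j, P a i * P b j = -(P b j * P a i)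
  px : ∀ a i b j, P a i * X b j = (if a = b ∧ i = j then 1 else 0) - X b j * P a i

/-- The operator `e_{ij} = ∑_a x_{ai} ∂_{aj}`. -/
def colE {α β A : Type} [Fintype α] [Ring A] (X P : α → β → A) (i j : β) : A :=
  ∑ a, X a i * P a j

/-- The operator `e_{ab} = ∑_i x_{ai} ∂_{bi}`. -/
def rowE {α β A : Type} [Fintype β] [Ring A] (X P : α → β → A) (a b : α) : A :=
  ∑ i, X a i * P b i

/-- The operator `Ω_{(ij)} = ∑_{a,b} x_{ai} ∂_{bi} x_{bj} ∂_{aj}`. -/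
def colOm {α β A : Type} [Fintype α] [Ring A] (X P : α → β → A) (i j : β) : A :=
  ∑ a, ∑ b, X a i * P b i * (X b j * P a j)

section Ring

variable {α β A : Type} [DecidableEq α] [DecidableEq β] [Ring A] {X P : α → β → A}

theorem IsCAR.swap (h : IsCAR X P) : IsCAR (fun i a => X a i) (fun i a => P a i) where
  xx a i b j := h.xx _ _ _ _
  pp a i b j := h.pp _ _ _ _
  px a i b j := by simp only [h.px, and_comm]

theorem IsCAR.px_same (h : IsCAR X P) (a : α) (i : β) : P a i * X a i = 1 - X a i * P a i := by
  simp [h.px]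

theorem IsCAR.px_ne (h : IsCAR X P) {a b : α} {i j : β} (hab : ¬(a = b ∧ i = j)) :
    P a i * X b j = -(X b j * P a i) := by
  simp [h.px, hab]

theorem IsCAR.p_sq [Algebra ℂ A] (h : IsCAR X P) (a : α) (i : β) : P a i * P a i = 0 := by
  have h1 := h.pp a i a i
  have h2 : (2 : ℂ) • (P a i * P a i) = 0 := by
    rw [two_smul]; nth_rewrite 1 [h1]; simp
  exact (smul_eq_zero.1 h2).resolve_left two_ne_zero

theorem IsCAR.bil_x (h : IsCAR X P) (a b c : α) (i j l : β) :
    X a i * P b j * X c l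
      = X c l * (X a i * P b j) + (if b = c ∧ j = l then X a i else 0) := by
  rw [mul_assoc, h.px, mul_sub, ← mul_assoc, h.xx a i c l]
  split_ifs <;> noncomm_ring

theorem IsCAR.bil_p (h : IsCAR X P) (a b c : α) (i j l : β) :
    X a i * P b j * P c l
      = P c l * (X a i * P b j) - (if c = a ∧ l = i then P b j else 0) := by
  rw [← mul_assoc (P c l), h.px, sub_mul, mul_assoc, h.pp b j c l]
  split_ifs <;> noncomm_ring

theorem IsCAR.bil_bil (h : IsCAR X P) (a b c d : α) (i j l m : β) :
    X a i * P b j * (X c l * P d m) = X c l * P d m * (X a i * P b j)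
      + (if b = c ∧ j = l then X a i * P d m else 0)
      - (if d = a ∧ m = i then X c l * P b j else 0) := by
  rw [← mul_assoc, h.bil_x, add_mul, mul_assoc, h.bil_p]
  split_ifs <;> noncomm_ring

theorem IsCAR.number_idem [Algebra ℂ A] (h : IsCAR X P) (a : α) (i : β) :
    X a i * P a i * (X a i * P a i) = X a i * P a i := by
  rw [mul_assoc, ← mul_assoc (P a i), h.px_same, sub_mul, one_mul, mul_assoc (X a i), h.p_sq]
  simp

theorem IsCAR.number_comm (h : IsCAR X P) (a b : α) (i j : β) :
    Commute (X a i * P a i) (X b j * P b j) := by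
  rw [Commute, SemiconjBy, h.bil_bil]
  by_cases hc : a = b ∧ i = j
  · obtain ⟨rfl, rfl⟩ := hc; simp
  · have hc' : ¬(b = a ∧ j = i) := fun h => hc ⟨h.1.symm, h.2.symm⟩
    simp [hc, hc']

section Col

variable [Fintype α]

theorem IsCAR.colE_x (h : IsCAR X P) (i j l : β) (c : α) :
    colE X P i j * X c l = X c l * colE X P i j + (if j = l then X c i else 0) := by
  simp only [colE, Finset.sum_mul, Finset.mul_sum, h.bil_x, Finset.sum_add_distrib]
  congr 1
  by_cases hjl : j = l <;> simp [hjl]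

theorem IsCAR.colE_p (h : IsCAR X P) (i j l : β) (c : α) :
    colE X P i j * P c l = P c l * colE X P i j - (if l = i then P c j else 0) := by
  simp only [colE, Finset.sum_mul, Finset.mul_sum, h.bil_p, Finset.sum_sub_distrib]
  congr 1
  by_cases hjl : l = i <;> simp [hjl]

theorem IsCAR.colE_bil (h : IsCAR X P) (i j l m : β) (c d : α) :
    colE X P i j * (X c l * P d m) = X c l * P d m * colE X P i j
      + (if j = l then X c i * P d m else 0) - (if m = i then X c l * P d j else 0) := by
  rw [← mul_assoc, h.colE_x, add_mul, mul_assoc, h.colE_p]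
  split_ifs <;> noncomm_ring

theorem IsCAR.colE_colE (h : IsCAR X P) (i j l m : β) :
    colE X P i j * colE X P l m = colE X P l m * colE X P i j
      + (if j = l then colE X P i m else 0) - (if m = i then colE X P l j else 0) := by
  conv_lhs => rw [show colE X P l m = ∑ a, X a l * P a m from rfl]
  simp only [Finset.mul_sum, h.colE_bil, Finset.sum_add_distrib, Finset.sum_sub_distrib]
  simp only [← Finset.sum_mul]
  split_ifs <;> simp [colE]

/-- The commuting actions of skew Howe duality: the two terms of the commutator of `e_{ij}` with
`x_{cl} ∂_{dl}` cancel after summation over `l`. -/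
theorem IsCAR.colE_rowE [Fintype β] (h : IsCAR X P) (i j : β) (a b : α) :
    Commute (colE X P i j) (rowE X P a b) := by
  rw [Commute, SemiconjBy, rowE]
  simp only [Finset.mul_sum, h.colE_bil, Finset.sum_add_distrib, Finset.sum_sub_distrib,
    Finset.sum_mul]
  simp

/-- In `x_{ai} ∂_{aj} x_{bj} ∂_{bi}` interchanging the two annihilation operators costs a sign and
produces the terms of `-Ω_{(ij)}`; the contraction of `∂_{aj}` with `x_{aj}` leaves `x_{ai} ∂_{ai}`.
This identity carries all the differential relations and the polynomial form of `f^q e^q`. -/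
theorem IsCAR.colE_mul_colE (h : IsCAR X P) {i j : β} (hij : i ≠ j) :
    colE X P i j * colE X P j i = colE X P i i - colOm X P i j := by
  rw [eq_sub_iff_add_eq, colE, colE, Finset.sum_mul_sum, colOm, ← Finset.sum_add_distrib]
  refine Finset.sum_congr rfl fun a _ => ?_
  rw [← Finset.sum_add_distrib, Finset.sum_eq_single a]
  · have h1 : P a j * X a j = 1 - X a j * P a j := h.px_same a j
    have h2 : P a i * X a j = -(X a j * P a i) := h.px_ne (fun h => hij h.2)
    linear_combination (norm := noncomm_ring)
      X a i * h1 * P a i + X a i * h2 * P a j - X a i * X a j * h.pp a i a j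
  · intro b _ hb
    have h1 : P a j * X b j = -(X b j * P a j) := h.px_ne (fun h => hb h.1.symm)
    have h2 : P b i * X b j = -(X b j * P b i) := h.px_ne (fun h => hij h.2)
    linear_combination (norm := noncomm_ring)
      X a i * h1 * P b i + X a i * h2 * P a j - X a i * X b j * h.pp a j b i
  · simp

/-- For `i ≠ j` the operator is a sum of `card α` commuting elements of square zero. -/
theorem IsCAR.colE_pow_eq_zero [Algebra ℂ A] (h : IsCAR X P) {i j : β} (hij : i ≠ j) :
    colE X P i j ^ (Fintype.card α + 1) = 0 := by
  have key : ∀ T : Finset α, (∑ a ∈ T, X a i * P a j) ^ (T.card + 1) = 0 := by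
    intro T
    induction T using Finset.induction_on with
    | empty => simp
    | insert a T ha ih =>
      rw [Finset.sum_insert ha, Finset.card_insert_of_notMem ha]
      refine Commute.add_pow_eq_zero_of_add_le_succ_of_pow_eq_zero (m := 2) ?_ ?_ ih (by omega)
      · refine Commute.sum_right _ _ _ fun b _ => ?_
        rw [Commute, SemiconjBy, h.bil_bil]
        simp [hij.symm]
      · rw [pow_two, mul_assoc, ← mul_assoc (P a j), h.px_ne (fun h => hij h.2.symm), neg_mul,
          mul_assoc, h.p_sq]
        simp
  exact key Finset.univ

end Col

end Ring

/-! ### Raising and lowering operators -/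

section SlTwo

variable {A : Type} [Ring A] [Algebra ℂ A] {e f U : A}

theorem lower_mul_raise_pow (hef : e * f = f * e + U) (hUe : U * e = e * U + 2 * e) (q : ℕ) :
    f * e ^ (q + 1) = e ^ (q + 1) * f - ((q : ℂ) + 1) • (e ^ q * U)
      - (((q : ℂ) + 1) * q) • e ^ q := by
  induction q with
  | zero => simp [hef]
  | succ q ih =>
    have hUe' : U * e = e * U + (2 : ℂ) • e := by rw [hUe, two_mul, two_smul]
    rw [pow_succ e (q + 1), ← mul_assoc, ih]
    simp only [sub_mul, smul_mul_assoc, mul_assoc, hUe']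
    have : f * e = e * f - U := by rw [hef]; abel
    rw [this]
    simp only [mul_sub, mul_add, mul_smul_comm, ← mul_assoc, ← pow_succ]
    push_cast
    module

/-- The product `f^q e^q` written through `e_{11}`, `e_{22}` and `Ω`. -/
def lowerRaise (L M Om : A) : ℕ → A
  | 0 => 1
  | q + 1 => lowerRaise L M Om q * (M - Om - (q : ℂ) • (L - M) - ((q : ℂ) * (q + 1)) • 1)

/-- Moving one `f` through `e^q` and using `U e = e (U + 2)`, with `U = L - M`, gives `f^{q+1}
e^{q+1} = f^q e^q (f e - q U - q (q + 1))`, and `f e = M - Om`. -/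
theorem lower_pow_mul_raise_pow {L M Om : A} (hef : e * f = f * e + (L - M))
    (hUe : (L - M) * e = e * (L - M) + 2 * e) (hW : f * e = M - Om) (q : ℕ) :
    f ^ q * e ^ q = lowerRaise L M Om q := by
  induction q with
  | zero => simp [lowerRaise]
  | succ q ih =>
    have hUe' : (L - M) * e = e * (L - M) + (2 : ℂ) • e := by rw [hUe, two_mul, two_smul]
    rw [lowerRaise, ← ih, ← hW]
    generalize L - M = U at *
    obtain _ | q := q
    · simp
    · rw [pow_succ f (q + 1), mul_assoc, pow_succ e (q + 1), ← mul_assoc f,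
        lower_mul_raise_pow hef hUe]
      simp only [sub_mul, smul_mul_assoc, mul_assoc, hUe']
      simp only [mul_sub, mul_add, mul_smul_comm, mul_one, ← mul_assoc (e ^ q), ← pow_succ]
      push_cast
      module

theorem Commute.lowerRaise {L M Om Y : A} (hL : Commute Y L) (hM : Commute Y M)
    (hO : Commute Y Om) (q : ℕ) : Commute Y (lowerRaise L M Om q) := by
  induction q with
  | zero => exact Commute.one_right _
  | succ q ih =>
    exact ih.mul_right (((hM.sub_right hO).sub_right ((hL.sub_right hM).smul_right _)).sub_right
      ((Commute.one_right _).smul_right _))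

theorem map_lowerRaise {B : Type} [Ring B] [Algebra ℂ B] (Φ : A →ₐ[ℂ] B) (L M Om : A) (q : ℕ) :
    Φ (lowerRaise L M Om q) = lowerRaise (Φ L) (Φ M) (Φ Om) q := by
  induction q with
  | zero => simp [lowerRaise]
  | succ q ih => simp [lowerRaise, ih]

/-- The coefficient of `e_{21}^q e_{12}^q` in `B_{12}(-t)` on the vectors of weight `u`. -/
def serCoeff (t u : ℂ) (q : ℕ) : ℂ :=
  ∏ j ∈ Finset.range q, (-(((j : ℂ) + 1) * (t + u + (j + 1))))⁻¹

/-- The polynomial in `e_{11}`, `e_{22}` and `Ω` that acts as `c l m • B_{12}(-t)` on the vectors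
with `e_{11} = l ≤ K` and `e_{22} = m ≤ K`. -/
def rPoly (K : ℕ) (c : ℕ → ℕ → ℂ) (t : ℂ) (L M Om : A) : A :=
  ∑ l ∈ Finset.range (K + 1), ∑ m ∈ Finset.range (K + 1), ∑ q ∈ Finset.range (K + 1),
    (c l m * serCoeff t (l - m) q) • (lowerRaise L M Om q *
      (Polynomial.aeval L (Lagrange.basis (Finset.range (K + 1)) (fun j : ℕ => (j : ℂ)) l) *
        Polynomial.aeval M (Lagrange.basis (Finset.range (K + 1)) (fun j : ℕ => (j : ℂ)) m)))

theorem Commute.polynomial_aeval_right {L Y : A} (hL : Commute Y L) (p : Polynomial ℂ) :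
    Commute Y (Polynomial.aeval L p) := by
  induction p using Polynomial.induction_on' with
  | add p q hp hq => rw [map_add]; exact hp.add_right hq
  | monomial n a =>
    rw [Polynomial.aeval_monomial]
    exact Commute.mul_right (Algebra.commutes a Y).symm (hL.pow_right n)

theorem Commute.rPoly {L M Om Y : A} (hL : Commute Y L) (hM : Commute Y M)
    (hO : Commute Y Om) (K : ℕ) (c : ℕ → ℕ → ℂ) (t : ℂ) : Commute Y (rPoly K c t L M Om) :=
  Commute.sum_right _ _ _ fun _ _ => Commute.sum_right _ _ _ fun _ _ =>
    Commute.sum_right _ _ _ fun _ _ => Commute.smul_right ((Commute.lowerRaise hL hM hO _).mul_right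
      ((Commute.polynomial_aeval_right hL _).mul_right (Commute.polynomial_aeval_right hM _))) _

/-- Being a polynomial in three elements, the operator can be studied in `End(𝔛_r) ⊗ End(𝔛_r)` and
then carried by algebra homomorphisms to any two factors of a tensor power. -/
theorem map_rPoly {B : Type} [Ring B] [Algebra ℂ B] (Φ : A →ₐ[ℂ] B) (K : ℕ) (c : ℕ → ℕ → ℂ)
    (t : ℂ) (L M Om : A) : Φ (rPoly K c t L M Om) = rPoly K c t (Φ L) (Φ M) (Φ Om) := by
  simp [rPoly, map_lowerRaise, Polynomial.aeval_algHom_apply]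

end SlTwo

/-! ### The polynomial and the series evaluated on weight vectors. -/

section Vectors

variable {H : Type} [AddCommGroup H] [Module ℂ H]

theorem aeval_basis_apply {K l : ℕ} {L : Module.End ℂ H} {v : H} (hl : l ≤ K)
    (hv : L v = (l : ℂ) • v) {j : ℕ} :
    Polynomial.aeval L (Lagrange.basis (Finset.range (K + 1)) (fun j : ℕ => (j : ℂ)) j) v
      = if j = l then v else 0 := by
  by_cases h0 : v = 0
  · simp [h0]
  have he : Module.End.HasEigenvector L (l : ℂ) v := ⟨Module.End.mem_eigenspace_iff.2 hv, h0⟩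
  rw [Module.End.aeval_apply_of_hasEigenvector he]
  have hl' : l ∈ Finset.range (K + 1) := Finset.mem_range.2 (by omega)
  have hinj : Set.InjOn (fun j : ℕ => (j : ℂ)) (Finset.range (K + 1)) :=
    fun a _ b _ h => Nat.cast_injective h
  split_ifs with h
  · subst h
    rw [Lagrange.eval_basis_self hinj hl', one_smul]
  · rw [Lagrange.eval_basis_of_ne h hl', zero_smul]

theorem rPoly_apply {K l m : ℕ} {L M : Module.End ℂ H} (Om : Module.End ℂ H) {v : H} (hl : l ≤ K)
    (hm : m ≤ K) (hL : L v = (l : ℂ) • v) (hM : M v = (m : ℂ) • v) (c : ℕ → ℕ → ℂ) (t : ℂ) :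
    rPoly K c t L M Om v = c l m • ∑ q ∈ Finset.range (K + 1),
      serCoeff t (l - m) q • lowerRaise L M Om q v := by
  have hl' : l ∈ Finset.range (K + 1) := Finset.mem_range.2 (by omega)
  have hm' : m ∈ Finset.range (K + 1) := Finset.mem_range.2 (by omega)
  simp only [rPoly, LinearMap.sum_apply, LinearMap.smul_apply, Module.End.mul_apply]
  rw [Finset.sum_eq_single_of_mem l hl', Finset.sum_eq_single_of_mem m hm', Finset.smul_sum]
  · refine Finset.sum_congr rfl fun q _ => ?_
    rw [aeval_basis_apply hm hM, if_pos rfl, aeval_basis_apply hl hL, if_pos rfl, mul_smul]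
  · intro b _ hbm
    refine Finset.sum_eq_zero fun q _ => ?_
    rw [aeval_basis_apply hm hM, if_neg hbm]
    simp
  · intro b _ hbl
    refine Finset.sum_eq_zero fun b' _ => Finset.sum_eq_zero fun q _ => ?_
    rw [aeval_basis_apply hm hM]
    split_ifs
    · rw [aeval_basis_apply hl hL, if_neg hbl]
      simp
    · simp

/-- `e^{q+1} f = f e^{q+1} + (q+1) e^q (U + q)` on vectors. -/
theorem raise_pow_lower_apply {e f U : Module.End ℂ H} (hef : e * f = f * e + U)
    (hUe : U * e = e * U + 2 * e) {v : H} {u : ℂ} (hv : U v = u • v) (q : ℕ) :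
    (e ^ (q + 1)) (f v) = f ((e ^ (q + 1)) v) + (((q : ℂ) + 1) * (u + q)) • (e ^ q) v := by
  have h := congrArg (fun T : Module.End ℂ H => T v) (lower_mul_raise_pow hef hUe q)
  simp only [Module.End.mul_apply, LinearMap.sub_apply, LinearMap.smul_apply, hv, map_smul] at h
  rw [h]
  module

/-- The symmetry `e ↔ f`, `U ↔ -U` of the `sl_2` relations reduces this to `raise_pow_lower_apply`.
-/
theorem raise_lower_pow_apply {e f U : Module.End ℂ H} (hef : e * f = f * e + U)
    (hUf : U * f = f * U - 2 * f) {v : H} {u : ℂ} (hv : U v = u • v) (q : ℕ) :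
    e ((f ^ (q + 1)) v) = (f ^ (q + 1)) (e v) + (((q : ℂ) + 1) * (u - q)) • (f ^ q) v := by
  have h := raise_pow_lower_apply (e := f) (f := e) (U := -U) (by rw [hef]; abel)
    (by rw [neg_mul, hUf]; noncomm_ring) (u := -u) (v := v) (by simp [hv]) q
  rw [h]
  module

theorem weight_raise_pow {e U : Module.End ℂ H}
    (hUe : U * e = e * U + 2 * e) {v : H} {u : ℂ} (hv : U v = u • v) (q : ℕ) :
    U ((e ^ q) v) = (u + 2 * q) • (e ^ q) v := by
  induction q with
  | zero => simp [hv]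
  | succ q ih =>
    rw [pow_succ', Module.End.mul_apply, ← Module.End.mul_apply U, hUe]
    simp only [LinearMap.add_apply, Module.End.mul_apply, ih, map_smul, two_mul]
    push_cast
    module

/-- The intertwining property of the series, behind the quadratic relation for the `R`-matrix. -/
theorem series_intertwine {e f U x₁ x₂ d₁ d₂ : Module.End ℂ H} (hef : e * f = f * e + U)
    (hUe : U * e = e * U + 2 * e) (hUf : U * f = f * U - 2 * f)
    (hex : e * x₁ = x₁ * e) (hfx : f * x₁ = x₁ * f + x₂) (hfx' : f * x₂ = x₂ * f)
    (hfd : f * d₁ = d₁ * f) (hed : e * d₁ = d₁ * e - d₂) (hed' : e * d₂ = d₂ * e)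
    (hUd : U * d₁ = d₁ * U - d₁) (hUd' : U * d₂ = d₂ * U + d₂)
    {v : H} {u t : ℂ} (hv : U v = u • v) {c : ℕ → ℂ}
    (hc : ∀ q : ℕ, c (q + 1) * (((q : ℂ) + 1) * (t + u + (q + 1))) = -c q)
    {K : ℕ} (he0 : e ^ (K + 1) = 0) (hf0 : f ^ (K + 1) = 0) :
    ∑ q ∈ Finset.range (K + 1), c q • (f ^ q * e ^ q) (x₁ (t • d₁ v - f (d₂ v)))
      = ∑ q ∈ Finset.range (K + 1),
          c q • (t • x₁ (d₁ ((f ^ q * e ^ q) v)) - x₂ (e (d₁ ((f ^ q * e ^ q) v)))) := by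
  have hfx'' : ∀ q : ℕ, f ^ q * x₂ = x₂ * f ^ q := fun q => (Commute.pow_left hfx' q)
  have hex' : ∀ q : ℕ, e ^ q * x₁ = x₁ * e ^ q := fun q => (Commute.pow_left hex q)
  have hfd' : ∀ q : ℕ, d₁ * f ^ q = f ^ q * d₁ := fun q => (Commute.pow_left hfd q).symm
  have hed'' : ∀ q : ℕ, d₂ * e ^ q = e ^ q * d₂ := fun q => (Commute.pow_left hed' q).symm
  have hfx1 : ∀ q : ℕ, f ^ (q + 1) * x₁ = x₁ * f ^ (q + 1) + ((q : ℂ) + 1) • (x₂ * f ^ q) := by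
    intro q
    induction q with
    | zero => simp [hfx]
    | succ q ih =>
      rw [pow_succ', mul_assoc, ih, mul_add, ← mul_assoc, hfx, add_mul, mul_smul_comm,
        ← mul_assoc f x₂, hfx', mul_assoc x₁, mul_assoc x₂, ← pow_succ', ← pow_succ']
      push_cast
      module
  have hed1 : ∀ q : ℕ, d₁ * e ^ (q + 1) = e ^ (q + 1) * d₁ + ((q : ℂ) + 1) • (e ^ q * d₂) := by
    intro q
    induction q with
    | zero => simp [hed]
    | succ q ih =>
      have : d₁ * e = e * d₁ + d₂ := by rw [hed]; abel
      rw [pow_succ, ← mul_assoc, ih, add_mul, mul_assoc, this, mul_add, smul_mul_assoc, mul_assoc,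
        ← hed', ← mul_assoc, ← mul_assoc (e ^ q), ← pow_succ, ← pow_succ]
      push_cast
      module
  have hud : U (d₁ v) = (u - 1) • d₁ v := by
    rw [← Module.End.mul_apply, hUd]
    simp only [LinearMap.sub_apply, Module.End.mul_apply, hv, map_smul]
    module
  have hud' : U (d₂ v) = (u + 1) • d₂ v := by
    rw [← Module.End.mul_apply, hUd']
    simp only [LinearMap.add_apply, Module.End.mul_apply, hv, map_smul]
    module
  -- The sums telescope: the recursion `hc` for the coefficients is exactly what leaves a single
  -- boundary term after `Q + 1` summands. At `Q = K` it contains `e^{K+1}` and `f^{K+1}`, so it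
  -- vanishes.
  have key : ∀ Q : ℕ,
      ∑ q ∈ Finset.range (Q + 1), c q • (f ^ q * e ^ q) (x₁ (t • d₁ v - f (d₂ v)))
      - ∑ q ∈ Finset.range (Q + 1),
          c q • (t • x₁ (d₁ ((f ^ q * e ^ q) v)) - x₂ (e (d₁ ((f ^ q * e ^ q) v))))
      = c Q • (x₂ ((f ^ Q) ((e ^ (Q + 1)) (d₁ v))) - x₁ ((f ^ (Q + 1)) ((e ^ Q) (d₂ v)))) := by
    intro Q
    induction Q with
    | zero => simp; module
    | succ Q ih =>
      rw [Finset.sum_range_succ, Finset.sum_range_succ _ (Q + 1), add_sub_add_comm, ih]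
      have h1 : (f ^ (Q + 1) * e ^ (Q + 1)) (x₁ (t • d₁ v - f (d₂ v)))
          = t • x₁ ((f ^ (Q + 1)) ((e ^ (Q + 1)) (d₁ v)))
            + (t * (Q + 1)) • x₂ ((f ^ Q) ((e ^ (Q + 1)) (d₁ v)))
            - x₁ ((f ^ (Q + 1 + 1)) ((e ^ (Q + 1)) (d₂ v)))
            - (((Q : ℂ) + 1) * (u + 1 + Q)) • x₁ ((f ^ (Q + 1)) ((e ^ Q) (d₂ v)))
            - ((Q : ℂ) + 1) • x₂ ((f ^ (Q + 1)) ((e ^ (Q + 1)) (d₂ v)))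
            - (((Q : ℂ) + 1) * (((Q : ℂ) + 1) * (u + 1 + Q))) •
                x₂ ((f ^ Q) ((e ^ Q) (d₂ v))) := by
        have h : ∀ w : H, (f ^ (Q + 1) * e ^ (Q + 1)) (x₁ w)
            = x₁ ((f ^ (Q + 1)) ((e ^ (Q + 1)) w))
              + ((Q : ℂ) + 1) • x₂ ((f ^ Q) ((e ^ (Q + 1)) w)) := by
          intro w
          rw [← Module.End.mul_apply, mul_assoc, hex', ← mul_assoc, hfx1]
          rfl
        have hp : ∀ (q : ℕ) (w : H), (f ^ q) (f w) = (f ^ (q + 1)) w := fun q w => by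
          rw [pow_succ, Module.End.mul_apply]
        rw [h, map_sub, raise_pow_lower_apply hef hUe hud']
        simp only [map_sub, map_add, map_smul, hp]
        module
      have h2 : d₁ ((f ^ (Q + 1) * e ^ (Q + 1)) v)
          = (f ^ (Q + 1)) ((e ^ (Q + 1)) (d₁ v))
            + ((Q : ℂ) + 1) • (f ^ (Q + 1)) ((e ^ Q) (d₂ v)) := by
        rw [← Module.End.mul_apply, ← mul_assoc, hfd', mul_assoc, hed1, mul_add, mul_smul_comm]
        rfl
      have hp : ∀ (q : ℕ) (w : H), e ((e ^ q) w) = (e ^ (q + 1)) w := fun q w => by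
        rw [pow_succ', Module.End.mul_apply]
      rw [h1, h2, map_add e, map_smul e,
        raise_lower_pow_apply hef hUf (weight_raise_pow hUe hud (Q + 1)),
        raise_lower_pow_apply hef hUf (weight_raise_pow hUe hud' Q)]
      simp only [map_add, map_smul, hp]
      have hq := hc Q
      push_cast
      have hq' : c Q = -(c (Q + 1) * (((Q : ℂ) + 1) * (t + u + (Q + 1)))) := by rw [hq]; ring
      rw [hq']
      module
  have h := key K
  rwa [he0, hf0, LinearMap.zero_apply, LinearMap.zero_apply, map_zero, map_zero, map_zero,
    sub_zero, smul_zero, sub_eq_zero] at h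

/-! ### Weight vectors -/

/-- A joint eigenvector of the operators `x_{ai} ∂_{ai}`. -/
def IsWeight {α β : Type} (X P : α → β → Module.End ℂ H) (v : H) : Prop :=
  ∀ a i, ∃ ε : ℕ, ε ≤ 1 ∧ (X a i * P a i) v = (ε : ℂ) • v

theorem IsWeight.colE_apply {α β : Type} [Fintype α] {X P : α → β → Module.End ℂ H} {v : H} (hv : IsWeight X P v) (i : β) :
    ∃ l : ℕ, l ≤ Fintype.card α ∧ colE X P i i v = (l : ℂ) • v := by
  choose ε hε he using fun a => hv a i
  refine ⟨∑ a, ε a, (Finset.sum_le_sum fun a _ => hε a).trans (by simp), ?_⟩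
  simp only [colE, LinearMap.sum_apply, he, Nat.cast_sum, Finset.sum_smul]

variable {α β : Type} [DecidableEq α] [DecidableEq β] {X P : α → β → Module.End ℂ H}

/-- The operators `N = x_{ai} ∂_{ai}` are commuting idempotents, so splitting `v = N v + (v - N v)`
for one of them after another decomposes any vector into joint eigenvectors. -/
theorem IsCAR.span_isWeight [Fintype α] [Fintype β] (h : IsCAR X P) :
    Submodule.span ℂ {v | IsWeight X P v} = ⊤ := by
  have key : ∀ (T : Finset (α × β)) (v : H), v ∈ Submodule.span ℂ
      {v | ∀ j ∈ T, ∃ ε : ℕ, ε ≤ 1 ∧ (X j.1 j.2 * P j.1 j.2) v = (ε : ℂ) • v} := by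
    intro T
    induction T using Finset.induction_on with
    | empty => intro v; exact Submodule.subset_span (by simp)
    | insert j T hj ih =>
      intro v
      refine Submodule.span_induction ?_ (Submodule.zero_mem _) (fun _ _ _ _ => Submodule.add_mem _)
        (fun c _ _ => Submodule.smul_mem _ c) (ih v)
      intro w hw
      set N := X j.1 j.2 * P j.1 j.2 with hN
      have hidem : N (N w) = N w := congrArg (fun S : Module.End ℂ H => S w) (h.number_idem _ _)
      have hcomm : ∀ l ∈ T, ∃ ε : ℕ, ε ≤ 1 ∧ (X l.1 l.2 * P l.1 l.2) w = (ε : ℂ) • w ∧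
          (X l.1 l.2 * P l.1 l.2) (N w) = (ε : ℂ) • N w := by
        intro l hl
        obtain ⟨ε, hε, he⟩ := hw l hl
        refine ⟨ε, hε, he, ?_⟩
        rw [← Module.End.mul_apply, h.number_comm, Module.End.mul_apply, he, map_smul]
      rw [show w = N w + (w - N w) by abel]
      refine Submodule.add_mem _ (Submodule.subset_span ?_) (Submodule.subset_span ?_)
      · intro l hl
        rcases Finset.mem_insert.1 hl with rfl | hl
        · exact ⟨1, le_rfl, by simp only [← hN, hidem]; simp⟩
        · obtain ⟨ε, hε, -, he⟩ := hcomm l hl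
          exact ⟨ε, hε, he⟩
      · intro l hl
        rcases Finset.mem_insert.1 hl with rfl | hl
        · exact ⟨0, zero_le_one, by simp only [← hN, map_sub, hidem]; simp⟩
        · obtain ⟨ε, hε, he, he'⟩ := hcomm l hl
          exact ⟨ε, hε, by rw [map_sub, he, he', smul_sub]⟩
  rw [eq_top_iff]
  intro v _
  refine Submodule.span_mono ?_ (key Finset.univ v)
  intro w hw a i
  exact hw (a, i) (Finset.mem_univ _)

theorem IsCAR.ext_weight [Fintype α] [Fintype β] (h : IsCAR X P) {V : Type} [AddCommGroup V]
    [Module ℂ V] {F G : H →ₗ[ℂ] V} (hFG : ∀ v, IsWeight X P v → F v = G v) : F = G :=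
  LinearMap.ext_on h.span_isWeight hFG

end Vectors

/-! ### Multiplication and differentiation operators on anticommuting polynomials -/

section Grass

/-- Multiplication by the variable `x_j`. -/
def xop {J : Type} [DecidableEq J] (j : J) : Module.End ℂ (Grass J) := LinearMap.mulLeft ℂ (xvar j)

/-- The parity automorphism. -/
def parity (J : Type) : Module.End ℂ (Grass J) :=
  (CliffordAlgebra.involute : Grass J →ₐ[ℂ] Grass J).toLinearMap

theorem parity_mul_parity (J : Type) : parity J * parity J = 1 :=
  LinearMap.ext fun y => CliffordAlgebra.involute_involute y

theorem pdx_one {J : Type} (i : J) : pdx i (1 : Grass J) = 0 :=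
  CliffordAlgebra.contractLeft_one (Q := (0 : QuadraticForm ℂ (J → ℂ))) (LinearMap.proj i)

theorem pdx_mul_pdx {J : Type} (i j : J) : (pdx i * pdx j : Module.End ℂ (Grass J)) = -(pdx j * pdx i) :=
  LinearMap.ext fun y => CliffordAlgebra.contractLeft_comm (Q := (0 : QuadraticForm ℂ (J → ℂ)))
    (LinearMap.proj i) (LinearMap.proj j) y

variable {J : Type} [DecidableEq J]

theorem xop_apply (j : J) (y : Grass J) : xop j y = xvar j * y := rfl

theorem xvar_mul_comm (j : J) (y : Grass J) :
    xvar j * y = CliffordAlgebra.involute y * xvar j := iota_mul_comm _ _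

theorem involute_xvar (j : J) :
    (CliffordAlgebra.involute : Grass J →ₐ[ℂ] Grass J) (xvar j) = -xvar j :=
  CliffordAlgebra.involute_ι _

theorem pdx_xvar_mul (i j : J) (y : Grass J) :
    pdx i (xvar j * y) = (if i = j then y else 0) - xvar j * pdx i y := by
  have h := CliffordAlgebra.contractLeft_ι_mul (Q := (0 : QuadraticForm ℂ (J → ℂ)))
    (LinearMap.proj i : Module.Dual ℂ (J → ℂ)) (Pi.single j (1 : ℂ)) y
  refine h.trans ?_
  congr 1
  simp [Pi.single_apply]

theorem grass_induction {motive : Grass J → Prop} [Fintype J] (h1 : motive 1)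
    (hadd : ∀ y z, motive y → motive z → motive (y + z)) (hsmul : ∀ (c : ℂ) y, motive y → motive (c • y))
    (hx : ∀ j y, motive y → motive (xvar j * y)) (y : Grass J) : motive y := by
  induction y using CliffordAlgebra.left_induction with
  | algebraMap c => rw [Algebra.algebraMap_eq_smul_one]; exact hsmul _ _ h1
  | add x y h h' => exact hadd _ _ h h'
  | ι_mul y v h =>
    have hv : v = ∑ j, v j • (Pi.single j (1 : ℂ) : J → ℂ) := by
      funext l
      simp [Finset.sum_apply, Pi.single_apply]
    have : ∀ T : Finset J, motive (∑ j ∈ T, v j • (xvar j * y)) := by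
      intro T
      induction T using Finset.induction_on with
      | empty => simpa using hsmul 0 _ h1
      | insert j T hj ih => rw [Finset.sum_insert hj]; exact hadd _ _ (hsmul _ _ (hx _ _ h)) ih
    have h2 := this Finset.univ
    convert h2 using 1
    conv_lhs => rw [hv, map_sum, Finset.sum_mul]
    refine Finset.sum_congr rfl fun j _ => ?_
    rw [map_smul, smul_mul_assoc]
    rfl

theorem pdx_mul [Fintype J] (i : J) (y z : Grass J) :
    pdx i (y * z) = pdx i y * z + CliffordAlgebra.involute y * pdx i z := by
  induction y using grass_induction with
  | h1 => rw [pdx_one, map_one]; simp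
  | hadd x y hx hy => simp only [add_mul, map_add, hx, hy]; abel
  | hsmul c y h => simp only [smul_mul_assoc, map_smul, h, smul_add]
  | hx j y h =>
    rw [mul_assoc, pdx_xvar_mul, h, pdx_xvar_mul, map_mul, involute_xvar]
    split_ifs <;> noncomm_ring

theorem parity_mul_xop (j : J) : parity J * xop j = -(xop j * parity J) := by
  refine LinearMap.ext fun y => ?_
  change CliffordAlgebra.involute (xvar j * y) = -(xvar j * CliffordAlgebra.involute y)
  rw [map_mul, involute_xvar, neg_mul]

theorem parity_mul_pdx [Fintype J] (j : J) : parity J * pdx j = -(pdx j * parity J) := by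
  refine LinearMap.ext fun y => ?_
  change CliffordAlgebra.involute (pdx j y) = -(pdx j (CliffordAlgebra.involute y))
  induction y using grass_induction with
  | h1 => rw [map_one CliffordAlgebra.involute, pdx_one]; simp
  | hadd x y hx hy => simp only [map_add, hx, hy]; abel
  | hsmul c y h => simp only [map_smul, h, smul_neg]
  | hx i y h =>
    rw [pdx_xvar_mul, map_mul, involute_xvar, neg_mul, map_neg, pdx_xvar_mul, map_sub, map_mul,
      involute_xvar, h]
    split_ifs <;> simp

theorem xop_mul_xop (i j : J) : xop i * xop j = -(xop j * xop i) := by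
  refine LinearMap.ext fun y => ?_
  change xvar i * (xvar j * y) = -(xvar j * (xvar i * y))
  have h : xvar i * xvar j = -(xvar j * xvar i) :=
    eq_neg_of_add_eq_zero_left (ExteriorAlgebra.ι_add_mul_swap _ _)
  rw [← mul_assoc, h, neg_mul, mul_assoc]

theorem pdx_mul_xop (i j : J) : pdx i * xop j = (if i = j then 1 else 0) - xop j * pdx i := by
  refine LinearMap.ext fun y => ?_
  change pdx i (xvar j * y) = _
  rw [pdx_xvar_mul]
  split_ifs <;> rfl

theorem isCAR_grass {α β : Type} [DecidableEq α] [DecidableEq β] {g : α → β → J}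
    (hg : ∀ a i b j, g a i = g b j ↔ a = b ∧ i = j) :
    IsCAR (fun a i => xop (g a i)) (fun a i => (pdx (g a i) : Module.End ℂ (Grass J))) where
  xx _ _ _ _ := xop_mul_xop _ _
  pp _ _ _ _ := pdx_mul_pdx _ _
  px a i b j := by simp only [pdx_mul_xop, hg]

instance [Fintype J] : Module.Finite ℂ (Grass J) :=
  let ⟨b⟩ := grass_basis J
  Module.Finite.of_basis b

end Grass

/-! ### The doubled space -/

section Doubled

variable {r : ℕ}

/-- The action of `End(𝔛_r) ⊗ End(𝔛_r)` on `𝔛_r ⊗ 𝔛_r`. -/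
def act2 (r : ℕ) : End2 r →ₐ[ℂ] Module.End ℂ (Grass (Fin r) ⊗[ℂ] Grass (Fin r)) :=
  Module.endTensorEndAlgHom

theorem act2_tmul (S T : Module.End ℂ (Grass (Fin r))) (v w : Grass (Fin r)) :
    act2 r (S ⊗ₜ T) (v ⊗ₜ w) = S v ⊗ₜ T w := rfl

/-- Lets relations in the abstract tensor product of algebras be checked on the Fock space `𝔛_r ⊗
𝔛_r`. -/
theorem act2_injective (r : ℕ) : Function.Injective (act2 r) := by
  have h : ⇑(act2 r) = homTensorHomEquiv ℂ (Grass (Fin r)) (Grass (Fin r)) (Grass (Fin r))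
      (Grass (Fin r)) := by
    funext S
    rw [homTensorHomEquiv_apply]
    rfl
  rw [h]
  exact LinearEquiv.injective _

/-- `S ↦ S ⊗ 1`. -/
def onFst (r : ℕ) :
    Module.End ℂ (Grass (Fin r)) →ₐ[ℂ] Module.End ℂ (Grass (Fin r) ⊗[ℂ] Grass (Fin r)) :=
  (act2 r).comp Algebra.TensorProduct.includeLeft

/-- `S ↦ 1 ⊗ S`. -/
def onSnd (r : ℕ) :
    Module.End ℂ (Grass (Fin r)) →ₐ[ℂ] Module.End ℂ (Grass (Fin r) ⊗[ℂ] Grass (Fin r)) :=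
  (act2 r).comp Algebra.TensorProduct.includeRight

/-- The creation operators on `𝔛_r ⊗ 𝔛_r`. -/
def dblX (a : Fin r) : Bool → Module.End ℂ (Grass (Fin r) ⊗[ℂ] Grass (Fin r))
  | false => onFst r (xop a)
  | true => onFst r (parity (Fin r)) * onSnd r (xop a)

/-- The annihilation operators on `𝔛_r ⊗ 𝔛_r`. -/
def dblP (a : Fin r) : Bool → Module.End ℂ (Grass (Fin r) ⊗[ℂ] Grass (Fin r))
  | false => onFst r (pdx a)
  | true => onFst r (parity (Fin r)) * onSnd r (pdx a)

theorem onSnd_mul_onFst (S T : Module.End ℂ (Grass (Fin r))) :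
    onSnd r T * onFst r S = onFst r S * onSnd r T := by
  simp [onFst, onSnd, ← map_mul]

theorem onFst_anticomm {S T : Module.End ℂ (Grass (Fin r))} (h : S * T = -(T * S)) :
    onFst r S * onFst r T = -(onFst r T * onFst r S) := by
  rw [← map_mul, h, map_neg, map_mul]

/-- The rules of signs for products in `End(𝔛_r) ⊗ End(𝔛_r)` with the parity twist. -/
theorem parity_twist_fst_snd {S T : Module.End ℂ (Grass (Fin r))}
    (h : parity (Fin r) * S = -(S * parity (Fin r))) :
    onFst r S * (onFst r (parity (Fin r)) * onSnd r T)
      = -(onFst r (parity (Fin r)) * onSnd r T * onFst r S) := by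
  have key : ∀ {B : Type} [Ring B] (g s t : B), g * s = -(s * g) → t * s = s * t →
      s * (g * t) = -(g * t * s) := by
    intro B _ g s t h1 h2
    rw [mul_assoc, h2, ← mul_assoc, ← mul_assoc, h1, neg_mul, neg_neg]
  exact key _ _ _ (onFst_anticomm h) (onSnd_mul_onFst _ _)

theorem parity_twist_snd_snd (S T : Module.End ℂ (Grass (Fin r))) :
    onFst r (parity (Fin r)) * onSnd r S * (onFst r (parity (Fin r)) * onSnd r T)
      = onSnd r (S * T) := by
  rw [mul_assoc, ← mul_assoc (onSnd r S), onSnd_mul_onFst, mul_assoc, ← mul_assoc, ← map_mul,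
    parity_mul_parity, map_one, one_mul, ← map_mul]

theorem gl_eq (a b : Fin r) : gl a b = xop a * pdx b := rfl

/-- Operators in different tensor factors commute; the parity operator put in front of those of the
second factor makes them anticommute. Since parity squares to one, it drops out of the products of
two operators of the second factor, in particular of the bilinears giving `1 ⊗ e_{ab}`. -/
theorem isCAR_dbl (r : ℕ) : IsCAR (dblX (r := r)) dblP where
  xx a i b j := by
    cases i <;> cases j <;> simp only [dblX]
    · exact onFst_anticomm (xop_mul_xop _ _)
    · exact parity_twist_fst_snd (parity_mul_xop _)
    · rw [parity_twist_fst_snd (parity_mul_xop _), neg_neg]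
    · rw [parity_twist_snd_snd, parity_twist_snd_snd, xop_mul_xop, map_neg]
  pp a i b j := by
    cases i <;> cases j <;> simp only [dblP]
    · exact onFst_anticomm (pdx_mul_pdx _ _)
    · exact parity_twist_fst_snd (parity_mul_pdx _)
    · rw [parity_twist_fst_snd (parity_mul_pdx _), neg_neg]
    · rw [parity_twist_snd_snd, parity_twist_snd_snd, pdx_mul_pdx, map_neg]
  px a i b j := by
    cases i <;> cases j <;> simp only [dblX, dblP]
    · rw [← map_mul, pdx_mul_xop, map_sub, ← map_mul]
      split_ifs <;> simp_all
    · rw [parity_twist_fst_snd (parity_mul_pdx _), if_neg (by simp), zero_sub]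
    · rw [parity_twist_fst_snd (parity_mul_xop _), if_neg (by simp), zero_sub, neg_neg]
    · rw [parity_twist_snd_snd, parity_twist_snd_snd, pdx_mul_xop, map_sub]
      split_ifs <;> simp_all

theorem dblX_mul_dblP_false (a b : Fin r) :
    dblX a false * dblP b false = act2 r (gl a b ⊗ₜ 1) := by
  rw [dblX, dblP, ← map_mul]
  rfl

theorem dblX_mul_dblP_true (a b : Fin r) :
    dblX a true * dblP b true = act2 r (1 ⊗ₜ gl a b) := by
  rw [dblX, dblP, parity_twist_snd_snd]
  rfl

theorem colE_dbl_false :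
    colE (dblX (r := r)) dblP false false = act2 r ((∑ c, gl c c) ⊗ₜ 1) := by
  simp only [colE, dblX_mul_dblP_false, TensorProduct.sum_tmul, map_sum]

theorem colE_dbl_true :
    colE (dblX (r := r)) dblP true true = act2 r (1 ⊗ₜ (∑ c, gl c c)) := by
  simp only [colE, dblX_mul_dblP_true, TensorProduct.tmul_sum, map_sum]

theorem colOm_dbl : colOm (dblX (r := r)) dblP false true = act2 r (Om r) := by
  simp only [colOm, Om, dblX_mul_dblP_true, dblX_mul_dblP_false, ← map_mul,
    Algebra.TensorProduct.tmul_mul_tmul, one_mul, mul_one, map_sum]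

theorem rowE_dbl (a b : Fin r) :
    rowE (dblX (r := r)) dblP a b = act2 r (gl a b ⊗ₜ 1 + 1 ⊗ₜ gl a b) := by
  simp [rowE, dblX_mul_dblP_true, dblX_mul_dblP_false, add_comm]

end Doubled

/-! ### Highest weight vectors -/

section HighestWeight

variable {r : ℕ}

theorem hw_succ {l : ℕ} (hl : l < r) : hw r (l + 1) = hw r l * xvar ⟨l, hl⟩ := by
  rw [hw, hw, List.take_add_one, List.getElem?_eq_getElem (by simpa using hl)]
  simp

theorem xop_hw {l : ℕ} (hl : l ≤ r) {a : Fin r} (ha : (a : ℕ) < l) : xop a (hw r l) = 0 := by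
  induction l with
  | zero => omega
  | succ l ih =>
    rw [hw_succ hl, xop_apply, ← mul_assoc]
    by_cases h : (a : ℕ) < l
    · have := ih (by omega) h
      rw [xop_apply] at this
      rw [this, zero_mul]
    · have h2 : a = ⟨l, hl⟩ := Fin.ext (by simp; omega)
      rw [xvar_mul_comm, h2, mul_assoc]
      have : (xvar (⟨l, hl⟩ : Fin r) * xvar ⟨l, hl⟩ : Grass (Fin r)) = 0 :=
        ExteriorAlgebra.ι_sq_zero _
      rw [this, mul_zero]

theorem pdx_hw {l : ℕ} (hl : l ≤ r) {a : Fin r} (ha : l ≤ (a : ℕ)) : pdx a (hw r l) = 0 := by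
  induction l with
  | zero => simp [hw, pdx_one]
  | succ l ih =>
    have h2 : a ≠ ⟨l, hl⟩ := fun h => by rw [h] at ha; simp at ha
    have h3 : pdx a (xvar (⟨l, hl⟩ : Fin r) : Grass (Fin r)) = 0 := by
      rw [← mul_one (xvar _), pdx_xvar_mul, pdx_one, if_neg h2]
      simp
    rw [hw_succ hl, pdx_mul, ih (by omega) (by omega), h3]
    simp

theorem number_hw {l : ℕ} (hl : l ≤ r) (a : Fin r) :
    gl a a (hw r l) = if (a : ℕ) < l then hw r l else 0 := by
  split_ifs with h
  · have h1 := congrArg (fun T : Module.End ℂ _ => T (hw r l)) (pdx_mul_xop a a)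
    simp only [Module.End.mul_apply, xop_hw hl h, map_zero, if_true, LinearMap.sub_apply,
      Module.End.one_apply] at h1
    exact (sub_eq_zero.1 h1.symm).symm
  · rw [gl_eq, Module.End.mul_apply, pdx_hw hl (by omega), map_zero]

theorem degree_hw {l : ℕ} (hl : l ≤ r) :
    (∑ c, gl c c : Module.End ℂ (Grass (Fin r))) (hw r l) = (l : ℂ) • hw r l := by
  simp only [LinearMap.sum_apply, number_hw hl]
  rw [← Finset.sum_filter, Finset.sum_const, ← Nat.cast_smul_eq_nsmul ℂ]
  congr 2
  rw [Fin.card_filter_val_lt]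
  exact min_eq_right hl

theorem involute_hw {l : ℕ} (hl : l ≤ r) :
    ∃ c : ℂ, CliffordAlgebra.involute (hw r l) = c • hw r l := by
  induction l with
  | zero => exact ⟨1, by simp [hw]⟩
  | succ l ih =>
    obtain ⟨c, hc⟩ := ih (by omega)
    refine ⟨-c, ?_⟩
    rw [hw_succ hl, map_mul, hc, involute_xvar]
    simp

theorem pdx_eq_zero_of_number {a : Fin r} {v : Grass (Fin r)} (hv : gl a a v = 0) :
    pdx a v = 0 := by
  have h1 := pdx_xvar_mul a a (pdx a v)
  have h2 : pdx a (pdx a v) = 0 :=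
    CliffordAlgebra.contractLeft_contractLeft (Q := (0 : QuadraticForm ℂ (Fin r → ℂ)))
      (LinearMap.proj a) v
  have h3 : xvar a * pdx a v = 0 := hv
  rw [h3, map_zero, if_pos rfl, h2, mul_zero, sub_zero] at h1
  exact h1.symm

/-- The polynomials killed by all the derivations are the constants. -/
theorem eq_const_of_number_eq_zero {v : Grass (Fin r)} (hv : ∀ a, gl a a v = 0) :
    ∃ c : ℂ, v = c • 1 := by
  have key : ∀ T : Finset (Fin r), ∃ Q : Module.End ℂ (Grass (Fin r)), Q v = v ∧ Q 1 = 1 ∧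
      ∀ a ∈ T, ∀ y, Q (xvar a * y) = 0 := by
    intro T
    induction T using Finset.induction_on with
    | empty => exact ⟨1, by simp⟩
    | insert b T hb ih =>
      obtain ⟨Q, h1, h2, h3⟩ := ih
      -- The product of all `1 - x_b ∂_b` is the projection onto the constants: it kills every `x_a
      -- y`, while it fixes `1` and, by hypothesis, `v`.
      refine ⟨Q * (1 - gl b b), ?_, ?_, ?_⟩
      · simp [hv b, h1]
      · simp [gl_eq, pdx_one, h2]
      · intro a ha y
        have h4 : gl b b (xvar a * y) = (if b = a then xvar b * y else 0)
            + xvar a * gl b b y := by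
          change xvar b * pdx b (xvar a * y) = _ + xvar a * (xvar b * pdx b y)
          have h5 : (xvar b * xvar a : Grass (Fin r)) = -(xvar a * xvar b) :=
            eq_neg_of_add_eq_zero_left (ExteriorAlgebra.ι_add_mul_swap _ _)
          rw [pdx_xvar_mul, mul_sub, ← mul_assoc, h5, neg_mul, mul_assoc]
          split_ifs <;> simp
        rw [Module.End.mul_apply, LinearMap.sub_apply, Module.End.one_apply, h4]
        rcases Finset.mem_insert.1 ha with rfl | ha
        · rw [if_pos rfl]
          have h6 : (xvar a * gl a a y : Grass (Fin r)) = 0 := by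
            change xvar a * (xvar a * pdx a y) = 0
            rw [← mul_assoc]
            have : (xvar a * xvar a : Grass (Fin r)) = 0 := ExteriorAlgebra.ι_sq_zero _
            rw [this, zero_mul]
          rw [h6]
          simp
        · have : b ≠ a := fun h => hb (h ▸ ha)
          rw [if_neg this, zero_add, ← mul_sub]
          exact h3 a ha _
  obtain ⟨Q, h1, h2, h3⟩ := key Finset.univ
  have hQ : ∀ y, ∃ c : ℂ, Q y = c • 1 := by
    intro y
    induction y using grass_induction with
    | h1 => exact ⟨1, by simp [h2]⟩
    | hadd y z hy hz =>
      obtain ⟨c, hc⟩ := hy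
      obtain ⟨d, hd⟩ := hz
      exact ⟨c + d, by rw [map_add, hc, hd, add_smul]⟩
    | hsmul d y hy =>
      obtain ⟨c, hc⟩ := hy
      exact ⟨d * c, by rw [map_smul, hc, mul_smul]⟩
    | hx j y _ => exact ⟨0, by rw [h3 j (Finset.mem_univ _), zero_smul]⟩
  rw [← h1]
  exact hQ v

/-- The space `V_•` is generated by the highest weight vectors of its summands `V_l`. -/
theorem eq_top_of_hw_mem (Y : Submodule ℂ (Grass (Fin r)))
    (hY : ∀ (a b : Fin r), ∀ v ∈ Y, gl a b v ∈ Y) (hhw : ∀ l ≤ r, hw r l ∈ Y) : Y = ⊤ := by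
  let X : Fin r → Unit → Module.End ℂ (Grass (Fin r)) := fun a _ => xop a
  let P : Fin r → Unit → Module.End ℂ (Grass (Fin r)) := fun a _ => pdx a
  have hcar : IsCAR X P := isCAR_grass (g := fun a _ => a) (by simp)
  have hbil : ∀ (a b c d : Fin r) (v : Grass (Fin r)), gl a b (gl c d v) = gl c d (gl a b v)
      + (if b = c then gl a d v else 0) - (if d = a then gl c b v else 0) := by
    intro a b c d v
    have h := congrArg (fun T : Module.End ℂ _ => T v) (hcar.bil_bil a b c d () () () ())
    simp only [and_true, LinearMap.sub_apply, LinearMap.add_apply] at h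
    refine h.trans ?_
    split_ifs <;> rfl
  -- vectors with prescribed occupation numbers
  let occ : Finset (Fin r) → Grass (Fin r) → Prop := fun I v =>
    ∀ a, gl a a v = if a ∈ I then v else 0
  -- The occupation numbers of `x_1 ⋯ x_l` determine a line: strip off the last variable by its
  -- derivation, use induction, and multiply it back from the left; the sign of moving it to the
  -- right end is the scalar `d` below.
  have hbase : ∀ l ≤ r, ∀ v, occ (Finset.univ.filter fun a => (a : ℕ) < l) v →
      ∃ c : ℂ, v = c • hw r l := by
    intro l
    induction l with
    | zero =>
      intro _ v hv
      simpa [hw] using eq_const_of_number_eq_zero (v := v) fun a => by simpa using hv a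
    | succ l ih =>
      intro hl v hv
      obtain ⟨c, hc⟩ := ih (by omega) (pdx ⟨l, hl⟩ v) fun a => by
        have h1 := congrArg (fun T : Module.End ℂ _ => T v) (hcar.bil_p a a ⟨l, hl⟩ () () ())
        simp only [and_true, LinearMap.sub_apply, Module.End.mul_apply, X, P] at h1
        have h2 : xop a (pdx a v) = if a ∈ Finset.univ.filter fun a : Fin r => (a : ℕ) < l + 1
          then v else 0 := hv a
        rw [h2] at h1
        refine Eq.trans h1 ?_
        by_cases hal : a = ⟨l, hl⟩
        · subst hal
          simp
        · have hal' : ¬((⟨l, hl⟩ : Fin r) = a) := fun h => hal h.symm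
          have hal2 : (a : ℕ) ≠ l := fun h => hal (Fin.ext h)
          have hiff : (a : ℕ) < l + 1 ↔ (a : ℕ) < l := by omega
          simp only [hal', if_false, LinearMap.zero_apply, sub_zero, Finset.mem_filter,
            Finset.mem_univ, true_and, hiff]
          split_ifs <;> simp
      obtain ⟨d, hd⟩ := involute_hw (l := l) (r := r) (by omega)
      refine ⟨c * d, ?_⟩
      have h3 : gl (⟨l, hl⟩ : Fin r) ⟨l, hl⟩ v = v := by rw [hv]; simp
      rw [← h3]
      change xvar _ * pdx _ v = _
      rw [hc, mul_smul_comm, xvar_mul_comm, hd, hw_succ hl, smul_mul_assoc, mul_smul]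
  -- Induction on the number `N` of occupied places outside the first `l`. Moving one such variable
  -- `x_b` to a free place `c` among the first `l` lowers `N`, and the reverse move recovers the
  -- vector.
  have hocc : ∀ (l : ℕ), l ≤ r → ∀ (N : ℕ) (I : Finset (Fin r)), I.card = l →
      (I \ Finset.univ.filter fun a => (a : ℕ) < l).card = N → ∀ v, occ I v → v ∈ Y := by
    intro l hl N
    induction N with
    | zero =>
      intro I hI hN v hv
      have hsub := Finset.sdiff_eq_empty_iff_subset.1 (Finset.card_eq_zero.1 hN)
      have : I = Finset.univ.filter fun a : Fin r => (a : ℕ) < l :=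
        Finset.eq_of_subset_of_card_le hsub (by
          rw [hI, Fin.card_filter_val_lt]; exact min_le_right _ _)
      rw [this] at hv
      obtain ⟨c, rfl⟩ := hbase l hl v hv
      exact Y.smul_mem _ (hhw l hl)
    | succ N ih =>
      intro I hI hN v hv
      obtain ⟨b, hb⟩ : (I \ Finset.univ.filter fun a : Fin r => (a : ℕ) < l).Nonempty :=
        Finset.card_pos.1 (by omega)
      obtain ⟨c, hc⟩ : ((Finset.univ.filter fun a : Fin r => (a : ℕ) < l) \ I).Nonempty := by
        rw [← Finset.card_pos, Finset.card_sdiff_comm, hN]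
        · omega
        · rw [hI, Fin.card_filter_val_lt, min_eq_right hl]
      rw [Finset.mem_sdiff, Finset.mem_filter] at hb hc
      have hbc : b ≠ c := fun h => hc.2 (h ▸ hb.1)
      have hw1 : occ (insert c (I.erase b)) (gl c b v) := by
        intro a
        rw [hbil, hv a]
        by_cases hab : a = b
        · subst hab
          simp [hb.1, hbc]
        · by_cases hac : a = c
          · subst hac
            simp [hc.2, hbc]
          · have hba' : ¬(b = a) := fun h => hab h.symm
            simp only [Finset.mem_insert, Finset.mem_erase, hab, hac, hba', if_false,
              false_or, ne_eq, not_false_iff, true_and]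
            split_ifs <;> simp
      have h2 : gl b c (gl c b v) = v := by
        rw [hbil, if_pos rfl, if_pos rfl, hv b, if_pos hb.1, hv c, if_neg hc.2]
        have h3 : gl b c v = 0 := by
          rw [gl_eq, Module.End.mul_apply, pdx_eq_zero_of_number, map_zero]
          rw [hv c, if_neg hc.2]
        rw [h3]; simp
      rw [← h2]
      refine hY _ _ _ (ih _ ?_ ?_ _ hw1)
      · rw [Finset.card_insert_of_notMem (fun h => hc.2 (Finset.mem_of_mem_erase h)),
          Finset.card_erase_of_mem hb.1]
        have := Finset.card_pos.2 ⟨b, hb.1⟩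
        omega
      · have : insert c (I.erase b) \ (Finset.univ.filter fun a : Fin r => (a : ℕ) < l)
            = (I \ Finset.univ.filter fun a : Fin r => (a : ℕ) < l).erase b := by
          ext a
          by_cases hac : a = c
          · subst hac; simp [hc.1.2]
          · simp [hac, and_assoc]
        rw [this, Finset.card_erase_of_mem (by simpa using ⟨hb.1, by simpa using hb.2⟩), hN]
        omega
  rw [eq_top_iff, ← hcar.span_isWeight, Submodule.span_le]
  intro v hv
  choose ε hε he using fun a => hv a ()
  refine hocc (Finset.univ.filter fun a => ε a = 1).card ?_ _ _ rfl rfl v fun a => ?_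
  · simpa using Finset.card_le_univ (Finset.univ.filter fun a => ε a = 1)
  · have h1 : gl a a v = (ε a : ℂ) • v := he a
    rw [h1]
    have := hε a
    interval_cases h : ε a <;> simp [h]

end HighestWeight

/-! ### Relations between the raising, lowering, creation and annihilation operators -/

section Relations

variable {α β A : Type} [DecidableEq α] [DecidableEq β] [Fintype α] [Ring A]
  {X P : α → β → A} {i j : β}

theorem IsCAR.raise_mul_lower (h : IsCAR X P) (i j : β) :
    colE X P i j * colE X P j i
      = colE X P j i * colE X P i j + (colE X P i i - colE X P j j) := by
  rw [h.colE_colE, if_pos rfl, if_pos rfl]; abel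

theorem IsCAR.weight_mul_raise (h : IsCAR X P) (hij : i ≠ j) :
    (colE X P i i - colE X P j j) * colE X P i j
      = colE X P i j * (colE X P i i - colE X P j j) + 2 * colE X P i j := by
  rw [sub_mul, h.colE_colE i i i j, h.colE_colE j j i j, if_pos rfl, if_neg hij.symm,
    if_neg hij.symm, if_pos rfl]
  noncomm_ring

theorem IsCAR.weight_mul_lower (h : IsCAR X P) (hij : i ≠ j) :
    (colE X P i i - colE X P j j) * colE X P j i
      = colE X P j i * (colE X P i i - colE X P j j) - 2 * colE X P j i := by
  rw [sub_mul, h.colE_colE i i j i, h.colE_colE j j j i, if_pos rfl, if_neg hij, if_neg hij,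
    if_pos rfl]
  noncomm_ring

theorem IsCAR.lower_mul_raise (h : IsCAR X P) (hij : i ≠ j) :
    colE X P j i * colE X P i j = colE X P j j - colOm X P i j := by
  have h1 := h.colE_mul_colE hij
  rw [h.raise_mul_lower] at h1
  rw [← sub_eq_zero] at h1 ⊢
  rw [← h1]; abel

theorem IsCAR.lower_pow_mul_raise_pow [Algebra ℂ A] (h : IsCAR X P) (hij : i ≠ j) (q : ℕ) :
    colE X P j i ^ q * colE X P i j ^ q
      = lowerRaise (colE X P i i) (colE X P j j) (colOm X P i j) q :=
  GLDuality.lower_pow_mul_raise_pow (h.raise_mul_lower i j) (h.weight_mul_raise hij)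
    (h.lower_mul_raise hij) q

theorem IsCAR.colE_commute_bil (h : IsCAR X P) (l i : β) (a b : α) :
    Commute (colE X P l l) (X a i * P b i) := by
  rw [Commute, SemiconjBy, h.colE_bil]
  by_cases hl : l = i
  · subst hl; simp
  · simp [hl, Ne.symm hl]

theorem IsCAR.colE_commute_colE (h : IsCAR X P) (l i : β) :
    Commute (colE X P l l) (colE X P i i) :=
  Commute.sum_right _ _ _ fun _ _ => h.colE_commute_bil _ _ _ _

theorem IsCAR.colE_commute_colOm (h : IsCAR X P) (l i j : β) :
    Commute (colE X P l l) (colOm X P i j) :=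
  Commute.sum_right _ _ _ fun _ _ => Commute.sum_right _ _ _ fun _ _ =>
    (h.colE_commute_bil _ _ _ _).mul_right (h.colE_commute_bil _ _ _ _)

theorem IsCAR.rowE_commute_colOm [Fintype β] (h : IsCAR X P) (hij : i ≠ j) (a b : α) :
    Commute (rowE X P a b) (colOm X P i j) := by
  have h1 : colOm X P i j = colE X P i i - colE X P i j * colE X P j i := by
    rw [h.colE_mul_colE hij]; abel
  rw [h1]
  exact (h.colE_rowE _ _ _ _).symm.sub_right
    ((h.colE_rowE _ _ _ _).symm.mul_right (h.colE_rowE _ _ _ _).symm)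

/-- The quadratic term of the relation defining the `R`-matrix, rewritten through the lowering
operator; the next lemma treats the opposite order through the raising operator. In this form only
`sl_2` relations and the commutators with four operators `x`, `∂` enter. -/
theorem IsCAR.sum_bil_mul_bil (h : IsCAR X P) (hij : i ≠ j) (a b : α) :
    ∑ c, X a i * P c i * (X c j * P b j) = -(X a i * (colE X P j i * P b j)) := by
  rw [colE, Finset.sum_mul, Finset.mul_sum, ← Finset.sum_neg_distrib]
  refine Finset.sum_congr rfl fun c _ => ?_
  linear_combination (norm := noncomm_ring)
    X a i * h.px_ne (a := c) (b := c) (fun h => hij h.2) * P b j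

theorem IsCAR.sum_bil_mul_bil' (h : IsCAR X P) (hij : i ≠ j) (a b : α) :
    ∑ c, X c i * P b i * (X a j * P c j) = -(X a j * (colE X P i j * P b i)) := by
  rw [← h.sum_bil_mul_bil hij.symm]
  refine Finset.sum_congr rfl fun c _ => ?_
  rw [h.bil_bil]
  simp [hij, hij.symm]

end Relations

/-! ### Commutators of the Casimir operator with the exchange operators. -/

section Exchange

variable {A : Type} [Ring A] {e f U x₁ x₂ d₁ d₂ : A}

/-- With `W = f e`, `E = x₁ d₁`, `T = -x₁ f d₂` and `T' = -x₂ e d₁`, this is `T - T' = W E - E W`: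
the difference of the two quadratic terms is a commutator with the Casimir operator. -/
theorem casimir_comm_bil (hex : e * x₁ = x₁ * e) (hfx : f * x₁ = x₁ * f + x₂)
    (hfd : f * d₁ = d₁ * f) (hed : e * d₁ = d₁ * e - d₂) :
    -(x₁ * (f * d₂)) - -(x₂ * (e * d₁)) = f * e * (x₁ * d₁) - x₁ * d₁ * (f * e) := by
  linear_combination (norm := noncomm_ring)
    -f * hex * d₁ - hfx * e * d₁ - x₁ * f * hed - x₁ * hfd * e

/-- A second commutation with `W = f e` produces nothing new beyond `E`, `T` and the diagonal action
`x₁ d₁ + x₂ d₂`; this closes the linear system solved in `exchange_kernel_aux`. Both sides are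
compared after moving creation operators to the left, annihilation operators to the right, and `f`
before `e`. -/
theorem casimir_comm_exchange (hef : e * f = f * e + U)
    (hex : e * x₁ = x₁ * e) (hex' : e * x₂ = x₂ * e + x₁) (hfx : f * x₁ = x₁ * f + x₂)
    (hfx' : f * x₂ = x₂ * f)
    (hfd : f * d₁ = d₁ * f) (hfd' : f * d₂ = d₂ * f - d₁) (hed : e * d₁ = d₁ * e - d₂)
    (hed' : e * d₂ = d₂ * e)
    (hUx : U * x₁ = x₁ * U + x₁) (hUx' : U * x₂ = x₂ * U - x₂) (hUf : U * f = f * U - 2 * f)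
    (hUd : U * d₁ = d₁ * U - d₁) (hUd' : U * d₂ = d₂ * U + d₂) :
    f * e * -(x₁ * (f * d₂)) - -(x₁ * (f * d₂)) * (f * e)
      = f * e * (x₁ * d₁) + x₁ * d₁ * (f * e) + U * (x₁ * d₁)
        - (f * e + U) * (x₁ * d₁ + x₂ * d₂) + U * -(x₁ * (f * d₂)) := by
  have hdf : d₁ * f = f * d₁ := hfd.symm
  have hdf' : d₂ * f = f * d₂ + d₁ := by rw [hfd']; abel
  have hde : d₁ * e = e * d₁ + d₂ := by rw [hed]; abel
  have hde' : d₂ * e = e * d₂ := hed'.symm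
  have hdU : d₁ * U = U * d₁ + d₁ := by rw [hUd]; abel
  have hdU' : d₂ * U = U * d₂ - d₂ := by rw [hUd']; abel
  have assoc : ∀ {x y z : A}, x * y = z → ∀ w, x * (y * w) = z * w := fun h w => by
    rw [← mul_assoc, h]
  simp only [mul_assoc, mul_add, add_mul, mul_sub, sub_mul, mul_neg, neg_mul, hde, hde',
    assoc hef, assoc hex, assoc hex', assoc hfx, assoc hfx', assoc hUx, assoc hUx', assoc hUf,
    assoc hdf, assoc hdf']
  noncomm_ring

end Exchange

/-! ### Weights and invertibility -/

section Weights

variable {H : Type} [AddCommGroup H] [Module ℂ H] {α β : Type} [DecidableEq α] [DecidableEq β]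
  {X P : α → β → Module.End ℂ H}

theorem NonInt.add_ne_zero {t : ℂ} (ht : NonInt t) (m : ℤ) : t + m ≠ 0 := fun h =>
  ht (-m) (by push_cast; linear_combination h)

theorem NonInt.neg {t : ℂ} (ht : NonInt t) : NonInt (-t) := fun m h =>
  ht (-m) (by push_cast; linear_combination -h)

theorem NonInt.add_int {t : ℂ} (ht : NonInt t) (n : ℤ) : NonInt (t + n) := fun m h =>
  ht (m - n) (by push_cast; linear_combination h)

/-- On weight vectors `T` has integer eigenvalues, so `c + T` has no zero eigenvalue for noninteger
`c`. This is the only way in which `t ∉ ℤ` enters invertibility of the operators. -/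
theorem IsCAR.opFun_shift [Fintype α] [Fintype β] [Module.Finite ℂ H] (h : IsCAR X P)
    {T : Module.End ℂ H} (hT : ∀ v, IsWeight X P v → ∃ m : ℤ, T v = (m : ℂ) • v) {c : ℂ}
    (hc : NonInt c) :
    opFun (fun μ => (c + μ)⁻¹) T * (algebraMap ℂ _ c + T) = 1 ∧
      (algebraMap ℂ _ c + T) * opFun (fun μ => (c + μ)⁻¹) T = 1 := by
  constructor <;>
  · refine h.ext_weight fun v hv => ?_
    obtain ⟨m, hm⟩ := hT v hv
    have h0 := hc.add_ne_zero m
    simp only [Module.End.mul_apply, LinearMap.add_apply, Module.algebraMap_end_apply, hm,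
      opFun_apply _ _ hm, ← add_smul, map_smul, smul_smul, Module.End.one_apply]
    first
      | rw [mul_inv_cancel₀ h0, one_smul]
      | rw [inv_mul_cancel₀ h0, one_smul]

theorem IsWeight.diff_apply {α β : Type} [Fintype α] {X P : α → β → Module.End ℂ H} {v : H}
    (hv : IsWeight X P v) (i j : β) :
    ∃ m : ℤ, (colE X P i i - colE X P j j) v = (m : ℂ) • v := by
  obtain ⟨l, -, hl⟩ := hv.colE_apply i
  obtain ⟨m, -, hm⟩ := hv.colE_apply j
  exact ⟨l - m, by rw [LinearMap.sub_apply, hl, hm, ← sub_smul]; push_cast; rfl⟩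

theorem IsCAR.weight_add_injective [Fintype α] [Fintype β] [Module.Finite ℂ H] (h : IsCAR X P)
    (i j : β) {c : ℂ} (hc : NonInt c) {y : H}
    (hy : (colE X P i i - colE X P j j) y + c • y = 0) : y = 0 := by
  have h1 := (h.opFun_shift (fun v hv => hv.diff_apply i j) hc).1
  have h2 : (algebraMap ℂ (Module.End ℂ H) c + (colE X P i i - colE X P j j)) y = 0 := by
    rw [LinearMap.add_apply, Module.algebraMap_end_apply, add_comm, hy]
  have h3 := congrArg (fun S : Module.End ℂ H => S y) h1
  simp only [Module.End.mul_apply, h2, map_zero, Module.End.one_apply] at h3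
  exact h3.symm

end Weights

/-! ### The quadratic relation for the `R`-matrix -/

section RMatrix

variable {H : Type} [AddCommGroup H] [Module ℂ H] {α β : Type} [DecidableEq α] [DecidableEq β]
  [Fintype α] [Fintype β] {X P : α → β → Module.End ℂ H} {i j : β}

theorem serCoeff_succ {t u : ℂ} {q : ℕ} (h : t + u + (q + 1) ≠ 0) :
    serCoeff t u (q + 1) * (((q : ℂ) + 1) * (t + u + (q + 1))) = -serCoeff t u q := by
  have h2 : (q : ℂ) + 1 ≠ 0 := Nat.cast_add_one_ne_zero q
  rw [serCoeff, Finset.prod_range_succ, ← serCoeff]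
  field_simp

/-- The exchange operator on the left preserves the eigenvalues `l`, `m` of `e_{ii}`, `e_{jj}`, so
the factor `c l m` comes out on both sides, and what remains is `series_intertwine` for `x_{ai}`,
`x_{aj}`, `∂_{bi}`, `∂_{bj}`. The noninteger `t` keeps the denominators of the series away from
zero. -/
theorem IsCAR.rPoly_exchange (h : IsCAR X P) (hij : i ≠ j) (c : ℕ → ℕ → ℂ) {t : ℂ}
    (ht : NonInt t) (a b : α) :
    rPoly (Fintype.card α) c t (colE X P i i) (colE X P j j) (colOm X P i j)
        * (t • (X a i * P b i) + ∑ c, X a i * P c i * (X c j * P b j))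
      = (t • (X a i * P b i) + ∑ c, X c i * P b i * (X a j * P c j))
        * rPoly (Fintype.card α) c t (colE X P i i) (colE X P j j) (colOm X P i j) := by
  refine h.ext_weight fun v hv => ?_
  obtain ⟨l, hlα, hl⟩ := hv.colE_apply i
  obtain ⟨m, hmα, hm⟩ := hv.colE_apply j
  have hL : Commute (colE X P i i) (t • (X a i * P b i) + ∑ c, X a i * P c i * (X c j * P b j)) :=
    ((h.colE_commute_bil _ _ _ _).smul_right t).add_right (Commute.sum_right _ _ _ fun _ _ =>
      (h.colE_commute_bil _ _ _ _).mul_right (h.colE_commute_bil _ _ _ _))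
  have hM : Commute (colE X P j j) (t • (X a i * P b i) + ∑ c, X a i * P c i * (X c j * P b j)) :=
    ((h.colE_commute_bil _ _ _ _).smul_right t).add_right (Commute.sum_right _ _ _ fun _ _ =>
      (h.colE_commute_bil _ _ _ _).mul_right (h.colE_commute_bil _ _ _ _))
  have hl' : colE X P i i ((t • (X a i * P b i) + ∑ c, X a i * P c i * (X c j * P b j)) v)
      = (l : ℂ) • (t • (X a i * P b i) + ∑ c, X a i * P c i * (X c j * P b j)) v := by
    rw [← Module.End.mul_apply, hL, Module.End.mul_apply, hl, map_smul]
  have hm' : colE X P j j ((t • (X a i * P b i) + ∑ c, X a i * P c i * (X c j * P b j)) v)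
      = (m : ℂ) • (t • (X a i * P b i) + ∑ c, X a i * P c i * (X c j * P b j)) v := by
    rw [← Module.End.mul_apply, hM, Module.End.mul_apply, hm, map_smul]
  rw [Module.End.mul_apply, Module.End.mul_apply, rPoly_apply _ hlα hmα hl hm,
    rPoly_apply _ hlα hmα hl' hm', map_smul]
  congr 1
  rw [map_sum]
  simp only [← h.lower_pow_mul_raise_pow hij, h.sum_bil_mul_bil hij, h.sum_bil_mul_bil' hij,
    map_smul]
  have hu : (colE X P i i - colE X P j j) v = ((l : ℂ) - m) • v := by
    rw [LinearMap.sub_apply, hl, hm, sub_smul]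
  have key := series_intertwine (h.raise_mul_lower i j) (h.weight_mul_raise hij)
    (h.weight_mul_lower hij) (x₁ := X a i) (x₂ := X a j) (d₁ := P b i) (d₂ := P b j)
    (by rw [h.colE_x, if_neg hij.symm, add_zero]) (by rw [h.colE_x, if_pos rfl])
    (by rw [h.colE_x, if_neg hij, add_zero]) (by rw [h.colE_p, if_neg hij, sub_zero])
    (by rw [h.colE_p, if_pos rfl]) (by rw [h.colE_p, if_neg hij.symm, sub_zero])
    (by rw [sub_mul, h.colE_p, h.colE_p, if_pos rfl, if_neg hij]; noncomm_ring)
    (by rw [sub_mul, h.colE_p, h.colE_p, if_pos rfl, if_neg hij.symm]; noncomm_ring) hu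
    (t := t) (c := serCoeff t (l - m)) (fun q => serCoeff_succ (by
      have := ht.add_ne_zero (l - m + (q + 1))
      push_cast at this
      rwa [add_assoc])) (h.colE_pow_eq_zero hij) (h.colE_pow_eq_zero hij.symm)
  refine Eq.trans ?_ (key.trans ?_)
  · refine Finset.sum_congr rfl fun q _ => ?_
    congr 2
    simp only [LinearMap.add_apply, LinearMap.smul_apply, LinearMap.neg_apply,
      Module.End.mul_apply, map_sub, map_smul]
    abel
  · refine Finset.sum_congr rfl fun q _ => ?_
    congr 1
    simp only [LinearMap.add_apply, LinearMap.smul_apply, LinearMap.neg_apply,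
      Module.End.mul_apply]
    abel

end RMatrix

/-! ### Existence and uniqueness of the `R`-matrix -/

section Uniqueness

variable {H : Type} [AddCommGroup H] [Module ℂ H] {α : Type} [DecidableEq α] [Fintype α]

/-- A vector on which the Casimir operator takes the nonphysical value `(t - 1)(t + u)` and which
is killed by `f^q e^q` vanishes. -/
theorem eq_zero_of_lowerRaise {L M Om : Module.End ℂ H} (hU : Commute (M - Om) (L - M)) {t : ℂ}
    (ht : NonInt t) (hinj : ∀ c : ℂ, NonInt c → ∀ y, (L - M) y + c • y = 0 → y = 0) (q : ℕ) :
    ∀ y, (M - Om) y = (t - 1) • ((L - M) y + t • y) → lowerRaise L M Om q y = 0 → y = 0 := by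
  induction q with
  | zero => intro y _ h; exact h
  | succ q ih =>
    intro y hy h
    -- On `y` the factor splits, with `U = L - M`: `(t - 1)(U + t) - q U - q (q + 1) = (t - 1 - q)(U
    -- + t + q)`.
    have h1 : (M - Om - (q : ℂ) • (L - M) - ((q : ℂ) * (q + 1)) • (1 : Module.End ℂ H)) y
        = (t - 1 - q) • ((L - M) y + (t + q) • y) := by
      rw [LinearMap.sub_apply, LinearMap.sub_apply (M - Om), hy, LinearMap.smul_apply,
        LinearMap.smul_apply, Module.End.one_apply]
      module
    rw [lowerRaise, Module.End.mul_apply, h1, map_smul] at h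
    have h2 : t - 1 - q ≠ 0 := by
      have := ht.add_ne_zero (-1 - q)
      push_cast at this
      rwa [show t - 1 - q = t + (-1 - q) by ring]
    have h3 := (smul_eq_zero.1 h).resolve_left h2
    -- The vector `(U + t + q) y` satisfies the same equation as `y`, because `M - Om` commutes with
    -- `U`; so the induction hypothesis kills it, and injectivity of `U + t + q` then kills `y`.
    refine hinj _ (ht.add_int q) y (ih _ ?_ h3)
    have h4 : (M - Om) ((L - M) y) = (L - M) ((M - Om) y) :=
      congrArg (fun S : Module.End ℂ H => S y) hU
    rw [map_add, h4, map_smul, hy]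
    simp only [map_add, map_smul]
    module

/-- Put `y = D E v`. On `ker D` the exchange relation gives `D T = -t D E`. Applying `D` to `h₁ +
h₂` at `v` determines `D E W v` as `W y + U y + 2 t y`; substituting it in `h₃` leaves the equation
for `y`. -/
theorem exchange_kernel_aux {D W U E T T' I Z : Module.End ℂ H} {t : ℂ}
    (h₁ : T - T' = W * E - E * W) (h₂ : T + T' = Z + U * E)
    (h₃ : W * T - T * W = W * E + E * W + U * E - (W + U) * I + U * T)
    (hW : Commute D W) (hU : Commute D U) (hI : Commute D I) (hZ : Commute D Z)
    (hD : D * (t • E + T) = (t • E + T') * D) {v : H} (hv : D v = 0) :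
    W (D (E v)) = (t - 1) • (U (D (E v)) + t • D (E v)) := by
  have hDW : ∀ w, D (W w) = W (D w) := fun w => congrArg (fun S : Module.End ℂ H => S w) hW
  have hDU : ∀ w, D (U w) = U (D w) := fun w => congrArg (fun S : Module.End ℂ H => S w) hU
  have hDI : ∀ w, D (I w) = I (D w) := fun w => congrArg (fun S : Module.End ℂ H => S w) hI
  have hDZ : ∀ w, D (Z w) = Z (D w) := fun w => congrArg (fun S : Module.End ℂ H => S w) hZ
  have hDT : ∀ w, D w = 0 → D (T w) = -(t • D (E w)) := by
    intro w hw
    have h := congrArg (fun S : Module.End ℂ H => S w) hD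
    simp only [Module.End.mul_apply, hw, map_zero, LinearMap.add_apply, LinearMap.smul_apply,
      map_add, map_smul] at h
    exact eq_neg_of_add_eq_zero_right h
  have hWv : D (W v) = 0 := by rw [hDW, hv, map_zero]
  have e1 := congrArg (fun S : Module.End ℂ H => D (S v)) h₁
  have e2 := congrArg (fun S : Module.End ℂ H => D (S v)) h₂
  have e3 := congrArg (fun S : Module.End ℂ H => D (S v)) h₃
  simp only [LinearMap.add_apply, LinearMap.sub_apply, Module.End.mul_apply, map_add, map_sub,
    hDW, hDU, hDZ, hDI, hv, hDT v hv, hDT _ hWv, map_zero, map_neg, map_smul] at e1 e2 e3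
  have e4 : D (E (W v)) = W (D (E v)) + U (D (E v)) + (2 * t) • D (E v) := by
    linear_combination (norm := module) (1 : ℂ) • e1 + (1 : ℂ) • e2
  rw [e4] at e3
  linear_combination (norm := module) -(2⁻¹ : ℂ) • e3

variable {X P : α → Bool → Module.End ℂ H}

/-- The sum `T + T'` of the two exchange operators, up to the operators of the diagonal action. -/
theorem IsCAR.exchange_add_exchange (h : IsCAR X P) (a b : α) :
    ∑ c, rowE X P a c * rowE X P c b
      = -(X a false * (colE X P true false * P b true))
        + -(X a true * (colE X P false true * P b false))
        + ((Fintype.card α : ℂ) + 1) • rowE X P a b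
        - colE X P true true * rowE X P a b
        - (colE X P false false - colE X P true true) * (X a false * P b false) := by
  have hdiag : ∀ l : Bool, ∑ c, X a l * P c l * (X c l * P b l)
      = ((Fintype.card α : ℂ) + 1) • (X a l * P b l) - colE X P l l * (X a l * P b l) := by
    intro l
    have h1 : ∀ c, X a l * P c l * (X c l * P b l)
        = X a l * P b l - X a l * (X c l * P c l) * P b l := by
      intro c
      linear_combination (norm := noncomm_ring) X a l * h.px_same c l * P b l
    simp only [h1, Finset.sum_sub_distrib, ← Finset.sum_mul, ← Finset.mul_sum, Finset.sum_const,
      Finset.card_univ]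
    rw [show ∑ c, X c l * P c l = colE X P l l from rfl]
    have h2 : X a l * colE X P l l = colE X P l l * X a l - X a l := by
      rw [h.colE_x, if_pos rfl, add_sub_cancel_right]
    rw [h2, sub_mul, mul_assoc (colE X P l l), ← Nat.cast_smul_eq_nsmul ℂ, smul_mul_assoc]
    module
  have h3 : ∀ c, rowE X P a c * rowE X P c b
      = X a false * P c false * (X c false * P b false)
        + X a true * P c true * (X c true * P b true)
        + X a false * P c false * (X c true * P b true)
        + X a true * P c true * (X c false * P b false) := by
    intro c
    simp only [rowE, Fintype.sum_bool]
    noncomm_ring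
  simp only [h3, Finset.sum_add_distrib, hdiag]
  rw [h.sum_bil_mul_bil (by simp), h.sum_bil_mul_bil (by simp)]
  simp only [rowE, Fintype.sum_bool, mul_add, sub_mul]
  module

/-- The Casimir tensor is, up to the degrees `L` and `M`, the quadratic Casimir element of the
diagonal `gl_r`: taking the trace of `IsCAR.exchange_add_exchange` expresses `2 Ω` through these. -/
theorem IsCAR.commute_colOm_of_commute_rowE (h : IsCAR X P) {D : Module.End ℂ H}
    (hL : Commute D (colE X P false false)) (hM : Commute D (colE X P true true))
    (hrow : ∀ a b, Commute D (rowE X P a b)) : Commute D (colOm X P false true) := by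
  have h1 : (2 : ℂ) • colOm X P false true = ∑ a, (∑ c, rowE X P a c * rowE X P c a
      - ((Fintype.card α : ℂ) + 1) • rowE X P a a + colE X P true true * rowE X P a a)
      + (colE X P false false - colE X P true true) * colE X P false false := by
    have h2 : ∑ a, ∑ c, X a false * P c false * (X c true * P a true) = colOm X P false true := rfl
    have h3 : ∑ a, ∑ c, X c false * P a false * (X a true * P c true) = colOm X P false true :=
      Finset.sum_comm
    have h6 : ∀ a, ∑ c, rowE X P a c * rowE X P c a
          - ((Fintype.card α : ℂ) + 1) • rowE X P a a + colE X P true true * rowE X P a a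
        = ∑ c, X a false * P c false * (X c true * P a true)
          + ∑ c, X c false * P a false * (X a true * P c true)
          - (colE X P false false - colE X P true true) * (X a false * P a false) := by
      intro a
      rw [h.exchange_add_exchange, h.sum_bil_mul_bil (i := false) (j := true) (by simp),
        h.sum_bil_mul_bil' (i := false) (j := true) (by simp)]
      module
    simp only [h6, Finset.sum_add_distrib, Finset.sum_sub_distrib, ← Finset.mul_sum, h2, h3]
    rw [show ∑ a, X a false * P a false = colE X P false false from rfl]
    module
  have h4 : Commute D ((2 : ℂ) • colOm X P false true) := by
    rw [h1]
    refine Commute.add_right (Commute.sum_right _ _ _ fun a _ => ?_)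
      ((hL.sub_right hM).mul_right hL)
    exact ((Commute.sum_right _ _ _ fun c _ => (hrow _ _).mul_right (hrow _ _)).sub_right
      ((hrow _ _).smul_right _)).add_right (hM.mul_right (hrow _ _))
  have h5 := h4.smul_right (2⁻¹ : ℂ)
  rwa [smul_smul, inv_mul_cancel₀ two_ne_zero, one_smul] at h5

/-- The heart of uniqueness: the kernel of an operator satisfying the homogeneous relations of the
`R`-matrix is stable under `e_{ab} ⊗ 1`. The image `y` obeys the equation of `exchange_kernel_aux`,
which is incompatible with nilpotency of `e` unless `y = 0`. -/
theorem IsCAR.exchange_kernel [Module.Finite ℂ H] (h : IsCAR X P) {D : Module.End ℂ H} {t : ℂ}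
    (ht : NonInt t)
    (hL : Commute D (colE X P false false)) (hM : Commute D (colE X P true true))
    (hrow : ∀ a b, Commute D (rowE X P a b))
    (hD : ∀ a b, D * (t • (X a false * P b false)
        + ∑ c, X a false * P c false * (X c true * P b true))
      = (t • (X a false * P b false) + ∑ c, X c false * P b false * (X a true * P c true)) * D)
    {v : H} (hv : D v = 0) (a b : α) : D ((X a false * P b false) v) = 0 := by
  have hOm := h.commute_colOm_of_commute_rowE hL hM hrow
  have hne : (false : Bool) ≠ true := by simp
  have hW := h.lower_mul_raise hne
  set L := colE X P false false with hLdef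
  set M := colE X P true true with hMdef
  set Om := colOm X P false true with hOmdef
  set e := colE X P false true with hedef
  set f := colE X P true false with hfdef
  set E := X a false * P b false with hE
  set T := -(X a false * (f * P b true)) with hT
  set T' := -(X a true * (e * P b false)) with hT'
  set I := rowE X P a b with hI
  have hIE : X a false * P b false + X a true * P b true = I := by
    simp [hI, rowE, add_comm]
  have hx1 : e * X a false = X a false * e := by rw [h.colE_x, if_neg hne.symm, add_zero]
  have hx2 : e * X a true = X a true * e + X a false := by rw [h.colE_x, if_pos rfl]
  have hx3 : f * X a false = X a false * f + X a true := by rw [h.colE_x, if_pos rfl]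
  have hx4 : f * X a true = X a true * f := by rw [h.colE_x, if_neg hne, add_zero]
  have hd1 : f * P b false = P b false * f := by rw [h.colE_p, if_neg hne, sub_zero]
  have hd2 : f * P b true = P b true * f - P b false := by rw [h.colE_p, if_pos rfl]
  have hd3 : e * P b false = P b false * e - P b true := by rw [h.colE_p, if_pos rfl]
  have hd4 : e * P b true = P b true * e := by rw [h.colE_p, if_neg hne.symm, sub_zero]
  have r1 : T - T' = (M - Om) * E - E * (M - Om) := by
    rw [← hW]
    exact casimir_comm_bil hx1 hx3 hd1 hd3
  have r3 : (M - Om) * T - T * (M - Om)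
      = (M - Om) * E + E * (M - Om) + (L - M) * E - ((M - Om) + (L - M)) * I + (L - M) * T := by
    rw [← hW, ← hIE]
    refine casimir_comm_exchange (h.raise_mul_lower _ _) hx1 hx2 hx3 hx4 hd1 hd2 hd3 hd4
      ?_ ?_ (h.weight_mul_lower hne) ?_ ?_
    · rw [sub_mul, h.colE_x, h.colE_x, if_pos rfl, if_neg hne.symm]; noncomm_ring
    · rw [sub_mul, h.colE_x, h.colE_x, if_pos rfl, if_neg hne]; noncomm_ring
    · rw [sub_mul, h.colE_p, h.colE_p, if_pos rfl, if_neg hne]; noncomm_ring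
    · rw [sub_mul, h.colE_p, h.colE_p, if_pos rfl, if_neg hne.symm]; noncomm_ring
  -- `Z` is the part of `IsCAR.exchange_add_exchange` built from the diagonal action and the degree
  -- `M`, with which `D` commutes.
  obtain ⟨Z, hZ, r2⟩ : ∃ Z, Commute D Z ∧ T + T' = Z + (L - M) * E := by
    refine ⟨∑ c, rowE X P a c * rowE X P c b - ((Fintype.card α : ℂ) + 1) • I + M * I, ?_, ?_⟩
    · exact ((Commute.sum_right _ _ _ fun c _ => (hrow _ _).mul_right (hrow _ _)).sub_right
        ((hrow _ _).smul_right _)).add_right (hM.mul_right (hrow _ _))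
    · rw [h.exchange_add_exchange]
      simp only [hT, hT', hI, hE, hLdef, hMdef, hedef, hfdef]
      abel
  have hDR := hD a b
  rw [h.sum_bil_mul_bil hne, h.sum_bil_mul_bil' hne] at hDR
  have key := exchange_kernel_aux r1 r2 r3 (hM.sub_right hOm) (hL.sub_right hM) (hrow a b) hZ hDR hv
  have hWU : Commute (M - Om) (L - M) := by
    refine ((h.colE_commute_colE _ _).sub_right (Commute.refl _)).sub_left
      ((h.colE_commute_colOm _ _ _).symm.sub_right (h.colE_commute_colOm _ _ _).symm)
  -- The exponent `card α + 1` is the one at which `e` to that power vanishes, so `f^q e^q` kills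
  -- every vector.
  refine eq_zero_of_lowerRaise hWU ht (fun c hc y hy => h.weight_add_injective _ _ hc hy)
    (Fintype.card α + 1) _ key ?_
  rw [← h.lower_pow_mul_raise_pow hne, h.colE_pow_eq_zero hne, mul_zero, LinearMap.zero_apply]

end Uniqueness

/-! ### The polynomial is the `R`-matrix, and the only one. -/

section Existence

variable {r : ℕ}

/-- The eigenvalue of `C_{12}(t)`, with `e_{11} = l` and `e_{22} = m`, that corresponds to the
normalization `ν` of the `R`-matrix. -/
def normC (ν : ℕ → ℕ → ℂ) (t : ℂ) (l m : ℕ) : ℂ :=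
  ν l m * (t / (t + (min 0 ((l : ℝ) - m) : ℝ)))

/-- The `R`-matrix as a polynomial in the degrees and the Casimir tensor. -/
def rElem (r : ℕ) (ν : ℕ → ℕ → ℂ) (t : ℂ) : End2 r :=
  rPoly r (normC ν t) t ((∑ c, gl c c) ⊗ₜ 1) (1 ⊗ₜ (∑ c, gl c c)) (Om r)

theorem act2_rElem (r : ℕ) (ν : ℕ → ℕ → ℂ) (t : ℂ) : act2 r (rElem r ν t)
    = rPoly r (normC ν t) t (colE dblX dblP false false) (colE dblX dblP true true)
        (colOm dblX dblP false true) := by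
  rw [colE_dbl_false, colE_dbl_true, colOm_dbl]
  exact map_rPoly (A := End2 r) (B := Module.End ℂ (Grass (Fin r) ⊗[ℂ] Grass (Fin r))) (act2 r)
    _ _ _ _ _ _

theorem lowerRaise_apply {H : Type} [AddCommGroup H] [Module ℂ H] {L M Om : Module.End ℂ H}
    {w : H} {u ω : ℂ} (hu : (L - M) w = u • w) (hω : (M - Om) w = ω • w) (q : ℕ) :
    lowerRaise L M Om q w = (∏ j ∈ Finset.range q, (ω - j * u - j * (j + 1))) • w := by
  induction q with
  | zero => simp [lowerRaise]
  | succ q ih =>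
    rw [lowerRaise, Module.End.mul_apply, LinearMap.sub_apply, LinearMap.sub_apply (M - Om),
      LinearMap.smul_apply, LinearMap.smul_apply, hu, hω, Module.End.one_apply, smul_smul,
      ← sub_smul, ← sub_smul, map_smul, ih, smul_smul, Finset.prod_range_succ, mul_comm]

/-- The value of the series on the lowest weight vectors. -/
theorem sum_serCoeff_lowest {t : ℂ} (ht : NonInt t) (N : ℕ) {K : ℕ} (hK : N ≤ K) :
    ∑ q ∈ Finset.range (K + 1), serCoeff t (-N) q *
      (∏ j ∈ Finset.range q, ((N : ℂ) - j * (-N) - j * (j + 1))) = (t - N) / t := by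
  have ht0 : t ≠ 0 := by simpa using ht.add_ne_zero 0
  have hterm : ∀ q, serCoeff t (-N) q *
      (∏ j ∈ Finset.range q, ((N : ℂ) - j * (-N) - j * (j + 1)))
      = ∏ j ∈ Finset.range q, (((N : ℂ) - j) / (N - t - (j + 1))) := by
    intro q
    rw [serCoeff, ← Finset.prod_mul_distrib]
    refine Finset.prod_congr rfl fun j _ => ?_
    have h1 : (j : ℂ) + 1 ≠ 0 := Nat.cast_add_one_ne_zero j
    have h2 : t + -N + (j + 1) ≠ 0 := by
      have := ht.add_ne_zero (-N + (j + 1)); push_cast at this; rwa [add_assoc]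
    have h3 : (N : ℂ) - t - (j + 1) ≠ 0 := fun h => h2 (by linear_combination -h)
    field_simp
    ring
  simp only [hterm]
  -- Each term is a difference of consecutive values of the subtracted product, so the partial sums
  -- have a closed form. Once `Q > N` that product contains the zero factor `N - N`.
  have key : ∀ Q : ℕ, ∑ q ∈ Finset.range Q,
      ∏ j ∈ Finset.range q, (((N : ℂ) - j) / (N - t - (j + 1)))
      = (N - t) / (-t) - (∏ j ∈ Finset.range Q, (((N : ℂ) - j) / (N - t - (j + 1))))
          * ((N - t - Q) / (-t)) := by
    intro Q
    induction Q with
    | zero => simp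
    | succ Q ih =>
      rw [Finset.sum_range_succ, ih, Finset.prod_range_succ]
      have h3 : (N : ℂ) - t - (Q + 1) ≠ 0 := fun h => by
        have := ht.add_ne_zero (-N + (Q + 1))
        push_cast at this
        exact this (by linear_combination -h)
      push_cast
      field_simp
      ring
  rw [key, Finset.prod_eq_zero (i := N) (Finset.mem_range.2 (by omega)) (by simp)]
  field_simp
  ring

/-- Term by term: `x_a` kills `x_1 ⋯ x_l` for `a ≤ l`, and `∂_a` kills `x_1 ⋯ x_m` for `a > m`;
since `m ≤ l`, one of the two always applies. The next lemma is the mirror image. -/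
theorem colE_dbl_hw_of_le {l m : ℕ} (hl : l ≤ r) (hm : m ≤ r) (hlm : m ≤ l) :
    colE (dblX (r := r)) dblP false true (hw r l ⊗ₜ hw r m) = 0 := by
  rw [colE, LinearMap.sum_apply]
  refine Finset.sum_eq_zero fun a _ => ?_
  by_cases ha : (a : ℕ) < m
  · have h := (isCAR_dbl r).px_ne (a := a) (b := a) (i := true) (j := false) (by simp)
    rw [show dblX a false * dblP a true = -(dblP a true * dblX a false) by rw [h, neg_neg]]
    have : dblX a false (hw r l ⊗ₜ hw r m) = xop a (hw r l) ⊗ₜ hw r m := rfl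
    rw [LinearMap.neg_apply, Module.End.mul_apply, this, xop_hw hl (by omega)]
    simp
  · have : dblP a true (hw r l ⊗ₜ hw r m) = parity (Fin r) (hw r l) ⊗ₜ pdx a (hw r m) := rfl
    rw [Module.End.mul_apply, this, pdx_hw hm (by omega)]
    simp

theorem colE_dbl_hw_of_lt {l m : ℕ} (hl : l ≤ r) (hm : m ≤ r) (hlm : l < m) :
    colE (dblX (r := r)) dblP true false (hw r l ⊗ₜ hw r m) = 0 := by
  rw [colE, LinearMap.sum_apply]
  refine Finset.sum_eq_zero fun a _ => ?_
  by_cases ha : (a : ℕ) < m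
  · have h := (isCAR_dbl r).px_ne (a := a) (b := a) (i := false) (j := true) (by simp)
    rw [show dblX a true * dblP a false = -(dblP a false * dblX a true) by rw [h, neg_neg]]
    have : dblX a true (hw r l ⊗ₜ hw r m) = parity (Fin r) (hw r l) ⊗ₜ xop a (hw r m) := rfl
    rw [LinearMap.neg_apply, Module.End.mul_apply, this, xop_hw hm (by omega)]
    simp
  · have : dblP a false (hw r l ⊗ₜ hw r m) = pdx a (hw r l) ⊗ₜ hw r m := rfl
    rw [Module.End.mul_apply, this, pdx_hw hl (by omega)]
    simp

/-- If `m ≤ l`, the raising operator kills the vector and only the term `q = 0` of the series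
survives. If `l < m`, the lowering operator kills it, `f e` acts by `m - l`, and the series sums to
`(t + l - m) / t`, which the factor in `normC` compensates. -/
theorem rElem_hw {t : ℂ} (ht : NonInt t) (ν : ℕ → ℕ → ℂ) {l m : ℕ} (hl : l ≤ r) (hm : m ≤ r) :
    act2 r (rElem r ν t) (hw r l ⊗ₜ hw r m) = ν l m • (hw r l ⊗ₜ hw r m) := by
  have hcar := isCAR_dbl r
  have hne : (false : Bool) ≠ true := by simp
  have ht0 : t ≠ 0 := by simpa using ht.add_ne_zero 0
  have hL : colE (dblX (r := r)) dblP false false (hw r l ⊗ₜ hw r m)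
      = (l : ℂ) • (hw r l ⊗ₜ hw r m) := by
    rw [colE_dbl_false, act2_tmul, degree_hw hl, Module.End.one_apply, TensorProduct.smul_tmul']
  have hM : colE (dblX (r := r)) dblP true true (hw r l ⊗ₜ hw r m)
      = (m : ℂ) • (hw r l ⊗ₜ hw r m) := by
    rw [colE_dbl_true, act2_tmul, degree_hw hm, Module.End.one_apply, TensorProduct.tmul_smul]
  have hu : (colE (dblX (r := r)) dblP false false - colE (dblX (r := r)) dblP true true)
      (hw r l ⊗ₜ hw r m) = ((l : ℂ) - m) • (hw r l ⊗ₜ hw r m) := by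
    rw [LinearMap.sub_apply, hL, hM, sub_smul]
  rw [act2_rElem, rPoly_apply _ hl hm hL hM]
  by_cases hlm : m ≤ l
  · have hω : (colE (dblX (r := r)) dblP true true - colOm (dblX (r := r)) dblP false true)
        (hw r l ⊗ₜ hw r m) = (0 : ℂ) • (hw r l ⊗ₜ hw r m) := by
      rw [← hcar.lower_mul_raise hne, Module.End.mul_apply, colE_dbl_hw_of_le hl hm hlm, map_zero,
        zero_smul]
    have h1 : normC ν t l m = ν l m := by
      have : min 0 ((l : ℝ) - m) = 0 := min_eq_left (sub_nonneg.2 (by exact_mod_cast hlm))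
      rw [normC, this]
      simp [ht0]
    rw [h1, Finset.sum_range_succ', Finset.sum_eq_zero]
    · simp [serCoeff, lowerRaise]
    · intro q _
      rw [lowerRaise_apply hu hω, Finset.prod_eq_zero (i := 0) (by simp) (by simp)]
      simp
  · obtain ⟨N, rfl⟩ := Nat.exists_eq_add_of_lt (not_le.1 hlm)
    have hω : (colE (dblX (r := r)) dblP true true - colOm (dblX (r := r)) dblP false true)
        (hw r l ⊗ₜ hw r (l + N + 1)) = ((N + 1 : ℕ) : ℂ) • (hw r l ⊗ₜ hw r (l + N + 1)) := by
      have h1 : colE (dblX (r := r)) dblP true true - colOm (dblX (r := r)) dblP false true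
          = colE dblX dblP false true * colE dblX dblP true false
            - (colE dblX dblP false false - colE dblX dblP true true) := by
        rw [← hcar.lower_mul_raise hne, hcar.raise_mul_lower false true]; abel
      rw [h1, LinearMap.sub_apply, Module.End.mul_apply, colE_dbl_hw_of_lt hl hm (by omega),
        map_zero, hu]
      push_cast
      module
    have hu' : (l : ℂ) - (l + N + 1 : ℕ) = -((N + 1 : ℕ) : ℂ) := by push_cast; ring
    rw [hu'] at hu ⊢
    simp only [lowerRaise_apply hu hω, smul_smul, ← Finset.sum_smul]
    rw [sum_serCoeff_lowest ht (N + 1) (by omega)]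
    congr 1
    have h2 : min 0 ((l : ℝ) - (l + N + 1 : ℕ)) = -((N + 1 : ℕ) : ℝ) := by
      rw [min_eq_right] <;> push_cast <;> linarith [Nat.cast_nonneg (α := ℝ) N]
    have h3 : t - ((N + 1 : ℕ) : ℂ) ≠ 0 := by
      have := ht.add_ne_zero (-((N + 1 : ℕ) : ℤ))
      push_cast at this ⊢
      rwa [sub_eq_add_neg]
    rw [normC, h2, Complex.ofReal_neg, Complex.ofReal_natCast, ← sub_eq_add_neg]
    field_simp

theorem isRMatrix_rElem {t : ℂ} (ht : NonInt t) (ν : ℕ → ℕ → ℂ) :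
    IsRMatrix r t ν (rElem r ν t) := by
  have hcar := isCAR_dbl r
  have hne : (false : Bool) ≠ true := by simp
  refine ⟨?_, ?_, fun a b => ?_, fun a b => ?_, fun l m hl hm => rElem_hw ht ν hl hm⟩
  · refine act2_injective r ?_
    rw [map_mul, map_mul, act2_rElem, ← colE_dbl_false]
    exact (Commute.rPoly (Commute.refl _) (hcar.colE_commute_colE _ _)
      (hcar.colE_commute_colOm _ _ _) _ _ _).symm
  · refine act2_injective r ?_
    rw [map_mul, map_mul, act2_rElem, ← colE_dbl_true]
    exact (Commute.rPoly (hcar.colE_commute_colE _ _) (Commute.refl _)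
      (hcar.colE_commute_colOm _ _ _) _ _ _).symm
  · refine act2_injective r ?_
    rw [map_mul, map_mul, act2_rElem, ← rowE_dbl]
    exact (Commute.rPoly (hcar.colE_rowE _ _ _ _).symm (hcar.colE_rowE _ _ _ _).symm
      (hcar.rowE_commute_colOm hne _ _) _ _ _).symm
  · refine act2_injective r ?_
    have h := hcar.rPoly_exchange hne (normC ν t) ht a b
    rw [Fintype.card_fin, ← act2_rElem] at h
    simp only [dblX_mul_dblP_false, dblX_mul_dblP_true, ← map_mul, ← map_smul, ← map_sum,
      ← map_add, Algebra.TensorProduct.tmul_mul_tmul, one_mul, mul_one] at h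
    exact h

/-- The kernel of the difference `D` is stable under `gl_r ⊗ 1` by `IsCAR.exchange_kernel`, and
under `1 ⊗ gl_r` because `D` commutes with the diagonal action. It contains all products of highest
weight vectors, which generate everything, one tensor factor at a time. -/
theorem IsRMatrix.unique {t : ℂ} (ht : NonInt t) {ν : ℕ → ℕ → ℂ} {S S' : End2 r}
    (hS : IsRMatrix r t ν S) (hS' : IsRMatrix r t ν S') : S = S' := by
  have hcar := isCAR_dbl r
  refine act2_injective r (sub_eq_zero.1 ?_)
  obtain ⟨D, hDdef⟩ : ∃ D, D = act2 r S - act2 r S' := ⟨_, rfl⟩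
  rw [← hDdef]
  have hmap : ∀ {x y : End2 r}, S * x = y * S → S' * x = y * S' →
      D * act2 r x = act2 r y * D := by
    intro x y h h'
    rw [hDdef, sub_mul, mul_sub, ← map_mul, ← map_mul, h, h', map_mul, map_mul]
  have hL : Commute D (colE dblX dblP false false) := by
    rw [colE_dbl_false]; exact hmap hS.block_left hS'.block_left
  have hM : Commute D (colE dblX dblP true true) := by
    rw [colE_dbl_true]; exact hmap hS.block_right hS'.block_right
  have hrow : ∀ a b, Commute D (rowE dblX dblP a b) := fun a b => by
    rw [rowE_dbl]; exact hmap (hS.invariance a b) (hS'.invariance a b)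
  have hex := fun a b => hmap (hS.comm_rel a b) (hS'.comm_rel a b)
  have hker : ∀ {v}, D v = 0 → ∀ a b, D ((dblX (r := r) a false * dblP (r := r) b false) v) = 0 := fun hv a b =>
    hcar.exchange_kernel ht hL hM hrow (fun a b => by
      simp only [dblX_mul_dblP_false, dblX_mul_dblP_true, ← map_mul, ← map_smul, ← map_sum,
        ← map_add, Algebra.TensorProduct.tmul_mul_tmul, one_mul, mul_one]
      exact hex a b) hv a b
  have hker1 : ∀ {v}, D v = 0 → ∀ a b, D (act2 r (gl a b ⊗ₜ 1) v) = 0 := fun hv a b => by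
    rw [← dblX_mul_dblP_false]; exact hker hv a b
  have hker2 : ∀ {v}, D v = 0 → ∀ a b, D (act2 r (1 ⊗ₜ gl a b) v) = 0 := fun {v} hv a b => by
    have h1 : act2 r (1 ⊗ₜ gl a b) = rowE dblX dblP a b - act2 r (gl a b ⊗ₜ 1) := by
      rw [rowE_dbl, map_add, add_sub_cancel_left]
    have h2 : D (rowE dblX dblP a b v) = rowE dblX dblP a b (D v) :=
      congrArg (fun T : Module.End ℂ _ => T v) (hrow a b)
    rw [h1, LinearMap.sub_apply, map_sub, hker1 hv, h2, hv, map_zero, sub_zero]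
  have hhw : ∀ l m, l ≤ r → m ≤ r → D (hw r l ⊗ₜ hw r m) = 0 := fun l m hl hm => by
    rw [hDdef, LinearMap.sub_apply]
    exact sub_eq_zero.2 ((hS.normalization l m hl hm).trans (hS'.normalization l m hl hm).symm)
  have h1 : ∀ m ≤ r, ∀ v, D (v ⊗ₜ hw r m) = 0 := fun m hm v => by
    have h := eq_top_of_hw_mem
      ((LinearMap.ker D).comap ((TensorProduct.mk ℂ _ _).flip (hw r m)))
      (fun a b v hv => hker1 (show D (v ⊗ₜ hw r m) = 0 from hv) a b)
      (fun l hl => hhw l m hl hm)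
    exact h.ge (Submodule.mem_top (x := v))
  refine TensorProduct.ext' fun v w => ?_
  have h := eq_top_of_hw_mem ((LinearMap.ker D).comap (TensorProduct.mk ℂ _ _ v))
    (fun a b w hw => hker2 (show D (v ⊗ₜ w) = 0 from hw) a b) (fun m hm => h1 m hm v)
  exact h.ge (Submodule.mem_top (x := w))

theorem existsUnique_isRMatrix (r : ℕ) {t : ℂ} (ht : NonInt t) (ν : ℕ → ℕ → ℂ) :
    ∃! S, IsRMatrix r t ν S :=
  ⟨_, isRMatrix_rElem ht ν, fun _ h => h.unique ht (isRMatrix_rElem ht ν)⟩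

theorem rMatrix_eq_rElem (r : ℕ) {t : ℂ} (ht : NonInt t) (ν : ℂ → ℕ → ℕ → ℂ) :
    rMatrix r ν t = rElem r (ν t) t := by
  have h : ∃ S, IsRMatrix r t (ν t) S := ⟨_, isRMatrix_rElem ht (ν t)⟩
  rw [rMatrix, dif_pos h]
  exact h.choose_spec.unique ht (isRMatrix_rElem ht (ν t))

end Existence

/-! ### The operators on the tensor powers as operators on anticommuting polynomials -/

section Legs

variable {r s : ℕ}

theorem leg_tprod (i : Fin s) (T : Module.End ℂ (Grass (Fin r))) (p : Fin s → Grass (Fin r)) :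
    leg i T (PiTensorProduct.tprod ℂ p)
      = PiTensorProduct.tprod ℂ (Function.update p i (T (p i))) := by
  rw [leg, MultilinearMap.toLinearMap_apply, PiTensorProduct.mapMultilinear_apply,
    PiTensorProduct.map_tprod]
  congr 1
  funext j
  by_cases h : j = i
  · subst h; simp
  · simp [h]

/-- `leg i` as a homomorphism of algebras. -/
def legHom (i : Fin s) : Module.End ℂ (Grass (Fin r)) →ₐ[ℂ] Module.End ℂ (TP r s) :=
  AlgHom.ofLinearMap (leg i)
    (by
      ext p
      simp only [LinearMap.compMultilinearMap_apply, leg_tprod, Module.End.one_apply,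
        Function.update_eq_self])
    (fun S T => by
      ext p
      simp only [LinearMap.compMultilinearMap_apply, leg_tprod, Module.End.mul_apply,
        Function.update_self, Function.update_idem])

theorem legHom_apply (i : Fin s) (T : Module.End ℂ (Grass (Fin r))) : legHom i T = leg i T := rfl

theorem leg_commute {i j : Fin s} (hij : i ≠ j) (S T : Module.End ℂ (Grass (Fin r))) :
    Commute (leg i S) (leg j T) := by
  refine PiTensorProduct.ext (MultilinearMap.ext fun p => ?_)
  simp only [LinearMap.compMultilinearMap_apply, leg_tprod, Module.End.mul_apply,
    Function.update_of_ne hij, Function.update_of_ne hij.symm]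
  rw [Function.update_comm hij]

/-- `leg2 i j` as a homomorphism of algebras. -/
def leg2Hom {i j : Fin s} (hij : i ≠ j) : End2 r →ₐ[ℂ] Module.End ℂ (TP r s) :=
  Algebra.TensorProduct.lift (legHom i) (legHom j) (fun S T => leg_commute hij S T)

theorem leg2_tmul (i j : Fin s) (S T : Module.End ℂ (Grass (Fin r))) :
    leg2 i j (S ⊗ₜ T) = leg i S * leg j T := rfl

theorem leg2Hom_apply {i j : Fin s} (hij : i ≠ j) (S : End2 r) : leg2Hom hij S = leg2 i j S := by
  induction S using TensorProduct.induction_on with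
  | zero => rw [map_zero, map_zero]
  | tmul S T =>
    exact Algebra.TensorProduct.lift_tmul (legHom i) (legHom j) (fun S T => leg_commute hij S T) S T
  | add S T hS hT => rw [map_add, map_add, hS, hT]

end Legs

section ProdMap

variable {r s : ℕ} {J : Type} [DecidableEq J]

theorem substVar_xvar (g : Fin r → J) (a : Fin r) : substVar g (xvar a) = xvar (g a) := by
  simp [substVar, xvar, Fintype.linearCombination_apply, Pi.single_apply]

theorem pdx_substVar {g : Fin r → J} (hg : Function.Injective g) (b : Fin r)
    (p : Grass (Fin r)) : pdx (g b) (substVar g p) = substVar g (pdx b p) := by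
  induction p using grass_induction with
  | h1 => rw [map_one, pdx_one, pdx_one, map_zero]
  | hadd x y hx hy => simp only [map_add, hx, hy]
  | hsmul c y h => simp only [map_smul, h]
  | hx a y h =>
    rw [map_mul, substVar_xvar, pdx_xvar_mul, h, pdx_xvar_mul, map_sub, map_mul, substVar_xvar]
    simp only [hg.eq_iff]
    split_ifs <;> simp

theorem pdx_substVar_eq_zero {g : Fin r → J} {j : J} (hj : ∀ a, g a ≠ j) (p : Grass (Fin r)) :
    pdx j (substVar g p) = 0 := by
  induction p using grass_induction with
  | h1 => rw [map_one, pdx_one]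
  | hadd x y hx hy => simp only [map_add, hx, hy, add_zero]
  | hsmul c y h => simp only [map_smul, h, smul_zero]
  | hx a y h =>
    rw [map_mul, substVar_xvar, pdx_xvar_mul, h, if_neg (hj a).symm]
    simp

variable [Fintype J]

theorem pdx_ofFn_prod (j : J) : ∀ {s : ℕ} (q : Fin s → Grass J) (i : Fin s),
    (∀ l, l ≠ i → pdx j (q l) = 0) →
    pdx j (List.ofFn q).prod = (List.ofFn (fun l => if l < i then CliffordAlgebra.involute (q l)
      else if l = i then pdx j (q l) else q l)).prod := by
  intro s
  induction s with
  | zero => intro q i; exact i.elim0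
  | succ s ih =>
    intro q i h
    rw [List.ofFn_succ, List.ofFn_succ, List.prod_cons, List.prod_cons, pdx_mul]
    induction i using Fin.cases with
    | zero =>
      have h2 : ∀ {s : ℕ} (q : Fin s → Grass J), (∀ l, pdx j (q l) = 0) →
          pdx j (List.ofFn q).prod = 0 := by
        intro s
        induction s with
        | zero => intro q _; simp [pdx_one]
        | succ s ih' =>
          intro q hq
          rw [List.ofFn_succ, List.prod_cons, pdx_mul, hq, ih' _ fun l => hq _]
          simp
      rw [h2 _ fun l => h _ (Fin.succ_ne_zero l)]
      simp [Fin.succ_ne_zero]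
    | succ i =>
      rw [h 0 (Fin.succ_ne_zero i).symm, ih (fun l => q l.succ) i
        fun l hl => h _ (fun h' => hl (Fin.succ_injective _ h'))]
      simp

/-- In the product `p_1 ⋯ p_s` the derivation reaches only the `i`-th factor and twists the
preceding ones by parity; multiplication by the variable twists them once more, and the two twists
cancel. -/
theorem prodMap_leg {g : Fin s → Fin r → J} (hg : ∀ i a j b, g i a = g j b ↔ i = j ∧ a = b)
    (i : Fin s) (a b : Fin r) (t : TP r s) :
    prodMap g (leg i (gl a b) t) = (xop (g i a) * pdx (g i b)) (prodMap g t) := by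
  suffices h : (prodMap g).comp (leg i (gl a b)) = (xop (g i a) * pdx (g i b)).comp (prodMap g) from
    congrArg (fun T : TP r s →ₗ[ℂ] Grass J => T t) h
  refine PiTensorProduct.ext (MultilinearMap.ext fun p => ?_)
  simp only [LinearMap.compMultilinearMap_apply, LinearMap.comp_apply, leg_tprod, prodMap_tprod,
    Module.End.mul_apply, xop_apply]
  rw [pdx_ofFn_prod _ _ i, mul_ofFn_prod (xvar (g i a)) _ (fun l => CliffordAlgebra.involute
    (if l < i then CliffordAlgebra.involute (substVar (g l) (p l)) else
      if l = i then pdx (g i b) (substVar (g l) (p l)) else substVar (g l) (p l))) i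
    (fun l => xvar_mul_comm _ _)]
  · congr 2
    funext l
    rcases lt_trichotomy l i with h | rfl | h
    · simp [h, h.ne]
    · have hinj : Function.Injective (g l) := fun a b h => ((hg _ _ _ _).1 h).2
      simp only [lt_irrefl, if_false, if_true, Function.update_self, gl_eq, Module.End.mul_apply,
        xop_apply, map_mul, substVar_xvar, pdx_substVar hinj]
    · simp [h.not_gt, h.ne']
  · intro l hl
    exact pdx_substVar_eq_zero (fun a h => hl ((hg _ _ _ _).1 h).1) _

end ProdMap

/-! ### Duality between the tensor powers of `𝔛_r` and of `𝔛_s` -/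

/-! ### Gamma quotients behind the shifted normalization. -/

section Gamma

theorem NonInt.ne_neg_nat {t : ℂ} (ht : NonInt t) (m : ℕ) : t ≠ -m := fun h =>
  ht (-m) (by push_cast; exact h)

theorem Gamma_add_nat_eq_prod {z : ℂ} (hz : NonInt z) (n : ℕ) :
    (∏ q ∈ Finset.range n, (z + q)) * Complex.Gamma z = Complex.Gamma (z + n) := by
  induction n with
  | zero => simp
  | succ n ih =>
    have h : z + n ≠ 0 := by simpa using hz.add_ne_zero n
    rw [Finset.prod_range_succ, mul_right_comm, ih, mul_comm, ← Complex.Gamma_add_one _ h]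
    push_cast
    ring_nf

theorem Gamma_eq_prod_mul_Gamma_sub {z : ℂ} (hz : NonInt z) (n : ℕ) :
    (∏ q ∈ Finset.range n, (z - q)) * Complex.Gamma (z - n + 1) = Complex.Gamma (z + 1) := by
  induction n with
  | zero => simp
  | succ n ih =>
    have h : z - n ≠ 0 := by simpa [sub_eq_add_neg] using hz.add_ne_zero (-n)
    rw [← ih, Finset.prod_range_succ, mul_assoc, Complex.Gamma_add_one _ h]
    push_cast
    ring_nf

/-- The arguments of the Gamma functions pair up with integer differences, so the quotients are
finite products. For `m ≤ l` these are exactly the products in `shiftedNorm`; for `l < m` the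
pairing is different and leaves the extra factor `t / (t + l - m)`. -/
theorem gamma_eq_normC {t : ℂ} (ht : NonInt t) (l m : ℕ) :
    Complex.Gamma (t + l + 1) * Complex.Gamma (t - m)
        * (Complex.Gamma (t + (l - m) + 1) * Complex.Gamma t)⁻¹
      = normC (shiftedNorm t) t l m := by
  have ht0 : t ≠ 0 := by simpa using ht.add_ne_zero 0
  have htl : NonInt (t + l) := by simpa using ht.add_int l
  have htm : NonInt (t - m) := by simpa [sub_eq_add_neg] using ht.add_int (-m)
  have htlm : NonInt (t + (l - m)) := by simpa using ht.add_int (l - m)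
  have g1 : Complex.Gamma t ≠ 0 := Complex.Gamma_ne_zero ht.ne_neg_nat
  have g2 : Complex.Gamma (t - m) ≠ 0 := Complex.Gamma_ne_zero htm.ne_neg_nat
  have g3 : Complex.Gamma (t + (l - m)) ≠ 0 := Complex.Gamma_ne_zero htlm.ne_neg_nat
  have h0 : t + ((l : ℂ) - m) ≠ 0 := by simpa using htlm.add_ne_zero 0
  have hB : ∀ n : ℕ, ∏ q ∈ Finset.range n, (t - m + (q : ℂ)) ≠ 0 := fun n =>
    Finset.prod_ne_zero_iff.2 fun q _ => by simpa using htm.add_ne_zero q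
  rw [normC, shiftedNorm, Finset.prod_div_distrib, Complex.Gamma_add_one _ h0]
  by_cases hlm : m ≤ l
  · have hmin : min 0 ((l : ℝ) - m) = 0 := min_eq_left (sub_nonneg.2 (by exact_mod_cast hlm))
    have e1 := Gamma_eq_prod_mul_Gamma_sub htl m
    have e2 := Gamma_add_nat_eq_prod htm m
    rw [sub_add_cancel] at e2
    rw [add_sub_assoc, Complex.Gamma_add_one _ h0] at e1
    rw [hmin, min_eq_right hlm, ← e1, ← e2]
    have := hB m
    simp only [Complex.ofReal_zero, add_zero, div_self ht0, mul_one]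
    field_simp
  · have hmin : ((min 0 ((l : ℝ) - m) : ℝ) : ℂ) = l - m := by
      rw [min_eq_right (sub_nonpos.2 (by exact_mod_cast (not_le.1 hlm).le))]; push_cast; rfl
    have e1 := Gamma_eq_prod_mul_Gamma_sub htl l
    have e2 := Gamma_add_nat_eq_prod htm l
    rw [add_sub_cancel_right, Complex.Gamma_add_one _ ht0] at e1
    rw [show t - (m : ℂ) + l = t + (l - m) by ring] at e2
    rw [hmin, min_eq_left (not_le.1 hlm).le, ← e1, ← e2]
    have := hB l
    field_simp

end Gamma

/-! ### Functions of diagonal operators. -/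

section OpFun

variable {V : Type} [AddCommGroup V] [Module ℂ V]

theorem opFun_commute {A Y : Module.End ℂ V} (h : Commute Y A) (F : ℂ → ℂ) :
    Commute Y (opFun F A) := Commute.polynomial_aeval_right h _

/-- The idempotent `x_a ∂_a` has only the eigenvalues `0` and `1`, so a function of it is an affine
expression. -/
theorem opFun_gl {r : ℕ} (F : ℂ → ℂ) (a : Fin r) :
    opFun F (gl a a) = F 0 • 1 + (F 1 - F 0) • gl a a := by
  have hcar : IsCAR (fun (a : Fin r) (_ : Unit) => xop a) (fun a _ => pdx a) :=
    isCAR_grass (g := fun a _ => a) (by simp)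
  refine hcar.ext_weight fun v hv => ?_
  obtain ⟨ε, hε, he⟩ := hv a ()
  have he' : gl a a v = (ε : ℂ) • v := he
  rw [opFun_apply F _ he', LinearMap.add_apply, LinearMap.smul_apply, LinearMap.smul_apply, he',
    Module.End.one_apply]
  interval_cases ε
  · simp
  · rw [← sub_eq_zero]; push_cast; module

end OpFun

theorem map_ringInverse_algEquiv {A B : Type} [Ring A] [Ring B] [Algebra ℂ A] [Algebra ℂ B]
    (Φ : A ≃ₐ[ℂ] B) (x : A) : Φ (Ring.inverse x) = Ring.inverse (Φ x) := by
  by_cases h : IsUnit x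
  · obtain ⟨u, rfl⟩ := h
    have h1 : Φ (u : A) = (Units.map (Φ : A →* B) u : B) := rfl
    rw [Ring.inverse_unit, h1, Ring.inverse_unit]
    rfl
  · rw [Ring.inverse_non_unit _ h, Ring.inverse_non_unit, map_zero]
    intro h2
    exact h (by simpa using h2.map Φ.symm)

theorem ringInverse_eq {A : Type} [Ring A] {x y : A} (h : y * x = 1) (h' : x * y = 1) :
    Ring.inverse x = y :=
  Ring.inverse_unit (⟨x, y, h', h⟩ : Aˣ)

theorem commute_ringInverse {A : Type} [Ring A] {x y : A} (h : Commute x y) :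
    Commute x (Ring.inverse y) := by
  by_cases hy : IsUnit y
  · obtain ⟨u, rfl⟩ := hy
    rw [Ring.inverse_unit]
    exact h.units_inv_right
  · rw [Ring.inverse_non_unit _ hy]
    exact Commute.zero_right _

theorem list_prod_map_mul_of_commute {ι A : Type} [Ring A] (c b : ι → A) (l : List ι)
    (h : ∀ i ∈ l, ∀ j ∈ l, Commute (b i) (c j)) :
    (l.map fun i => c i * b i).prod = (l.map c).prod * (l.map b).prod := by
  induction l with
  | nil => simp
  | cons i l ih =>
    have ih' := ih fun i hi j hj => h i (List.mem_cons_of_mem _ hi) j (List.mem_cons_of_mem _ hj)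
    simp only [List.map_cons, List.prod_cons, ih']
    have h1 : Commute (b i) (l.map c).prod := Commute.list_prod_right _ _ (by
      intro x hx
      obtain ⟨j, hj, rfl⟩ := List.mem_map.1 hx
      exact h i List.mem_cons_self j (List.mem_cons_of_mem _ hj))
    rw [mul_assoc, ← mul_assoc (b i), h1.eq]
    simp only [mul_assoc]

/-- In `Bop` the list of indices is coerced to a list of complex numbers, and the coercion has this
monadic form. -/
theorem list_do_pure_natCast (l : List ℕ) :
    (do let a ← l; pure (a : ℂ)) = l.map (fun a : ℕ => (a : ℂ)) := by
  induction l <;> simp_all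

theorem inv_factorial_mul_prod (t u : ℂ) (q : ℕ) : (q.factorial : ℂ)⁻¹ *
    ((List.range q).map fun n : ℕ => (-t - ((n : ℂ) + 1) - u)⁻¹).prod = serCoeff t u q := by
  induction q with
  | zero => simp [serCoeff]
  | succ q ih =>
    rw [serCoeff, Finset.prod_range_succ, ← serCoeff, ← ih, List.range_succ, List.map_append,
      List.prod_append, Nat.factorial_succ, Nat.cast_mul, mul_inv, List.map_singleton,
      List.prod_singleton,
      show -(((q : ℂ) + 1) * (t + u + (q + 1))) = ((q : ℂ) + 1) * (-t - (q + 1) - u) by ring, mul_inv]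
    push_cast
    ring

/-- A space with an action of the anticommutation relations and with identifications with the
tensor powers of `𝔛_r` and of `𝔛_s`. -/
structure IsDuality {r s : ℕ} {V : Type} [AddCommGroup V] [Module ℂ V]
    (X P : Fin r → Fin s → Module.End ℂ V) (φ : TP r s ≃ₗ[ℂ] V) (φ' : TP s r ≃ₗ[ℂ] V) : Prop where
  car : IsCAR X P
  leg_left : ∀ i a b, φ.conjAlgEquiv ℂ (leg i (gl a b)) = X a i * P b i
  leg_right : ∀ a i j, φ'.conjAlgEquiv ℂ (leg a (gl i j)) = X a i * P a j

/-! ### Translation of both actions into the Fock space. -/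

section Duality

variable {r s : ℕ} {V : Type} [AddCommGroup V] [Module ℂ V]
  {X P : Fin r → Fin s → Module.End ℂ V} {φ : TP r s ≃ₗ[ℂ] V} {φ' : TP s r ≃ₗ[ℂ] V}

theorem conjAlgEquiv_apply_apply {W : Type} [AddCommGroup W] [Module ℂ W] (ψ : W ≃ₗ[ℂ] V)
    (T : Module.End ℂ W) (v : V) : ψ.conjAlgEquiv ℂ T v = ψ (T (ψ.symm v)) := rfl

theorem IsDuality.swap (h : IsDuality X P φ φ') :
    IsDuality (fun i a => X a i) (fun i a => P a i) φ' φ where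
  car := h.car.swap
  leg_left a i j := h.leg_right a i j
  leg_right i a b := h.leg_left i a b

theorem IsDuality.tot_left (h : IsDuality X P φ φ') (a b : Fin r) :
    φ.conjAlgEquiv ℂ (tot a b) = rowE X P a b := by
  simp only [tot, map_sum, h.leg_left, rowE]

theorem IsDuality.tot_right (h : IsDuality X P φ φ') (i j : Fin s) :
    φ'.conjAlgEquiv ℂ (tot i j) = colE X P i j := by
  simp only [tot, map_sum, h.leg_right, colE]

theorem IsDuality.leg2_Om (h : IsDuality X P φ φ') (i j : Fin s) :
    φ.conjAlgEquiv ℂ (leg2 i j (Om r)) = colOm X P i j := by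
  simp only [Om, map_sum, leg2_tmul, map_mul, h.leg_left, colOm]

/-- Acting in two different factors is an algebra homomorphism, so it suffices to follow the three
arguments of the polynomial. -/
theorem IsDuality.leg2_rElem (h : IsDuality X P φ φ') {i j : Fin s} (hij : i ≠ j)
    (ν : ℕ → ℕ → ℂ) (t : ℂ) : φ.conjAlgEquiv ℂ (leg2 i j (rElem r ν t))
      = rPoly r (normC ν t) t (colE X P i i) (colE X P j j) (colOm X P i j) := by
  have h1 := map_rPoly (A := End2 r) (B := Module.End ℂ V)
    (((φ.conjAlgEquiv ℂ).toAlgHom).comp (leg2Hom hij)) r (normC ν t) t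
    ((∑ c, gl c c) ⊗ₜ 1) (1 ⊗ₜ (∑ c, gl c c)) (Om r)
  have hl : ∀ S, (((φ.conjAlgEquiv ℂ).toAlgHom).comp (leg2Hom hij)) S
      = φ.conjAlgEquiv ℂ (leg2 i j S) := fun S => by
    rw [← leg2Hom_apply hij]; rfl
  have hL : φ.conjAlgEquiv ℂ (leg2 i j ((∑ c, gl c c) ⊗ₜ 1)) = colE X P i i := by
    rw [leg2_tmul, ← legHom_apply j, map_one, mul_one, map_sum, map_sum, colE]
    simp only [h.leg_left]
  have hM : φ.conjAlgEquiv ℂ (leg2 i j (1 ⊗ₜ (∑ c, gl c c))) = colE X P j j := by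
    rw [leg2_tmul, ← legHom_apply i, map_one, one_mul, map_sum, map_sum, colE]
    simp only [h.leg_left]
  rw [hl, hl, hl, hl, hL, hM, h.leg2_Om] at h1
  exact h1

/-- The right-hand side depends on `a` and `i` only through `x_{ai} ∂_{ai}`. Hence `λ_a^{-e_{aa}}`
in the factor `i` and `λ_a^{-e_{ii}}` in the factor `a` are the same operator, which matches the
middle products of the qKZ and dynamical operators. -/
theorem IsDuality.leg_opFun (h : IsDuality X P φ φ') (F : ℂ → ℂ) (a : Fin r) (i : Fin s) :
    φ.conjAlgEquiv ℂ (leg i (opFun F (gl a a))) = F 0 • 1 + (F 1 - F 0) • (X a i * P a i) := by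
  rw [opFun_gl, map_add, map_smul, map_smul, ← legHom_apply i 1, map_one, map_add, map_smul,
    map_smul, map_one, h.leg_left]

/-- The series is finite because `e_{ij}^{r+1} = 0`. On a weight vector the inverses act by scalars
whose product with `1/q!` is `serCoeff`, and `f^q e^q` is `lowerRaise`. -/
theorem IsDuality.Bop_right [Module.Finite ℂ V] (h : IsDuality X P φ φ') {i j : Fin s} (hij : i ≠ j)
    {t : ℂ} (ht : NonInt t) : φ'.conjAlgEquiv ℂ (Bop i j (-t))
      = rPoly r (fun _ _ => 1) t (colE X P i i) (colE X P j j) (colOm X P i j) := by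
  have hfin : φ'.conjAlgEquiv ℂ (Bop i j (-t)) = ∑ q ∈ Finset.range (r + 1),
      ((q.factorial : ℂ)⁻¹) • (colE X P j i ^ q * colE X P i j ^ q *
        ((List.range q).map (fun l : ℕ => Ring.inverse
          (algebraMap ℂ (Module.End ℂ V) (-t - ((l : ℂ) + 1)) - colE X P i i
            + colE X P j j))).prod) := by
    rw [Bop, finsum_eq_sum_of_support_subset (s := Finset.range (r + 1)), map_sum]
    · refine Finset.sum_congr rfl fun q _ => ?_
      rw [map_smul, map_mul, map_mul, map_pow, map_pow, h.tot_right, h.tot_right, map_list_prod,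
        list_do_pure_natCast, List.map_map, List.map_map]
      congr 4
      funext l
      simp only [Function.comp_apply]
      rw [map_ringInverse_algEquiv, map_add, map_sub, h.tot_right, h.tot_right, AlgEquiv.commutes]
    · intro q hq
      rw [Function.mem_support] at hq
      by_contra hq2
      apply hq
      have h0 : (tot i j : Module.End ℂ (TP s r)) ^ (r + 1) = 0 := by
        refine (φ'.conjAlgEquiv ℂ).injective ?_
        have := h.car.colE_pow_eq_zero hij
        rw [Fintype.card_fin] at this
        rw [map_pow, h.tot_right, this, map_zero]
      have h1 : (tot i j : Module.End ℂ (TP s r)) ^ q = 0 :=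
        pow_eq_zero_of_le (by simpa using hq2) h0
      rw [h1, mul_zero, zero_mul, smul_zero]
  rw [hfin]
  refine h.car.ext_weight fun v hv => ?_
  obtain ⟨l, hlr, hl⟩ := hv.colE_apply i
  obtain ⟨m, hmr, hm⟩ := hv.colE_apply j
  rw [Fintype.card_fin] at hlr hmr
  rw [rPoly_apply _ hlr hmr hl hm, one_smul, LinearMap.sum_apply]
  refine Finset.sum_congr rfl fun q _ => ?_
  have hinv : ∀ n : ℕ, Ring.inverse (algebraMap ℂ (Module.End ℂ V) (-t - ((n : ℂ) + 1))
      - colE X P i i + colE X P j j) v = (-t - ((n : ℂ) + 1) - (l - m))⁻¹ • v := by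
    intro n
    have hc : NonInt (-t - ((n : ℂ) + 1)) := by
      have := ht.neg.add_int (-(n + 1)); push_cast at this; rwa [← sub_eq_add_neg] at this
    have hT : ∀ v, IsWeight X P v → ∃ m : ℤ, (colE X P j j - colE X P i i) v = (m : ℂ) • v :=
      fun v hv => hv.diff_apply j i
    obtain ⟨e1, e2⟩ := h.car.opFun_shift hT hc
    rw [show algebraMap ℂ (Module.End ℂ V) (-t - ((n : ℂ) + 1)) - colE X P i i + colE X P j j
      = algebraMap ℂ (Module.End ℂ V) (-t - ((n : ℂ) + 1)) + (colE X P j j - colE X P i i) by abel,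
      ringInverse_eq e1 e2, opFun_apply (μ := (m : ℂ) - l)]
    · congr 2; ring
    · rw [LinearMap.sub_apply, hl, hm, sub_smul]
  have hprod : ∀ ns : List ℕ, ((ns.map (fun n : ℕ => Ring.inverse
      (algebraMap ℂ (Module.End ℂ V) (-t - ((n : ℂ) + 1)) - colE X P i i
        + colE X P j j))).prod) v
      = (ns.map fun n : ℕ => (-t - ((n : ℂ) + 1) - (l - m))⁻¹).prod • v := by
    intro ns
    induction ns with
    | nil => simp
    | cons n ns ih =>
      rw [List.map_cons, List.prod_cons, Module.End.mul_apply, ih, map_smul, hinv, List.map_cons,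
        List.prod_cons, smul_smul, mul_comm]
  rw [LinearMap.smul_apply, Module.End.mul_apply, hprod, map_smul, smul_smul,
    ← h.car.lower_pow_mul_raise_pow hij]
  congr 1
  exact inv_factorial_mul_prod _ _ _

/-- The operators `C` correspond to the normalizations `ν`. -/
def IsNormalizer (ν : ℂ → ℕ → ℕ → ℂ)
    (C : (r s : ℕ) → Fin r → Fin r → ℂ → Module.End ℂ (TP r s)) : Prop :=
  (∀ (r s : ℕ) (a b : Fin r) (t : ℂ), NonInt t → ∀ (l m : ℕ) (v : TP r s),
      tot a a v = (l : ℂ) • v → tot b b v = (m : ℂ) • v → C r s a b t v = normC (ν t) t l m • v) ∧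
    ∀ (r s : ℕ) (a b : Fin r) (t : ℂ) (Y : Module.End ℂ (TP r s)), (∀ c, Commute Y (tot c c)) →
      Commute Y (C r s a b t)

end Duality

instance {r s : ℕ} : Module.Finite ℂ (TP r s) :=
  let ⟨b⟩ := grass_basis (Fin r)
  Module.Finite.of_basis (Basis.piTensorProduct fun _ : Fin s => b)

/-! ### The two normalizations and the difference operators. -/

section Difference

theorem isNormalizer_simpleC : IsNormalizer unitNorm simpleC := by
  refine ⟨fun r s a b t _ l m v hl hm => ?_, fun r s a b t Y hY => ?_⟩
  · rw [simpleC, opFun_apply _ _ (μ := (l : ℂ) - m)]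
    · rw [normC, unitNorm, one_mul]
      simp
    · rw [LinearMap.sub_apply, hl, hm, sub_smul]
  · exact opFun_commute ((hY a).sub_right (hY b)) _

theorem isNormalizer_gammaC : IsNormalizer shiftedNorm gammaC := by
  refine ⟨fun r s a b t ht l m v hl hm => ?_, fun r s a b t Y hY => ?_⟩
  · rw [gammaC, Module.End.mul_apply, Module.End.mul_apply,
      opFun_apply _ (tot a a - tot b b) (μ := (l : ℂ) - m), map_smul, opFun_apply _ _ hm, map_smul,
      map_smul, opFun_apply _ _ hl, smul_smul, smul_smul, ← gamma_eq_normC ht]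
    · congr 1
      ring
    · rw [LinearMap.sub_apply, hl, hm, sub_smul]
  · exact ((opFun_commute (hY a) _).mul_right (opFun_commute (hY b) _)).mul_right
      (opFun_commute ((hY a).sub_right (hY b)) _)

variable {r s : ℕ} {V : Type} [AddCommGroup V] [Module ℂ V] [Module.Finite ℂ V]
  {X P : Fin r → Fin s → Module.End ℂ V} {φ : TP r s ≃ₗ[ℂ] V} {φ' : TP s r ≃ₗ[ℂ] V}
  {ν : ℂ → ℕ → ℕ → ℂ} {C : (r s : ℕ) → Fin r → Fin r → ℂ → Module.End ℂ (TP r s)}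

theorem IsDuality.Bop_commute_tot (h : IsDuality X P φ φ') {i j : Fin s} (hij : i ≠ j) {t : ℂ}
    (ht : NonInt t) (l : Fin s) :
    Commute (Bop i j (-t) : Module.End ℂ (TP s r)) (tot l l) := by
  refine (φ'.conjAlgEquiv ℂ).injective ?_
  rw [map_mul, map_mul, h.Bop_right hij ht, h.tot_right]
  exact (Commute.rPoly (h.car.colE_commute_colE _ _) (h.car.colE_commute_colE _ _)
    (h.car.colE_commute_colOm _ _ _) _ _ _).symm

/-- The `R`-matrix for `gl_r` is the operator `C B` for `gl_s`. -/
theorem IsDuality.leg2_rMatrix (h : IsDuality X P φ φ') (hC : IsNormalizer ν C) {i j : Fin s}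
    (hij : i ≠ j) {t : ℂ} (ht : NonInt t) :
    φ.conjAlgEquiv ℂ (leg2 i j (rMatrix r ν t))
      = φ'.conjAlgEquiv ℂ (C s r i j t * Bop i j (-t)) := by
  have hcomm : Commute (Bop i j (-t)) (C s r i j t) :=
    hC.2 s r i j t _ fun l => h.Bop_commute_tot hij ht l
  rw [rMatrix_eq_rElem r ht, h.leg2_rElem hij, ← hcomm.eq, map_mul, h.Bop_right hij ht]
  refine h.car.ext_weight fun v hv => ?_
  obtain ⟨l, hlr, hl⟩ := hv.colE_apply i
  obtain ⟨m, hmr, hm⟩ := hv.colE_apply j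
  rw [Fintype.card_fin] at hlr hmr
  have hCv : φ'.conjAlgEquiv ℂ (C s r i j t) v = normC (ν t) t l m • v := by
    rw [conjAlgEquiv_apply_apply, hC.1 s r i j t ht l m, map_smul, LinearEquiv.apply_symm_apply]
    · rw [← φ'.symm_apply_apply (tot i i _), ← conjAlgEquiv_apply_apply, h.tot_right, hl, map_smul]
    · rw [← φ'.symm_apply_apply (tot j j _), ← conjAlgEquiv_apply_apply, h.tot_right, hm, map_smul]
  rw [Module.End.mul_apply, hCv, map_smul, rPoly_apply _ hlr hmr hl hm, rPoly_apply _ hlr hmr hl hm,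
    one_smul]

theorem mem_above {a b : Fin r} : b ∈ above a ↔ a < b := by simp [above]

theorem mem_below {a b : Fin r} : b ∈ below a ↔ b < a := by simp [below]

/-- Replacing each `R` by `C B` reduces the claim to collecting the `C`'s in front. This is possible
because the `B`'s, the `C`'s and the middle product commute with all the weight operators `e_{ll}`,
hence with every `C`. -/
theorem IsDuality.Kop_eq (h : IsDuality X P φ φ') (hC : IsNormalizer ν C) (κ : ℂ) (i : Fin s)
    (p : Pt s r) (h₁ : ∀ j, i < j → NonInt (p.1 i - p.1 j))
    (h₂ : ∀ j, j < i → NonInt (p.1 j - p.1 i - κ)) :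
    φ.conjAlgEquiv ℂ (Kop ν κ i p)
      = φ'.conjAlgEquiv ℂ (normFactor C κ i p.1 * Xop (-κ) i (p.2, -p.1)) := by
  have e1 : ∀ j ∈ above i, Bop i j ((-p.1) i - (-p.1) j)
      = (Bop i j (-(p.1 i - p.1 j)) : Module.End ℂ (TP s r)) := fun j _ => by
    congr 1; simp only [Pi.neg_apply]; ring
  have e2 : ∀ j ∈ below i, Bop j i ((-p.1) j - (-p.1) i - -κ)
      = (Bop j i (-(p.1 j - p.1 i - κ)) : Module.End ℂ (TP s r)) := fun j _ => by
    congr 1; simp only [Pi.neg_apply]; ring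
  have hprod : normFactor C κ i p.1 * Xop (-κ) i (p.2, -p.1)
      = Ring.inverse ((above i).map fun j =>
          C s r i j (p.1 i - p.1 j) * Bop i j (-(p.1 i - p.1 j))).prod
        * ((List.finRange r).map fun a => leg a (opFun (fun μ => p.2 a ^ (-μ)) (gl i i))).prod
        * ((below i).map fun j =>
          C s r j i (p.1 j - p.1 i - κ) * Bop j i (-(p.1 j - p.1 i - κ))).prod := by
    set PC := ((above i).map fun j => C s r i j (p.1 i - p.1 j)).prod with hPC
    set PB := ((above i).map fun j =>
      (Bop i j (-(p.1 i - p.1 j)) : Module.End ℂ (TP s r))).prod with hPB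
    set PC' := ((below i).map fun j => C s r j i (p.1 j - p.1 i - κ)).prod with hPC'
    set D := ((List.finRange r).map fun a =>
      leg a (opFun (fun μ => p.2 a ^ (-μ)) (gl i i))).prod with hD
    have hCC : ∀ Y : Module.End ℂ (TP s r), (∀ c, Commute Y (tot c c)) → Commute Y PC :=
      fun Y hY => Commute.list_prod_right _ _ fun x hx => by
        obtain ⟨j, -, rfl⟩ := List.mem_map.1 hx
        exact hC.2 s r _ _ _ Y hY
    have hCC' : ∀ Y : Module.End ℂ (TP s r), (∀ c, Commute Y (tot c c)) → Commute Y PC' :=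
      fun Y hY => Commute.list_prod_right _ _ fun x hx => by
        obtain ⟨j, -, rfl⟩ := List.mem_map.1 hx
        exact hC.2 s r _ _ _ Y hY
    have hBt : ∀ l, Commute PB (tot l l) := fun l => Commute.list_prod_left _ _ fun x hx => by
      obtain ⟨j, hj, rfl⟩ := List.mem_map.1 hx
      rw [mem_above] at hj
      exact h.Bop_commute_tot hj.ne (h₁ j hj) l
    have hDt : ∀ l, Commute D (tot l l) := fun l => Commute.list_prod_left _ _ fun x hx => by
      obtain ⟨a, -, rfl⟩ := List.mem_map.1 hx
      refine (φ'.conjAlgEquiv ℂ).injective ?_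
      rw [map_mul, map_mul, h.tot_right, h.swap.leg_opFun]
      exact ((Commute.one_left _).smul_left _).add_left
        ((h.car.colE_commute_bil l i a a).symm.smul_left _)
    have htt : ∀ l m, Commute (tot l l : Module.End ℂ (TP s r)) (tot m m) := fun l m => by
      refine (φ'.conjAlgEquiv ℂ).injective ?_
      rw [map_mul, map_mul, h.tot_right, h.tot_right]
      exact h.car.colE_commute_colE _ _
    have hCt : ∀ l, Commute PC (tot l l) := fun l => (hCC _ fun m => htt l m).symm
    have c1 : Commute PC PB := (hCC _ hBt).symm
    have c2 : Commute (Ring.inverse PB) (Ring.inverse PC) := commute_ringInverse (commute_ringInverse c1).symm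
    have c3 : Commute (Ring.inverse PC) D := (commute_ringInverse (hCC _ hDt)).symm
    have c4 : Commute PC' (Ring.inverse PB) := commute_ringInverse (hCC' _ hBt).symm
    have c5 : Commute PC' (Ring.inverse PC) := commute_ringInverse (hCC' _ hCt).symm
    have c6 : Commute PC' D := (hCC' _ hDt).symm
    rw [normFactor, Xop, List.map_congr_left e1, List.map_congr_left e2,
      list_prod_map_mul_of_commute _ _ (above i) fun j hj l _ => hC.2 s r _ _ _ _ fun m =>
        h.Bop_commute_tot (mem_above.1 hj).ne (h₁ j (mem_above.1 hj)) m,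
      list_prod_map_mul_of_commute _ _ (below i) fun j hj l _ => hC.2 s r _ _ _ _ fun m =>
        h.Bop_commute_tot (mem_below.1 hj).ne (h₂ j (mem_below.1 hj)) m,
      ← hPC, ← hPB, ← hPC', ← hD, Ring.mul_inverse_rev' c1, c2.eq]
    set B' := ((below i).map fun j =>
      (Bop j i (-(p.1 j - p.1 i - κ)) : Module.End ℂ (TP s r))).prod
    have c7 : Commute PC' (Ring.inverse PC * Ring.inverse PB * D) :=
      (c5.mul_right c4).mul_right c6
    rw [← mul_assoc (Ring.inverse PC * Ring.inverse PB * D), ← c7.eq]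
    simp only [mul_assoc]
  rw [hprod, Kop]
  simp only [map_mul, map_ringInverse_algEquiv, map_list_prod, List.map_map]
  congr 1
  · congr 1
    · congr 2
      refine List.map_congr_left fun j hj => ?_
      rw [mem_above] at hj
      exact (h.leg2_rMatrix hC hj.ne (h₁ j hj))
    · congr 1
      refine List.map_congr_left fun a _ => ?_
      simp only [Function.comp_apply]
      rw [h.leg_opFun, h.swap.leg_opFun]
  · congr 1
    refine List.map_congr_left fun j hj => ?_
    rw [mem_below] at hj
    exact (h.leg2_rMatrix hC hj.ne (h₂ j hj))

theorem IsDuality.qKZ_eq (h : IsDuality X P φ φ') (hC : IsNormalizer ν C) (κ : ℂ) (i : Fin s)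
    (f : Pt s r → V) (p : Pt s r) (h₁ : ∀ j, i < j → NonInt (p.1 i - p.1 j))
    (h₂ : ∀ j, j < i → NonInt (p.1 j - p.1 i - κ)) :
    transfer φ (qKZ ν κ i) f p = transfer φ' (fun g q => normFactor C κ i q.1
      (changeVar (toLNegZ r s) (qDD (-κ) i) g q)) f p := by
  -- The shift of `-z_i` by `-κ` is the shift of `z_i` by `κ`.
  have hu : -Function.update (-p.1) i ((-p.1) i + -κ) = Function.update p.1 i (p.1 i + κ) := by
    funext j
    by_cases hj : j = i
    · subst hj; simp; ring
    · simp [hj]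
  have h3 := congrArg (fun T : Module.End ℂ V => T (f (Function.update p.1 i (p.1 i + κ), p.2)))
    (h.Kop_eq hC κ i p h₁ h₂)
  refine h3.trans ?_
  rw [← hu]
  rfl

end Difference

/-! ### The rational differential operators. -/

section Differential

section Calculus

variable {V W : Type} [AddCommGroup V] [Module ℂ V] [AddCommGroup W] [Module ℂ W]

theorem HasVecDeriv.map {g : ℂ → V} {v : V} {t : ℂ} (h : HasVecDeriv g v t) (T : V →ₗ[ℂ] W) :
    HasVecDeriv (fun u => T (g u)) (T v) t := fun ξ => h (ξ.comp T)

theorem HasVecDeriv.comp_neg {g : ℂ → V} {v : V} {t : ℂ} (h : HasVecDeriv g v t) :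
    HasVecDeriv (fun u => g (-u)) (-v) (-t) := fun ξ => by
  have h1 := h ξ
  rw [← neg_neg t] at h1
  have h2 := h1.comp (-t) (hasDerivAt_neg (-t))
  rw [mul_neg_one, ← map_neg] at h2
  exact h2

theorem HasVecDeriv.vecDeriv_eq {g : ℂ → V} {v : V} {t : ℂ} (h : HasVecDeriv g v t) :
    vecDeriv g t = v := by
  have h1 : ∃ v, HasVecDeriv g v t := ⟨v, h⟩
  rw [vecDeriv, dif_pos h1]
  exact h1.choose_spec.unique h

end Calculus

theorem sum_sum_eq_diag_add {M : Type} [AddCommMonoid M] {r : ℕ} (F : Fin r → Fin r → M) :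
    ∑ a, ∑ b, F a b = ∑ a, F a a + ∑ a, ∑ b ∈ Finset.univ.filter (fun b => a < b), F a b
      + ∑ a, ∑ b ∈ Finset.univ.filter (fun b => a < b), F b a := by
  have h1 : ∑ a, ∑ b ∈ Finset.univ.filter (fun b => a < b), F b a
      = ∑ a, ∑ b ∈ Finset.univ.filter (fun b => b < a), F a b := by
    simp only [Finset.sum_filter]
    exact Finset.sum_comm
  rw [h1, ← Finset.sum_add_distrib, ← Finset.sum_add_distrib]
  refine Finset.sum_congr rfl fun a _ => ?_
  simp only [Finset.sum_filter]
  have h2 : F a a = ∑ b, if a = b then F a b else 0 := by simp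
  rw [h2, ← Finset.sum_add_distrib, ← Finset.sum_add_distrib]
  refine Finset.sum_congr rfl fun b _ => ?_
  rcases lt_trichotomy a b with h | rfl | h
  · simp [h, h.ne, h.not_gt]
  · simp
  · simp [h, h.ne', h.not_gt]

variable {r s : ℕ} {V : Type} [AddCommGroup V] [Module ℂ V]
  {X P : Fin r → Fin s → Module.End ℂ V} {φ : TP r s ≃ₗ[ℂ] V} {φ' : TP s r ≃ₗ[ℂ] V}

/-- The signs of `κ` and of the derivative in `-z_i` cancel, and `e_{ij} e_{ji} - e_{ii} =
-Ω_{(ij)}` turns the dynamical pole terms into the KZ ones. -/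
theorem IsDuality.ratKZ_eq (h : IsDuality X P φ φ') (κ : ℂ) (i : Fin s) (f : Pt s r → V)
    (p : Pt s r) (hf : DiffFst i f p) :
    transfer φ (ratKZ κ i) f p
      = transfer φ' (changeVar (toLNegZ r s) (ratDD (-κ) i)) f p := by
  obtain ⟨v, hv⟩ := hf
  have h1 : pdFst i (φ.symm ∘ f) p = φ.symm v := (hv.map φ.symm.toLinearMap).vecDeriv_eq
  have h2 : pdSnd i ((φ'.symm ∘ f) ∘ (toLNegZ r s).symm) (toLNegZ r s p) = φ'.symm (-v) := by
    have h3 := (hv.comp_neg).map φ'.symm.toLinearMap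
    refine HasVecDeriv.vecDeriv_eq ?_
    have h5 : ∀ u, -Function.update (-p.1) i u = Function.update p.1 i (-u) := fun u => by
      funext j
      by_cases hj : j = i
      · subst hj; simp
      · simp [hj]
    simp only [← h5] at h3
    exact h3
  have h4 : transfer φ' (changeVar (toLNegZ r s) (ratDD (-κ) i)) f p
      = φ' ((-κ) • pdSnd i ((φ'.symm ∘ f) ∘ (toLNegZ r s).symm) (toLNegZ r s p)
        - ∑ a : Fin r, p.2 a • leg a (gl i i) (φ'.symm (f p))
        - ∑ j ∈ Finset.univ.erase i, (-p.1 i - -p.1 j)⁻¹ •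
          (tot i j * tot j i - tot i i : Module.End ℂ (TP s r)) (φ'.symm (f p))) := by
    have h5 : φ'.symm (f p) = ((φ'.symm ∘ f) ∘ (toLNegZ r s).symm) (toLNegZ r s p) := by
      simp only [Function.comp_apply, Equiv.symm_apply_apply]
    rw [h5]
    rfl
  rw [h4, h2]
  simp only [transfer, ratKZ, h1, map_sub, map_sum, map_smul, Function.comp_apply,
    LinearEquiv.apply_symm_apply, ← conjAlgEquiv_apply_apply, h.leg_left, h.leg_right, h.leg2_Om, map_mul,
    h.tot_right]
  congr 1
  · congr 1
    module
  · refine Finset.sum_congr rfl fun j hj => ?_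
    have hij : i ≠ j := (Finset.ne_of_mem_erase hj).symm
    rw [h.car.colE_mul_colE hij, sub_sub_cancel_left, LinearMap.neg_apply, smul_neg, ← neg_smul,
      ← inv_neg]
    congr 2
    ring

end Differential

/-! ### The trigonometric differential operators. -/

section Trigonometric

variable {r : ℕ} {β A : Type} [DecidableEq β] [Ring A] [Algebra ℂ A]

/-- The operator `Ω⁺_{(ij)}`. -/
def colOmPlus {β : Type} (X P : Fin r → β → A) (i j : β) : A :=
  (1 / 2 : ℂ) • ∑ a, X a i * P a i * (X a j * P a j)
    + ∑ a, ∑ b ∈ Finset.univ.filter (fun b => a < b), X a i * P b i * (X b j * P a j)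

theorem IsCAR.colE_sq {X P : Fin r → β → A} (h : IsCAR X P) (i : β) :
    colE X P i i ^ 2 = colE X P i i
      + (2 : ℂ) • ∑ a, ∑ b ∈ Finset.univ.filter (fun b => a < b),
        X a i * P a i * (X b i * P b i) := by
  rw [sq, colE, Finset.sum_mul_sum, sum_sum_eq_diag_add, add_assoc, two_smul]
  congr 1
  · exact Finset.sum_congr rfl fun a _ => h.number_idem a i
  · congr 1
    exact Finset.sum_congr rfl fun a _ => Finset.sum_congr rfl fun b _ => h.number_comm _ _ _ _

/-- The part of the trigonometric relation free of poles. The diagonal halves of `Ω⁺` cancel against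
the left sum except at `j = i`; the off-diagonal halves reorder into products over pairs `a < b`,
and those with `j = i` assemble into the square of `e_{ii}`. -/
theorem IsCAR.half_sum_rowE_sub [Fintype β] {X P : Fin r → β → A} (h : IsCAR X P) (i : β) :
    (1 / 2 : ℂ) • ∑ a, rowE X P a a * (X a i * P a i)
        - ∑ j ∈ Finset.univ.erase i, colOmPlus X P i j
      = colE X P i i - (1 / 2 : ℂ) • colE X P i i ^ 2
        + ∑ j, ∑ a, ∑ b ∈ Finset.univ.filter (fun b => a < b),
          X a i * P a j * (X b j * P b i) := by
  have h1 : ∑ a, rowE X P a a * (X a i * P a i) = colE X P i i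
      + ∑ j ∈ Finset.univ.erase i, ∑ a, X a i * P a i * (X a j * P a j) := by
    simp only [rowE, Finset.sum_mul]
    rw [Finset.sum_comm, ← Finset.add_sum_erase _ _ (Finset.mem_univ i), colE]
    congr 1
    · exact Finset.sum_congr rfl fun a _ => h.number_idem a i
    · exact Finset.sum_congr rfl fun j _ => Finset.sum_congr rfl fun a _ => h.number_comm _ _ _ _
  -- For `a ≠ b` and `j ≠ i` all contractions vanish, and interchanging `∂_{aj}` with `∂_{bi}`
  -- across `x_{bj}` takes three transpositions, whence the sign.
  have h2 : ∀ j ∈ Finset.univ.erase i, ∑ a, ∑ b ∈ Finset.univ.filter (fun b => a < b),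
      X a i * P a j * (X b j * P b i)
      = -∑ a, ∑ b ∈ Finset.univ.filter (fun b => a < b), X a i * P b i * (X b j * P a j) := by
    intro j hj
    rw [← Finset.sum_neg_distrib]
    refine Finset.sum_congr rfl fun a _ => ?_
    rw [← Finset.sum_neg_distrib]
    refine Finset.sum_congr rfl fun b hb => ?_
    have hab : a ≠ b := (Finset.mem_filter.1 hb).2.ne
    rw [mul_assoc, ← mul_assoc (P a j), h.px_ne fun e => hab e.1, neg_mul, mul_assoc, h.pp a j,
      mul_assoc (X a i) (P b i), ← mul_assoc (P b i),
      h.px_ne fun e => (Finset.ne_of_mem_erase hj) e.2.symm]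
    simp only [mul_neg, neg_mul, neg_neg, mul_assoc]
  rw [← Finset.add_sum_erase _ _ (Finset.mem_univ i), Finset.sum_congr rfl h2, h1, h.colE_sq]
  simp only [colOmPlus, Finset.sum_add_distrib, ← Finset.smul_sum, Finset.sum_neg_distrib]
  module

theorem OmPlus_add_OmMinus (r : ℕ) : OmPlus r + OmMinus r = Om r := by
  rw [Om, sum_sum_eq_diag_add, OmPlus, OmMinus]
  set D := ∑ a : Fin r, gl a a ⊗ₜ[ℂ] gl a a
  have h : D = (1 / 2 : ℂ) • D + (1 / 2 : ℂ) • D := by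
    rw [← add_smul]; norm_num
  conv_rhs => rw [h]
  abel

variable {r s : ℕ} {V : Type} [AddCommGroup V] [Module ℂ V]
  {X P : Fin r → Fin s → Module.End ℂ V} {φ : TP r s ≃ₗ[ℂ] V} {φ' : TP s r ≃ₗ[ℂ] V}

theorem IsDuality.leg2_OmPlus (h : IsDuality X P φ φ') (i j : Fin s) :
    φ.conjAlgEquiv ℂ (leg2 i j (OmPlus r)) = colOmPlus X P i j := by
  simp only [OmPlus, map_add, map_smul, map_sum, leg2_tmul, map_mul, h.leg_left, colOmPlus]

theorem IsDuality.leg2_OmMinus (h : IsDuality X P φ φ') (i j : Fin s) :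
    φ.conjAlgEquiv ℂ (leg2 i j (OmMinus r)) = colOm X P i j - colOmPlus X P i j := by
  rw [eq_sub_iff_add_eq', ← h.leg2_OmPlus, ← h.leg2_Om, ← map_add, ← map_add, OmPlus_add_OmMinus]

/-- The pole terms match as in the rational case and the rest is `IsCAR.half_sum_rowE_sub`. Its
summand `e_{ii} = ∑_a x_{ai} ∂_{ai}` is absorbed by the shift of `-λ` by `1`. -/
theorem IsDuality.trigKZ_eq (h : IsDuality X P φ φ') (κ : ℂ) (i : Fin s) (f : Pt s r → V)
    (p : Pt s r) (hp : ∀ j, j ≠ i → p.1 i ≠ p.1 j) (hf : DiffFst i f p) :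
    transfer φ (trigKZ κ i) f p
      = -transfer φ' (changeVar (toOneSubLZ r s) (trigDD (-κ) i)) f p := by
  obtain ⟨v, hv⟩ := hf
  have h1 : pdFst i (φ.symm ∘ f) p = φ.symm v := (hv.map φ.symm.toLinearMap).vecDeriv_eq
  have h2 : pdSnd i ((φ'.symm ∘ f) ∘ (toOneSubLZ r s).symm) (toOneSubLZ r s p) = φ'.symm v := by
    have h3 := hv.map φ'.symm.toLinearMap
    refine HasVecDeriv.vecDeriv_eq ?_
    have h5 : -((1 : Fin r → ℂ) - p.2) + 1 = p.2 := by abel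
    have h6 : HasVecDeriv (fun u => φ'.symm.toLinearMap (f (Function.update p.1 i u,
        -((1 : Fin r → ℂ) - p.2) + 1))) (φ'.symm.toLinearMap v) (p.1 i) := by
      rw [h5]; exact h3
    exact h6
  have h4 : transfer φ' (changeVar (toOneSubLZ r s) (trigDD (-κ) i)) f p
      = φ' ((-κ * p.1 i) • pdSnd i ((φ'.symm ∘ f) ∘ (toOneSubLZ r s).symm) (toOneSubLZ r s p)
        + (1 / 2 : ℂ) • (tot i i ^ 2) (φ'.symm (f p))
        - ∑ a : Fin r, (1 - p.2 a) • leg a (gl i i) (φ'.symm (f p))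
        - ∑ j : Fin s, ∑ a : Fin r, ∑ b ∈ Finset.univ.filter (fun b => a < b),
          (leg a (gl i j) * leg b (gl j i)) (φ'.symm (f p))
        - ∑ j ∈ Finset.univ.erase i, (p.1 j / (p.1 i - p.1 j)) •
          (tot i j * tot j i - tot i i : Module.End ℂ (TP s r)) (φ'.symm (f p))) := by
    have h5 : φ'.symm (f p) = ((φ'.symm ∘ f) ∘ (toOneSubLZ r s).symm) (toOneSubLZ r s p) := by
      simp only [Function.comp_apply, Equiv.symm_apply_apply]
    rw [h5]
    rfl
  have h5 := congrArg (fun T : Module.End ℂ V => T (f p)) (h.car.half_sum_rowE_sub i)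
  rw [h4, h2]
  simp only [transfer, trigKZ, h1, map_sub, map_add, map_sum, map_smul, Function.comp_apply,
    LinearEquiv.apply_symm_apply, ← conjAlgEquiv_apply_apply, h.leg_left, h.leg_right, h.leg2_OmPlus,
    h.leg2_OmMinus, map_mul, map_pow, h.tot_left, h.tot_right, AlgEquiv.commutes]
  have h6 : ∀ j ∈ Finset.univ.erase i, (p.1 j / (p.1 i - p.1 j)) •
      (colE X P i j * colE X P j i - colE X P i i) (f p)
      = -((p.1 j / (p.1 i - p.1 j)) • colOm X P i j (f p)) := fun j hj => by
    rw [h.car.colE_mul_colE (Finset.ne_of_mem_erase hj).symm, sub_sub_cancel_left,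
      LinearMap.neg_apply, smul_neg]
  -- Separates the pole: `(z_i Ω⁺ + z_j Ω⁻) / (z_i - z_j) = Ω⁺ + z_j / (z_i - z_j) Ω`.
  have h7 : ∀ j ∈ Finset.univ.erase i, (p.1 i - p.1 j)⁻¹ •
      (p.1 i • colOmPlus X P i j + p.1 j • (colOm X P i j - colOmPlus X P i j)) (f p)
      = colOmPlus X P i j (f p) + (p.1 j / (p.1 i - p.1 j)) • colOm X P i j (f p) := fun j hj => by
    have h8 : p.1 i - p.1 j ≠ 0 := sub_ne_zero.2 (hp j (Finset.ne_of_mem_erase hj))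
    rw [LinearMap.add_apply, LinearMap.smul_apply, LinearMap.smul_apply, LinearMap.sub_apply]
    match_scalars <;> field_simp
    ring
  have h8 : ∀ a, ((algebraMap ℂ (Module.End ℂ V) (p.2 a) - (1 / 2 : ℂ) • rowE X P a a)
      * (X a i * P a i)) (f p) = p.2 a • (X a i * P a i) (f p)
        - (1 / 2 : ℂ) • (rowE X P a a * (X a i * P a i)) (f p) := fun a => by
    rw [sub_mul, smul_mul_assoc, ← Algebra.smul_def]
    rfl
  have h9 : ∀ a, (1 - p.2 a) • (X a i * P a i) (f p)
      = (X a i * P a i) (f p) - p.2 a • (X a i * P a i) (f p) := fun a => by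
    rw [sub_smul, one_smul]
  simp only [LinearMap.sub_apply, LinearMap.add_apply, LinearMap.smul_apply,
    LinearMap.sum_apply] at h5
  have h10 : colE X P i i (f p) = ∑ a, (X a i * P a i) (f p) := by
    rw [colE, LinearMap.sum_apply]
  rw [Finset.sum_congr rfl h6, Finset.sum_congr rfl h7, Finset.sum_congr rfl fun a _ => h8 a,
    Finset.sum_congr rfl fun a _ => h9 a]
  simp only [Finset.sum_add_distrib, Finset.sum_sub_distrib, Finset.sum_neg_distrib,
    ← Finset.smul_sum, ← h10]
  linear_combination (norm := module) h5

end Trigonometric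

theorem isDuality_phi (k n : ℕ) : IsDuality
    (fun (a : Fin k) (i : Fin n) => xop (a, i)) (fun a i => pdx (a, i)) (phi1 k n) (phi2 k n) where
  car := isCAR_grass (g := fun a i => (a, i)) fun a i b j => Prod.mk_inj
  leg_left i a b := LinearMap.ext fun v => by
    rw [conjAlgEquiv_apply_apply]
    refine (prodMap_leg (g := fun (i : Fin n) (a : Fin k) => (a, i)) (fun i a j b => ?_) i a b
      ((phi1 k n).symm v)).trans ?_
    · rw [Prod.mk_inj, and_comm]
    · exact congrArg _ ((phi1 k n).apply_symm_apply v)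
  leg_right a i j := LinearMap.ext fun v => by
    rw [conjAlgEquiv_apply_apply]
    refine (prodMap_leg (g := fun (a : Fin k) (i : Fin n) => (a, i))
      (fun a i b j => Prod.mk_inj) a i j ((phi2 k n).symm v)).trans ?_
    exact congrArg _ ((phi2 k n).apply_symm_apply v)

end

end GLDuality

open GLDuality in
theorem theorem4p4 (k n : ℕ) (κ : ℂ) (hκ : κ ≠ 0) :
    -- the `R`-matrices for `gl_k` and `gl_n`, in either normalization, exist and are unique
    (∀ ν ∈ ({unitNorm, shiftedNorm} : Set (ℂ → ℕ → ℕ → ℂ)), ∀ t : ℂ, NonInt t →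
      (∃! S, IsRMatrix k t (ν t) S) ∧ (∃! S, IsRMatrix n t (ν t) S)) ∧
    -- rational KZ for `gl_k`, rational DD for `gl_n`
    (∀ (i : Fin n) (f : Pt n k → PP k n) (p : Pt n k),
      (∀ j, j ≠ i → p.1 i ≠ p.1 j) → DiffFst i f p →
      transfer (phi1 k n) (ratKZ κ i) f p
        = transfer (phi2 k n) (changeVar (toLNegZ k n) (ratDD (-κ) i)) f p) ∧
    -- rational KZ for `gl_n`, rational DD for `gl_k`
    (∀ (a : Fin k) (f : Pt n k → PP k n) (p : Pt n k),
      (∀ b, b ≠ a → p.2 a ≠ p.2 b) → DiffSnd a f p →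
      transfer (phi2 k n) (changeVar (toLZ k n) (ratKZ κ a)) f p
        = transfer (phi1 k n) (changeVar (toZNegL k n) (ratDD (-κ) a)) f p) ∧
    -- trigonometric KZ for `gl_k`, trigonometric DD for `gl_n`
    (∀ (i : Fin n) (f : Pt n k → PP k n) (p : Pt n k),
      (∀ j, j ≠ i → p.1 i ≠ p.1 j) → DiffFst i f p →
      transfer (phi1 k n) (trigKZ κ i) f p
        = -transfer (phi2 k n) (changeVar (toOneSubLZ k n) (trigDD (-κ) i)) f p) ∧
    -- trigonometric KZ for `gl_n`, trigonometric DD for `gl_k`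
    (∀ (a : Fin k) (f : Pt n k → PP k n) (p : Pt n k),
      (∀ b, b ≠ a → p.2 a ≠ p.2 b) → DiffSnd a f p →
      transfer (phi2 k n) (changeVar (toLZ k n) (trigKZ κ a)) f p
        = -transfer (phi1 k n) (changeVar (toOneSubZL k n) (trigDD (-κ) a)) f p) ∧
    -- the two normalizations of the `R`-matrix, with the corresponding factors `C`
    (∀ ν C, (ν = shiftedNorm ∧ C = gammaC) ∨ (ν = unitNorm ∧ C = simpleC) →
      -- `R`-matrices for `gl_k`, operators `B` for `gl_n`
      (∀ (i j : Fin n) (t : ℂ) (v : PP k n), i ≠ j → NonInt t →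
        phi1 k n (leg2 i j (rMatrix k ν t) ((phi1 k n).symm v))
          = phi2 k n (C n k i j t (Bop i j (-t) ((phi2 k n).symm v)))) ∧
      -- `R`-matrices for `gl_n`, operators `B` for `gl_k`
      (∀ (a b : Fin k) (t : ℂ) (v : PP k n), a ≠ b → NonInt t →
        phi2 k n (leg2 a b (rMatrix n ν t) ((phi2 k n).symm v))
          = phi1 k n (C k n a b t (Bop a b (-t) ((phi1 k n).symm v)))) ∧
      -- qKZ for `gl_k`, qDD for `gl_n`
      (∀ (i : Fin n) (f : Pt n k → PP k n) (p : Pt n k),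
        (∀ j, i < j → NonInt (p.1 i - p.1 j)) → (∀ j, j < i → NonInt (p.1 j - p.1 i - κ)) →
        (∀ a, p.2 a ≠ 0) →
        transfer (phi1 k n) (qKZ ν κ i) f p
          = transfer (phi2 k n) (fun g q => normFactor C κ i q.1
              (changeVar (toLNegZ k n) (qDD (-κ) i) g q)) f p) ∧
      -- qKZ for `gl_n`, qDD for `gl_k`
      (∀ (a : Fin k) (f : Pt n k → PP k n) (p : Pt n k),
        (∀ b, a < b → NonInt (p.2 a - p.2 b)) → (∀ b, b < a → NonInt (p.2 b - p.2 a - κ)) →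
        (∀ i, p.1 i ≠ 0) →
        transfer (phi2 k n) (changeVar (toLZ k n) (qKZ ν κ a)) f p
          = transfer (phi1 k n) (fun g q => normFactor C κ a q.2
              (changeVar (toZNegL k n) (qDD (-κ) a) g q)) f p)) := by
  have h := isDuality_phi k n
  refine ⟨fun ν _ t ht => ⟨existsUnique_isRMatrix k ht _, existsUnique_isRMatrix n ht _⟩,
    fun i f p _ hf => h.ratKZ_eq κ i f p hf,
    -- Interchanging the two algebras and the two groups of variables turns each relation into its
    -- mirror image; the changes of variables then agree by definition.
    fun a f p _ hf => h.swap.ratKZ_eq κ a (f ∘ Prod.swap) p.swap hf,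
    fun i f p hp hf => h.trigKZ_eq κ i f p hp hf,
    fun a f p hp hf => h.swap.trigKZ_eq κ a (f ∘ Prod.swap) p.swap hp hf, fun ν C hνC => ?_⟩
  have hC : IsNormalizer ν C := by
    rcases hνC with ⟨rfl, rfl⟩ | ⟨rfl, rfl⟩
    · exact isNormalizer_gammaC
    · exact isNormalizer_simpleC
  exact ⟨fun i j t v hij ht => congrArg (fun T : Module.End ℂ (PP k n) => T v)
      (h.leg2_rMatrix hC hij ht),
    fun a b t v hab ht => congrArg (fun T : Module.End ℂ (PP k n) => T v)
      (h.swap.leg2_rMatrix hC hab ht),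
    fun i f p h₁ h₂ _ => h.qKZ_eq hC κ i f p h₁ h₂,
    fun a f p h₁ h₂ _ => h.swap.qKZ_eq hC κ a (f ∘ Prod.swap) p.swap h₁ h₂⟩
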